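/- Let $n\ge 3$ be an integer, $\omega_n=e^{2\pi i/n}$, and let $V_n=\{re^{i\theta}: r>0,\ 0<\theta<2\pi/n\}$. For real $y<1$ (with also $y>-1$ if $n$ is even) put $F_n(y)=\int_0^y (1-x^n)^{-(n-1)/n}\,dx$, let $\pi_n=2\int_0^1(1-x^n)^{-(n-1)/n}\,dx$, and for $z\in V_n$ put $F_n(z)=\int_0^z (1-\zeta^n)^{-(n-1)/n}\,d\zeta$, where the power is the branch continuous on $V_n$ with value $1$ at $0$. Let $A_n=\pi_n/2$, $B_n=\omega_nA_n$, $P_n=\left(\frac{\pi_n}{4}\sec\frac{\pi}{n}\right)e^{i\pi/n}$, and let $\Pi_n$ be the closed polygonal region with successive vertices $0,A_n,P_n,B_n$ (for $n=4$ the vertex $P_4$ is degenerate). Let $\Omega_n$ be the interior of $\bigcup_{k=0}^{n-1}\omega_n^k\Pi_n$ and $\Sigma_n=\mathbb C\setminus\bigcup_{k=0}^{n-1}\omega_n^k[1,\infty)$. Then $F_n$ maps $V_n$ bijectively onto the interior of $\Pi_n$. Let $\sin_n$ be the inverse map on the interior of $\Pi_n$, extended by successive Schwarz reflections across the segments $[0,\omega_n^{k}A_n)$,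 $k=1,\dots,n-1$, to the interiors of $\omega_n\Pi_n,\dots,\omega_n^{n-1}\Pi_n$, and by continuity to the rest of $\Omega_n$. This is an analytic continuation of the real function $\sin_n$, that is, $F_n(y)\in\Omega_n$ and $\sin_n(F_n(y))=y$ for all real $y<1$ (with $y>-1$ if $n$ is even). Moreover: 1. $\sin_n:\Omega_n\to\Sigma_n$ is a bijective analytic map with analytic inverse, i.e. a conformal equivalence. 2. For each $k\in\{0,\dots,n-1\}$, the point $\omega_n^kP_n$ lies on $\partial\Omega_n$, and $|\sin_n z|\to\infty$ as $z\to\omega_n^kP_n$ in $\Omega_n$. 3. $\sin_n$ extends continuously to $\overline{\Omega_n}\setminus\{\omega_n^kP_n\}_{k=0}^{n-1}$. Each $\omega_n^kA_n$ lies on $\partial\Omega_n$ and is none of the points $\omega_n^jP_n$, and the extension maps it to $\omega_n^k$. The extension maps $\partial\Omega_n\setminus\{\omega_n^kA_n,\omega_n^kP_n\}_{k=0}^{n-1}$ into $\bigcup_{k=0}^{n-1}\omega_n^k(1,\infty)$, and every point of the latter set has exactly two preimages in the former. -/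

import Mathlib

namespace GenSine

open Complex ComplexConjugate

noncomputable section

/-- The real function `F_n(y) = ∫₀^y (1 - x^n)^{-(n-1)/n} dx`. -/
def realF (n : ℕ) (y : ℝ) : ℝ :=
  ∫ x in (0 : ℝ)..y, 1 / (1 - x ^ n) ^ (((n : ℝ) - 1) / n)

/-- The constant `π_n`, fixed by `F_n(1) = π_n / 2`. -/
def piN (n : ℕ) : ℝ := 2 * realF n 1

/-- The primitive root of unity `ω_n = e^{2πi/n}`. -/
def omega (n : ℕ) : ℂ := exp (2 * Real.pi * I / n)

/-- The open wedge `V_n = {r e^{iθ} : r > 0, 0 < θ < 2π/n}`. -/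
def wedge (n : ℕ) : Set ℂ :=
  {z | ∃ r θ : ℝ, 0 < r ∧ 0 < θ ∧ θ < 2 * Real.pi / n ∧ z = r * exp (θ * I)}

/-- The kernel `K_n(z) = (1 - z^n)^{-(n-1)/n}`, principal branch. If `z` lies in `V_n` then
`1 - z^n` is not in `(-∞, 1]`, so this is the branch continuous on `V_n` with `K_n(0) = 1`. -/
def K (n : ℕ) (z : ℂ) : ℂ := 1 / (1 - z ^ n) ^ (((n : ℂ) - 1) / n)

/-- `F_n(z) = ∫₀^z K_n(ζ) dζ`, the integral being taken along the segment from `0` to `z`. -/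
def F (n : ℕ) (z : ℂ) : ℂ := z * ∫ t in (0 : ℝ)..1, K n (t * z)

/-- The vertex `A_n = π_n / 2`. -/
def A (n : ℕ) : ℂ := ((piN n / 2 : ℝ) : ℂ)

/-- The vertex `B_n = ω_n A_n`. -/
def B (n : ℕ) : ℂ := omega n * A n

/-- The point `P_n` on the bisector of the angle `A_n O B_n` for which the angle `O A_n P_n`
equals `π/n`, that is `P_n = (π_n / 4) sec(π/n) e^{iπ/n}`. -/
def P (n : ℕ) : ℂ :=
  ((piN n / 4 * (1 / Real.cos (Real.pi / n)) : ℝ) : ℂ) * exp (Real.pi * I / n)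

/-- The closed polygonal region `Π_n` with successive vertices `O, A_n, P_n, B_n`, as the union
of the two triangles into which its diagonal `O P_n` cuts it (it need not be convex). -/
def quad (n : ℕ) : Set ℂ :=
  convexHull ℝ {0, A n, P n} ∪ convexHull ℝ {0, P n, B n}

/-- The rotated copy `ω_n^k S` of a set `S`. -/
def rot (n k : ℕ) (S : Set ℂ) : Set ℂ := (fun z => omega n ^ k * z) '' S

/-- The domain `Ω_n`, the interior of the union of the `n` rotated copies of `Π_n`. -/
def Omega (n : ℕ) : Set ℂ := interior (⋃ k ∈ Finset.range n, rot n k (quad n))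

/-- The closed slits: the union of the rays `ω_n^k [1, ∞)`. -/
def slits (n : ℕ) : Set ℂ :=
  ⋃ k ∈ Finset.range n, rot n k ((fun x : ℝ => (x : ℂ)) '' Set.Ici 1)

/-- The open slits: the union of the rays `ω_n^k (1, ∞)`. -/
def openSlits (n : ℕ) : Set ℂ :=
  ⋃ k ∈ Finset.range n, rot n k ((fun x : ℝ => (x : ℂ)) '' Set.Ioi 1)

/-- The slit plane `Σ_n`. -/
def Sigma (n : ℕ) : Set ℂ := (slits n)ᶜ

/-- The points `ω_n^k A_n`. -/
def vertsA (n : ℕ) : Set ℂ := {z | ∃ k < n, z = omega n ^ k * A n}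

/-- The points `ω_n^k P_n`. -/
def vertsP (n : ℕ) : Set ℂ := {z | ∃ k < n, z = omega n ^ k * P n}

/-- Reflection across the real line spanned by `ω_n^k`. -/
def reflection (n k : ℕ) (z : ℂ) : ℂ := omega n ^ (2 * k) * conj z

/-- The function `sin_n` on the open piece `ω_n^k (interior Π_n)`. For `k = 0` it is the inverse
of `F_n` on `V_n`; the piece with index `k + 1` is obtained from the one with index `k` by
Schwarz reflection across the side of the `k`-th piece issuing from `O` in direction
`ω_n^(k+1)`. -/
def sinPiece (n : ℕ) : ℕ → ℂ → ℂ
  | 0 => fun w => Function.invFunOn (F n) (wedge n) w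
  | k + 1 => fun w => reflection n (k + 1) (sinPiece n k (reflection n (k + 1) w))

/-- The union of the `n` (pairwise disjoint) open pieces `ω_n^k (interior Π_n)`. -/
def pieces (n : ℕ) : Set ℂ := ⋃ k ∈ Finset.range n, rot n k (interior (quad n))

open Classical in
/-- The function on the union of the open pieces that is `sinPiece n k` on the `k`-th one. -/
def sinOnPieces (n : ℕ) (w : ℂ) : ℂ :=
  if h : ∃ k, k < n ∧ w ∈ rot n k (interior (quad n)) then sinPiece n (Nat.find h) w else 0

/-- The function `sin_n` on `Ω_n`: on the common sides of neighbouring pieces its value is the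
limit from within the open pieces. -/
def sinN (n : ℕ) : ℂ → ℂ := extendFrom (pieces n) (sinOnPieces n)

end

end GenSine

namespace GenSine

open Complex ComplexConjugate

noncomputable section

open MeasureTheory Filter Topology

/-! By the dihedral symmetry generated by `z ↦ omega n * z` and conjugation, everything reduces to
one closed sector, `-π/n ≤ arg z ≤ 0`. On it `1 - z^n` stays in the closed upper half-plane, where
the principal argument is continuous away from `0`. Hence `K n` is continuous up to the edges,
except at `1`, where its singularity is integrable.

On the sector `K n` takes its arguments in an interval of length `alpha n * π < π`, so a fixed
rotation gives it positive real part. Integrating along segments gives a quantitative injectivity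
estimate (`F_mono_sector`, `exists_norm_F_sub_ge`), which also makes the inverse continuous.

`F n` maps `[0,1]`, `[1,∞)` and the ray `arg z = -π/n` to straight segments, and on arcs of radius
`R` it varies by `O(1/R)`. The two unbounded edges therefore have images meeting at one limit point,
which is `conj (P n)`; this evaluates the improper integrals without Beta functions (`limits_eq`).
The image of the open sector is open and bounded, with boundary in the sides of a triangle, so it is
exactly the open triangle (`F_image_sectorInt`). The closed sector maps onto the closed triangle
minus `conj (P n)` (`F_image_sector`).

To unfold, `fold` sends a point to its representative in the sector, and the homogeneous function
`lam` turns `Omega n`, its closure and its frontier into `lam < level`, `lam ≤ level`, `lam =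
level`. With `phi = F/z`, the formula `w / phi` (conjugating `phi` on alternate sectors) defines
`sinExt` on the closed region without the infinite vertices. It inverts `F n` on the slit plane and
commutes with the symmetries, so it agrees with the iterated reflections defining `sinN`. The
boundary statements reduce to the fact that the outer side of the triangle is the image of `[1,∞)`,
once from each side of the slit. -/

/-- The exponent `(n - 1) / n`. -/
def alpha (n : ℕ) : ℝ := ((n : ℝ) - 1) / n

lemma alpha_pos {n : ℕ} (hn : 3 ≤ n) : 0 < alpha n := by
  have : (3 : ℝ) ≤ n := by exact_mod_cast hn
  unfold alpha; apply div_pos <;> linarith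

lemma alpha_lt_one {n : ℕ} (hn : 3 ≤ n) : alpha n < 1 := by
  have : (3 : ℝ) ≤ n := by exact_mod_cast hn
  unfold alpha; rw [div_lt_one] <;> linarith

lemma alpha_mul_pi {n : ℕ} (hn : 3 ≤ n) : alpha n * Real.pi = Real.pi - Real.pi / n := by
  have : (3 : ℝ) ≤ n := by exact_mod_cast hn
  unfold alpha; field_simp

lemma K_eq_alpha (n : ℕ) (z : ℂ) : K n z = 1 / (1 - z ^ n) ^ ((alpha n : ℝ) : ℂ) := by
  simp [K, alpha]

lemma norm_K (n : ℕ) (z : ℂ) : ‖K n z‖ = 1 / ‖1 - z ^ n‖ ^ alpha n := by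
  rw [K_eq_alpha, norm_div, norm_one, norm_cpow_real]

lemma pi_div_pos {n : ℕ} (hn : 3 ≤ n) : 0 < Real.pi / n := by
  have : (3 : ℝ) ≤ n := by exact_mod_cast hn
  positivity

lemma pi_div_le {n : ℕ} (hn : 3 ≤ n) : Real.pi / n ≤ Real.pi / 3 := by
  have : (3 : ℝ) ≤ n := by exact_mod_cast hn
  gcongr

lemma natCast_mul_pi_div {n : ℕ} (hn : 3 ≤ n) : (n : ℝ) * (Real.pi / n) = Real.pi := by
  have : (3 : ℝ) ≤ n := by exact_mod_cast hn
  field_simp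

lemma sin_pos {n : ℕ} (hn : 3 ≤ n) : 0 < Real.sin (Real.pi / n) :=
  Real.sin_pos_of_pos_of_lt_pi (pi_div_pos hn) (by linarith [pi_div_le hn, Real.pi_pos])

lemma half_le_cos {n : ℕ} (hn : 3 ≤ n) : 1 / 2 ≤ Real.cos (Real.pi / n) := by
  rw [← Real.cos_pi_div_three]
  exact Real.cos_le_cos_of_nonneg_of_le_pi (pi_div_pos hn).le (by linarith [Real.pi_pos])
    (pi_div_le hn)

/-! ### Polar coordinates and n-th powers in the sector `-π/n ≤ arg z ≤ 0`. -/

/-- The unit vector `e^{-iθ}`. -/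
def dir (θ : ℝ) : ℂ := exp (-(θ : ℂ) * I)

lemma dir_re (θ : ℝ) : (dir θ).re = Real.cos θ := by
  simp [dir, exp_re]

lemma dir_im (θ : ℝ) : (dir θ).im = -Real.sin θ := by
  simp [dir, exp_im]

@[simp] lemma norm_dir (θ : ℝ) : ‖dir θ‖ = 1 := by
  rw [dir, ← ofReal_neg, norm_exp_ofReal_mul_I]

lemma dir_pow (θ : ℝ) (n : ℕ) : dir θ ^ n = dir (n * θ) := by
  rw [dir, dir, ← exp_nat_mul]; push_cast; ring_nf

lemma dir_zero : dir 0 = 1 := by simp [dir]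

lemma dir_pi : dir Real.pi = -1 := by
  apply Complex.ext <;> simp [dir_re, dir_im]

lemma dir_ne_zero (θ : ℝ) : dir θ ≠ 0 := exp_ne_zero _

/-- The closed sector `-π/n ≤ arg z ≤ 0`. -/
def sector (n : ℕ) : Set ℂ :=
  {z | z.im ≤ 0 ∧ 0 ≤ z.re * Real.sin (Real.pi / n) + z.im * Real.cos (Real.pi / n)}

/-- The open sector `-π/n < arg z < 0`. -/
def sectorInt (n : ℕ) : Set ℂ :=
  {z | z.im < 0 ∧ 0 < z.re * Real.sin (Real.pi / n) + z.im * Real.cos (Real.pi / n)}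

lemma sectorInt_subset (n : ℕ) : sectorInt n ⊆ sector n := fun _ h => ⟨h.1.le, h.2.le⟩

lemma isClosed_sector (n : ℕ) : IsClosed (sector n) :=
  (isClosed_le continuous_im continuous_const).inter
    (isClosed_le continuous_const
      ((continuous_re.mul continuous_const).add (continuous_im.mul continuous_const)))

lemma isOpen_sectorInt (n : ℕ) : IsOpen (sectorInt n) :=
  (isOpen_lt continuous_im continuous_const).inter
    (isOpen_lt continuous_const
      ((continuous_re.mul continuous_const).add (continuous_im.mul continuous_const)))

lemma convex_sector (n : ℕ) : Convex ℝ (sector n) := by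
  intro x hx y hy a b ha hb _
  refine ⟨?_, ?_⟩
  · simp only [add_im, real_smul, mul_im, ofReal_re, ofReal_im, zero_mul, add_zero]
    nlinarith [mul_nonneg ha (neg_nonneg.2 hx.1), mul_nonneg hb (neg_nonneg.2 hy.1)]
  · simp only [add_im, add_re, real_smul, mul_im, mul_re, ofReal_re, ofReal_im, zero_mul, add_zero,
      sub_zero]
    nlinarith [mul_nonneg ha hx.2, mul_nonneg hb hy.2]

lemma convex_sectorInt (n : ℕ) : Convex ℝ (sectorInt n) := by
  intro x hx y hy a b ha hb hab
  have key : ∀ p q : ℝ, 0 < p → 0 < q → 0 < a * p + b * q := by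
    intro p q hp hq
    rcases ha.lt_or_eq with h | h
    · nlinarith [mul_pos h hp, mul_nonneg hb hq.le]
    · have : b = 1 := by linarith
      subst this; rw [← h]; linarith
  have h1 := key _ _ (neg_pos.2 hx.1) (neg_pos.2 hy.1)
  have h2 := key _ _ hx.2 hy.2
  refine ⟨?_, ?_⟩
  · simp only [add_im, real_smul, mul_im, ofReal_re, ofReal_im, zero_mul, add_zero]
    linarith
  · simp only [add_im, add_re, real_smul, mul_im, mul_re, ofReal_re, ofReal_im, zero_mul, add_zero,
      sub_zero]
    linarith

lemma re_nonneg_of_mem_sector {n : ℕ} (hn : 3 ≤ n) {z : ℂ} (hz : z ∈ sector n) : 0 ≤ z.re := by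
  have := sin_pos hn
  have h2 := half_le_cos hn
  by_contra h
  push Not at h
  nlinarith [hz.1, hz.2, mul_pos_of_neg_of_neg h (neg_neg_of_pos this),
    mul_nonneg (neg_nonneg.2 hz.1) (by linarith : 0 ≤ Real.cos (Real.pi / n))]

lemma mul_dir_mem_sector {n : ℕ} (hn : 3 ≤ n) {r θ : ℝ} (hr : 0 ≤ r) (h0 : 0 ≤ θ)
    (h1 : θ ≤ Real.pi / n) : (r : ℂ) * dir θ ∈ sector n := by
  have hpi := pi_div_le hn
  have := Real.pi_pos
  refine ⟨?_, ?_⟩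
  · rw [im_ofReal_mul, dir_im]
    nlinarith [mul_nonneg hr (Real.sin_nonneg_of_nonneg_of_le_pi h0 (by linarith))]
  · rw [im_ofReal_mul, re_ofReal_mul, dir_im, dir_re]
    have := Real.sin_nonneg_of_nonneg_of_le_pi (x := Real.pi / n - θ) (by linarith) (by linarith)
    rw [Real.sin_sub] at this
    nlinarith [mul_nonneg hr this]

lemma mul_dir_mem_sectorInt {n : ℕ} (hn : 3 ≤ n) {r θ : ℝ} (hr : 0 < r) (h0 : 0 < θ)
    (h1 : θ < Real.pi / n) : (r : ℂ) * dir θ ∈ sectorInt n := by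
  have hpi := pi_div_le hn
  have := Real.pi_pos
  refine ⟨?_, ?_⟩
  · rw [im_ofReal_mul, dir_im]
    nlinarith [mul_pos hr (Real.sin_pos_of_pos_of_lt_pi h0 (by linarith))]
  · rw [im_ofReal_mul, re_ofReal_mul, dir_im, dir_re]
    have := Real.sin_pos_of_pos_of_lt_pi (x := Real.pi / n - θ) (by linarith) (by linarith)
    rw [Real.sin_sub] at this
    nlinarith [mul_pos hr this]

lemma exists_polar_of_mem_sector {n : ℕ} (hn : 3 ≤ n) {z : ℂ} (hz : z ∈ sector n) :
    ∃ θ : ℝ, 0 ≤ θ ∧ θ ≤ Real.pi / n ∧ z = (‖z‖ : ℂ) * dir θ := by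
  by_cases h0 : z = 0
  · exact ⟨0, le_rfl, (pi_div_pos hn).le, by simp [h0]⟩
  have hz0 : 0 < ‖z‖ := norm_pos_iff.2 h0
  have hs := sin_pos hn
  have hpi := pi_div_le hn
  have := Real.pi_pos
  have hre := re_nonneg_of_mem_sector hn hz
  have hpol : z = (‖z‖ : ℂ) * dir (-z.arg) := by
    rw [dir]; push_cast; rw [neg_neg]; exact (norm_mul_exp_arg_mul_I z).symm
  have h2 : z.arg ≤ 0 := by
    rcases hz.1.lt_or_eq with h | h
    · exact (arg_neg_iff.2 h).le
    · exact (arg_eq_zero_iff.2 ⟨hre, h⟩).le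
  have h3 : -(Real.pi / 2) ≤ z.arg := (abs_le.1 (abs_arg_le_pi_div_two_iff.2 hre)).1
  refine ⟨-z.arg, by linarith, ?_, hpol⟩
  by_contra hlt
  push Not at hlt
  have h4 := hz.2
  rw [hpol, im_ofReal_mul, re_ofReal_mul, dir_im, dir_re] at h4
  have h5 := Real.sin_pos_of_pos_of_lt_pi (x := -z.arg - Real.pi / n) (by linarith)
    (by linarith [pi_div_pos hn])
  rw [Real.sin_sub] at h5
  nlinarith [mul_pos hz0 h5]

lemma pos_mul_mem_sector {n : ℕ} {z : ℂ} (hz : z ∈ sector n) {r : ℝ} (hr : 0 ≤ r) :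
    (r : ℂ) * z ∈ sector n := by
  refine ⟨?_, ?_⟩
  · rw [im_ofReal_mul]; nlinarith [mul_nonneg hr (neg_nonneg.2 hz.1)]
  · rw [im_ofReal_mul, re_ofReal_mul]; nlinarith [mul_nonneg hr hz.2]

lemma add_mem_sectorInt {n : ℕ} {z w : ℂ} (hz : z ∈ sector n) (hw : w ∈ sectorInt n) :
    z + w ∈ sectorInt n := by
  refine ⟨?_, ?_⟩
  · rw [add_im]; linarith [hz.1, hw.1]
  · rw [add_im, add_re]; nlinarith [hz.2, hw.2]

lemma pos_mul_mem_sectorInt {n : ℕ} {z : ℂ} (hz : z ∈ sectorInt n) {r : ℝ} (hr : 0 < r) :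
    (r : ℂ) * z ∈ sectorInt n := by
  refine ⟨?_, ?_⟩
  · rw [im_ofReal_mul]; nlinarith [mul_pos hr (neg_pos.2 hz.1)]
  · rw [im_ofReal_mul, re_ofReal_mul]; nlinarith [mul_pos hr hz.2]

lemma pow_polar (r θ : ℝ) (n : ℕ) :
    ((r : ℂ) * dir θ) ^ n = ((r ^ n : ℝ) : ℂ) * dir (n * θ) := by
  rw [mul_pow, dir_pow, ofReal_pow]

lemma natCast_mul_mem {n : ℕ} (hn : 3 ≤ n) {θ : ℝ} (h0 : 0 ≤ θ) (h1 : θ ≤ Real.pi / n) :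
    0 ≤ n * θ ∧ n * θ ≤ Real.pi := by
  refine ⟨by positivity, ?_⟩
  calc n * θ ≤ n * (Real.pi / n) := by gcongr
    _ = _ := natCast_mul_pi_div hn

lemma pow_im_nonpos {n : ℕ} (hn : 3 ≤ n) {z : ℂ} (hz : z ∈ sector n) : (z ^ n).im ≤ 0 := by
  obtain ⟨θ, h0, h1, h⟩ := exists_polar_of_mem_sector hn hz
  obtain ⟨h2, h3⟩ := natCast_mul_mem hn h0 h1
  rw [h, pow_polar, im_ofReal_mul, dir_im]
  nlinarith [mul_nonneg (pow_nonneg (norm_nonneg z) n) (Real.sin_nonneg_of_nonneg_of_le_pi h2 h3)]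

lemma pow_eq_real_cases {n : ℕ} (hn : 3 ≤ n) {z : ℂ} (hz : z ∈ sector n)
    (h : (z ^ n).im = 0) : z = (‖z‖ : ℂ) ∨ z = (‖z‖ : ℂ) * dir (Real.pi / n) := by
  obtain ⟨θ, h0, h1, hp⟩ := exists_polar_of_mem_sector hn hz
  obtain ⟨h2, h3⟩ := natCast_mul_mem hn h0 h1
  have hn' : (3 : ℝ) ≤ n := by exact_mod_cast hn
  by_cases hz0 : z = 0
  · left; simp [hz0]
  have hz0 : 0 < ‖z‖ := norm_pos_iff.2 hz0
  rw [hp, pow_polar, im_ofReal_mul, dir_im, mul_neg, neg_eq_zero] at h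
  have hs : Real.sin (n * θ) = 0 := (mul_eq_zero.1 h).resolve_left (pow_pos hz0 n).ne'
  rcases h2.lt_or_eq with h4 | h4
  · rcases h3.lt_or_eq with h5 | h5
    · exact absurd hs (Real.sin_pos_of_pos_of_lt_pi h4 h5).ne'
    · right
      have : θ = Real.pi / n := by field_simp; linarith
      rw [← this]; exact hp
  · left
    have : θ = 0 := by
      rcases mul_eq_zero.1 h4.symm with h | h
      · linarith
      · exact h
    rw [this, dir_zero, mul_one] at hp
    exact hp

lemma ray_pow {n : ℕ} (hn : 3 ≤ n) (r : ℝ) :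
    ((r : ℂ) * dir (Real.pi / n)) ^ n = -((r ^ n : ℝ) : ℂ) := by
  rw [pow_polar, natCast_mul_pi_div hn, dir_pi]; ring

lemma eq_norm_of_pow_eq_pos {n : ℕ} (hn : 3 ≤ n) {z : ℂ} (hz : z ∈ sector n)
    {x : ℝ} (hx : 0 < x) (h : z ^ n = x) : z = (‖z‖ : ℂ) := by
  rcases pow_eq_real_cases hn hz (by simp [h]) with h1 | h1
  · exact h1
  · exfalso
    rw [h1, ray_pow hn, ← ofReal_neg, ofReal_inj] at h
    have := pow_nonneg (norm_nonneg z) n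
    linarith

lemma eq_one_of_pow_eq_one {n : ℕ} (hn : 3 ≤ n) {z : ℂ} (hz : z ∈ sector n)
    (h : z ^ n = 1) : z = 1 := by
  have h1 := eq_norm_of_pow_eq_pos hn hz one_pos (by simpa using h)
  have h2 : ‖z‖ = 1 := by
    have : ‖z‖ ^ n = 1 := by rw [← norm_pow, h, norm_one]
    exact (pow_eq_one_iff_of_nonneg (norm_nonneg z) (by omega)).1 this
  rw [h1, h2, ofReal_one]

lemma pow_im_neg {n : ℕ} (hn : 3 ≤ n) {z : ℂ} (hz : z ∈ sectorInt n) : (z ^ n).im < 0 := by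
  refine lt_of_le_of_ne (pow_im_nonpos hn (sectorInt_subset n hz)) fun h => ?_
  have hs := sin_pos hn
  rcases pow_eq_real_cases hn (sectorInt_subset n hz) h with h1 | h1
  · have := hz.1; rw [h1, ofReal_im] at this; exact lt_irrefl _ this
  · have := hz.2
    rw [h1, im_ofReal_mul, re_ofReal_mul, dir_im, dir_re] at this
    nlinarith

/-! ### The kernel: analyticity, continuity up to the edges, range of its argument. -/

/-- The set where the principal branch defining `K n` is analytic. -/
def slitDomain (n : ℕ) : Set ℂ := {z | 1 - z ^ n ∈ slitPlane}

lemma isOpen_slitDomain (n : ℕ) : IsOpen (slitDomain n) :=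
  isOpen_slitPlane.preimage (by fun_prop)

lemma sectorInt_subset_slitDomain {n : ℕ} (hn : 3 ≤ n) : sectorInt n ⊆ slitDomain n := by
  intro z hz
  right
  have := pow_im_neg hn hz
  simp [this.ne]

lemma differentiableAt_K {n : ℕ} {z : ℂ} (hz : z ∈ slitDomain n) : DifferentiableAt ℂ (K n) z := by
  unfold K
  refine DifferentiableAt.div (by fun_prop) ?_ ?_
  · exact DifferentiableAt.cpow_const (by fun_prop) hz
  · rw [cpow_def_of_ne_zero (slitPlane_ne_zero hz)]; exact exp_ne_zero _

lemma differentiableOn_K (n : ℕ) : DifferentiableOn ℂ (K n) (slitDomain n) :=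
  fun _ hz => (differentiableAt_K hz).differentiableWithinAt

/-- The principal argument equals `π` on the negative axis, which is its limit from above. One-sided
continuity thus holds on the closed upper half-plane, and this is why the basic sector is taken
below the real axis. -/
lemma continuousWithinAt_cpow_upper {w : ℂ} (h0 : w ≠ 0) (a : ℂ) :
    ContinuousWithinAt (fun x : ℂ => x ^ a) {x | 0 ≤ x.im} w := by
  by_cases hs : w ∈ slitPlane
  · exact (continuousAt_cpow_const hs).continuousWithinAt
  · rw [mem_slitPlane_iff] at hs
    push Not at hs
    have hre : w.re < 0 := lt_of_le_of_ne hs.1 fun h => h0 (Complex.ext h hs.2)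
    have h1 : ContinuousWithinAt (fun x : ℂ => exp (log x * a)) {x | 0 ≤ x.im} w :=
      ((continuousWithinAt_log_of_re_neg_of_im_zero hre hs.2).mul_const a).cexp
    refine h1.congr_of_eventuallyEq ?_ (cpow_def_of_ne_zero h0 a)
    filter_upwards [mem_nhdsWithin_of_mem_nhds (isOpen_ne.mem_nhds h0)] with x hx
    exact cpow_def_of_ne_zero hx a

lemma one_sub_pow_ne_zero {n : ℕ} (hn : 3 ≤ n) {z : ℂ} (hz : z ∈ sector n) (h1 : z ≠ 1) :
    1 - z ^ n ≠ 0 := fun h => h1 (eq_one_of_pow_eq_one hn hz (sub_eq_zero.1 h).symm)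

lemma continuousWithinAt_K {n : ℕ} (hn : 3 ≤ n) {z : ℂ} (hz : z ∈ sector n) (h1 : z ≠ 1) :
    ContinuousWithinAt (K n) (sector n) z := by
  have h0 := one_sub_pow_ne_zero hn hz h1
  have him : ∀ w ∈ sector n, 0 ≤ (1 - w ^ n).im := fun w hw => by
    have := pow_im_nonpos hn hw
    simp [this]
  unfold K
  refine ContinuousWithinAt.div continuousWithinAt_const ?_ ?_
  · exact ContinuousWithinAt.comp (f := fun z : ℂ => 1 - z ^ n) (t := {x : ℂ | 0 ≤ x.im})
      (continuousWithinAt_cpow_upper h0 _)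
      (by fun_prop) him
  · rw [cpow_def_of_ne_zero h0]; exact exp_ne_zero _

lemma K_polar {n : ℕ} {z : ℂ} (h0 : 1 - z ^ n ≠ 0) :
    K n z = ((1 / ‖1 - z ^ n‖ ^ alpha n : ℝ) : ℂ) * dir (alpha n * arg (1 - z ^ n)) := by
  rw [← norm_K, K_eq_alpha]
  rw [norm_div, norm_one, norm_cpow_real, cpow_def_of_ne_zero h0, log, dir, add_mul, exp_add,
    one_div, mul_inv, ofReal_div, ofReal_one, one_div]
  congr 1
  · rw [ofReal_cpow (norm_nonneg _), cpow_def_of_ne_zero (by simpa using h0),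
      ofReal_log (norm_nonneg _), ← exp_neg]
  · rw [← exp_neg]; congr 1; push_cast; ring

lemma arg_mem_of_sector {n : ℕ} (hn : 3 ≤ n) {z : ℂ} (hz : z ∈ sector n) :
    0 ≤ arg (1 - z ^ n) ∧ arg (1 - z ^ n) ≤ Real.pi := by
  have := pow_im_nonpos hn hz
  exact ⟨arg_nonneg_iff.2 (by simp [this]), arg_le_pi _⟩

lemma cos_alpha_pos {n : ℕ} (hn : 3 ≤ n) : 0 < Real.cos (alpha n * Real.pi / 2) := by
  have h1 := alpha_pos hn
  have h2 := alpha_lt_one hn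
  have := Real.pi_pos
  apply Real.cos_pos_of_mem_Ioo
  constructor <;> nlinarith

/-- Since `arg (1 - z^n)` lies in `[0, π]`, the argument of `K n z` lies in `[-απ, 0]`. Rotating by
`απ/2` centres this interval at `0`, and `α < 1` keeps the cosine of its half-length positive. -/
lemma le_re_dir_mul_K {n : ℕ} (hn : 3 ≤ n) {z : ℂ} (hz : z ∈ sector n) (h1 : z ≠ 1) :
    Real.cos (alpha n * Real.pi / 2) * ‖K n z‖ ≤ (dir (-(alpha n * Real.pi / 2)) * K n z).re := by
  have h0 := one_sub_pow_ne_zero hn hz h1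
  obtain ⟨ha, hb⟩ := arg_mem_of_sector hn hz
  have hal := alpha_pos hn
  have hal1 := alpha_lt_one hn
  have hpi := Real.pi_pos
  rw [norm_K, K_polar h0, mul_left_comm, re_ofReal_mul, mul_comm]
  have : dir (-(alpha n * Real.pi / 2)) * dir (alpha n * arg (1 - z ^ n)) =
      dir (alpha n * (arg (1 - z ^ n) - Real.pi / 2)) := by
    unfold dir; rw [← exp_add]; push_cast; ring_nf
  rw [this, dir_re]
  apply mul_le_mul_of_nonneg_left _ (by positivity)
  rw [← Real.cos_abs (alpha n * (arg (1 - z ^ n) - Real.pi / 2)), abs_mul, abs_of_pos hal]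
  have h3 : |arg (1 - z ^ n) - Real.pi / 2| ≤ Real.pi / 2 := abs_le.2 ⟨by linarith, by linarith⟩
  apply Real.cos_le_cos_of_nonneg_of_le_pi (by positivity) (by nlinarith)
  rw [mul_div_assoc]
  gcongr

/-! ### Integrable domination of the kernel along rays. -/

/-- The radial majorant `|1 - t^n|^{-(n-1)/n}` of `K n`. -/
def kern (n : ℕ) (t : ℝ) : ℝ := 1 / |1 - t ^ n| ^ alpha n

lemma kern_nonneg (n : ℕ) (t : ℝ) : 0 ≤ kern n t := by unfold kern; positivity

lemma measurable_kern (n : ℕ) : Measurable (kern n) := by unfold kern; fun_prop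

lemma measurable_K (n : ℕ) : Measurable (K n) := by unfold K; fun_prop

lemma norm_K_le {n : ℕ} (hn : 3 ≤ n) {z : ℂ} (hz : ‖z‖ ≠ 1) : ‖K n z‖ ≤ kern n ‖z‖ := by
  rw [norm_K, kern]
  have h1 : (0 : ℝ) < |1 - ‖z‖ ^ n| := by
    rw [abs_pos, sub_ne_zero]
    exact fun h => hz ((pow_eq_one_iff_of_nonneg (norm_nonneg z) (by omega)).1 h.symm)
  have h2 : |1 - ‖z‖ ^ n| ≤ ‖1 - z ^ n‖ := by
    have := abs_norm_sub_norm_le (1 : ℂ) (z ^ n)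
    rwa [norm_one, norm_pow] at this
  have := alpha_pos hn
  gcongr

lemma pow_rpow_alpha {n : ℕ} (hn : 3 ≤ n) {t : ℝ} (ht : 0 ≤ t) :
    (t ^ n) ^ alpha n = t ^ (n - 1) := by
  have h3 : (3 : ℝ) ≤ n := by exact_mod_cast hn
  rw [← Real.rpow_natCast, ← Real.rpow_mul ht, ← Real.rpow_natCast]
  congr 1
  rw [Nat.cast_sub (by omega), alpha]
  push_cast
  field_simp

/-- Here `t^n - 1 ≥ t^n / 2`, and the `alpha n`-th power of `t^n` is `t^(n-1) ≥ t^2`; the factor `2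
^ alpha n` is at most `2`. -/
lemma kern_le_of_two_le {n : ℕ} (hn : 3 ≤ n) {t : ℝ} (ht : 2 ≤ t) : kern n t ≤ 2 / t ^ 2 := by
  have hal := alpha_pos hn
  have hal1 := alpha_lt_one hn
  have h1 : 2 ≤ t ^ n := ht.trans (le_self_pow₀ (by linarith) (by omega))
  have h2 : |1 - t ^ n| = t ^ n - 1 := by rw [abs_sub_comm]; exact abs_of_nonneg (by linarith)
  have h3 : t ^ 2 / 2 ≤ (t ^ n - 1) ^ alpha n := calc
    t ^ 2 / 2 ≤ t ^ (n - 1) / 2 := by gcongr <;> [linarith; omega]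
    _ ≤ t ^ (n - 1) / 2 ^ alpha n := by
      gcongr
      calc (2 : ℝ) ^ alpha n ≤ 2 ^ (1 : ℝ) := by gcongr; norm_num
        _ = 2 := Real.rpow_one 2
    _ = (t ^ n / 2) ^ alpha n := by
      rw [Real.div_rpow (by positivity) (by norm_num), pow_rpow_alpha hn (by linarith)]
    _ ≤ (t ^ n - 1) ^ alpha n := by gcongr; linarith
  rw [kern, h2, div_le_div_iff₀ (Real.rpow_pos_of_pos (by linarith) _) (by positivity)]
  linarith

lemma integrableOn_kern_Ioi_two {n : ℕ} (hn : 3 ≤ n) : IntegrableOn (kern n) (Set.Ioi 2) := by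
  have h : IntegrableOn (fun t : ℝ => 2 * t ^ (-2 : ℝ)) (Set.Ioi 2) :=
    (integrableOn_Ioi_rpow_of_lt (by norm_num) (by norm_num)).const_mul 2
  refine h.mono' (measurable_kern n).aestronglyMeasurable ?_
  filter_upwards [ae_restrict_mem measurableSet_Ioi] with t ht
  have ht' : (2 : ℝ) < t := ht
  rw [Real.norm_of_nonneg (kern_nonneg n t), Real.rpow_neg (by linarith), ← div_eq_mul_inv]
  exact_mod_cast kern_le_of_two_le hn ht'.le

lemma abs_sub_le_abs_one_sub_pow {n : ℕ} (hn : 3 ≤ n) {t : ℝ} (ht : 0 ≤ t) :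
    |1 - t| ≤ |1 - t ^ n| := by
  rcases le_total t 1 with h | h
  · have := pow_le_of_le_one ht h (by omega : n ≠ 0)
    rw [abs_of_nonneg (by linarith), abs_of_nonneg (by linarith)]
    linarith
  · have := le_self_pow₀ h (by omega : n ≠ 0)
    rw [abs_sub_comm, abs_sub_comm 1, abs_of_nonneg (by linarith), abs_of_nonneg (by linarith)]
    linarith

/-- The only singularity is at `1`, where comparison with `|1 - t|^(-alpha n)` and `alpha n < 1`
give integrability from both sides. -/
lemma intervalIntegrable_kern_zero_two {n : ℕ} (hn : 3 ≤ n) :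
    IntervalIntegrable (kern n) volume 0 2 := by
  have hal := alpha_pos hn
  have hal1 := alpha_lt_one hn
  have key : ∀ t : ℝ, 0 ≤ t → t ≠ 1 → kern n t ≤ |1 - t| ^ (-alpha n) := by
    intro t ht h1
    rw [Real.rpow_neg (abs_nonneg _), ← one_div, kern]
    have h2 : 0 < |1 - t| := abs_pos.2 (sub_ne_zero.2 (Ne.symm h1))
    have := abs_sub_le_abs_one_sub_pow hn ht
    gcongr
  have hb : IntervalIntegrable (fun t : ℝ => t ^ (-alpha n)) volume 0 1 :=
    intervalIntegral.intervalIntegrable_rpow' (by linarith)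
  have hne : ∀ᵐ t : ℝ, t ≠ 1 := by simp [ae_iff]
  have h1 : IntervalIntegrable (kern n) volume 0 1 := by
    have h := (hb.comp_sub_left 1).symm
    simp only [sub_zero, sub_self] at h
    refine h.mono_fun' (measurable_kern n).aestronglyMeasurable ?_
    filter_upwards [ae_restrict_mem measurableSet_uIoc, ae_restrict_of_ae hne] with t ht ht1
    rw [Set.uIoc_of_le zero_le_one] at ht
    rw [Real.norm_of_nonneg (kern_nonneg n t)]
    convert key t ht.1.le ht1 using 2
    rw [abs_of_nonneg (by linarith [ht.2])]
  have h2 : IntervalIntegrable (kern n) volume 1 2 := by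
    have h := hb.comp_sub_right 1
    norm_num at h
    refine h.mono_fun' (measurable_kern n).aestronglyMeasurable ?_
    filter_upwards [ae_restrict_mem measurableSet_uIoc, ae_restrict_of_ae hne] with t ht ht1
    rw [Set.uIoc_of_le (by norm_num)] at ht
    rw [Real.norm_of_nonneg (kern_nonneg n t)]
    convert key t (by linarith [ht.1]) ht1 using 2
    rw [abs_sub_comm, abs_of_nonneg (by linarith [ht.1])]
  exact h1.trans h2

lemma integrableOn_kern {n : ℕ} (hn : 3 ≤ n) : IntegrableOn (kern n) (Set.Ioi 0) := by
  have h1 := (intervalIntegrable_iff_integrableOn_Ioc_of_le (by norm_num)).1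
    (intervalIntegrable_kern_zero_two hn)
  rw [← Set.Ioc_union_Ioi_eq_Ioi (by norm_num : (0 : ℝ) ≤ 2)]
  exact h1.union (integrableOn_kern_Ioi_two hn)

lemma ae_ne (a : ℝ) : ∀ᵐ t : ℝ, t ≠ a := by simp [ae_iff]

lemma integrableOn_K_ray {n : ℕ} (hn : 3 ≤ n) {e : ℂ} (he : ‖e‖ = 1) :
    IntegrableOn (fun t : ℝ => K n (t * e)) (Set.Ioi 0) := by
  refine (integrableOn_kern hn).mono'
    ((measurable_K n).comp (by fun_prop)).aestronglyMeasurable ?_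
  filter_upwards [ae_restrict_mem measurableSet_Ioi, ae_restrict_of_ae (ae_ne 1)] with t ht ht1
  have h : ‖(t : ℂ) * e‖ = t := by
    rw [norm_mul, he, mul_one, norm_real, Real.norm_of_nonneg (le_of_lt ht)]
  have := norm_K_le hn (z := t * e) (by rwa [h])
  rwa [h] at this

/-! ### `F n` as a primitive of the kernel, continuous on the closed sector. -/

lemma F_ofReal_mul (n : ℕ) (r : ℝ) (e : ℂ) :
    F n (r * e) = e * ∫ t in (0 : ℝ)..r, K n (t * e) := by
  have := intervalIntegral.smul_integral_comp_mul_right (a := 0) (b := 1)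
    (fun t : ℝ => K n (t * e)) r
  rw [zero_mul, one_mul] at this
  rw [← this, F, real_smul]
  have h : ∀ t : ℝ, K n (t * (r * e)) = K n (((t * r : ℝ) : ℂ) * e) := fun t => by
    push_cast; ring_nf
  simp_rw [h]
  ring

lemma F_zero (n : ℕ) : F n 0 = 0 := by simp [F]

lemma mul_mem_slitDomain {n : ℕ} {z : ℂ} (hz : z ∈ slitDomain n) {t : ℝ}
    (h0 : 0 ≤ t) (h1 : t ≤ 1) : (t : ℂ) * z ∈ slitDomain n := by
  have h := starConvex_one_slitPlane (show 1 - z ^ n ∈ slitPlane from hz)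
    (sub_nonneg.2 (pow_le_one₀ h0 h1 : t ^ n ≤ 1)) (pow_nonneg h0 n) (by ring)
  have h2 : (1 - t ^ n) • (1 : ℂ) + t ^ n • (1 - z ^ n) = 1 - ((t : ℂ) * z) ^ n := by
    simp only [real_smul]; push_cast; ring
  rw [h2] at h
  exact h

lemma zero_mem_slitDomain {n : ℕ} (hn : 3 ≤ n) : (0 : ℂ) ∈ slitDomain n := by
  simp [slitDomain, show n ≠ 0 by omega]

/-- The domain is only star-shaped about `0`, but the segment from `0` to `z` has a convex
neighbourhood inside it. There a holomorphic primitive of `K n` exists, and it equals `F n` up to a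
constant. -/
lemma hasDerivAt_F {n : ℕ} {z : ℂ} (hz : z ∈ slitDomain n) :
    HasDerivAt (F n) (K n z) z := by
  have hsub : segment ℝ 0 z ⊆ slitDomain n := by
    rw [segment_eq_image]
    rintro _ ⟨t, ht, rfl⟩
    simpa using mul_mem_slitDomain hz ht.1 ht.2
  have hcs : IsCompact (segment ℝ 0 z) := by
    rw [segment_eq_image]
    exact isCompact_Icc.image (by fun_prop)
  obtain ⟨δ, hδ, hth⟩ := hcs.exists_thickening_subset_open (isOpen_slitDomain n) hsub
  set s := Metric.thickening δ (segment ℝ 0 z)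
  have hconv : Convex ℝ s := (convex_segment 0 z).thickening δ
  have hs0 : (0 : ℂ) ∈ s := Metric.self_subset_thickening hδ _ (left_mem_segment ℝ 0 z)
  have hsz : z ∈ s := Metric.self_subset_thickening hδ _ (right_mem_segment ℝ 0 z)
  have hso : IsOpen s := Metric.isOpen_thickening
  obtain ⟨f, hf⟩ := hconv.exists_forall_hasDerivWithinAt ((differentiableOn_K n).mono hth)
  have hf' : ∀ w ∈ s, HasDerivAt f (K n w) w := fun w hw =>
    (hf w hw).hasDerivAt (hso.mem_nhds hw)
  have hFf : ∀ w ∈ s, F n w = f w - f 0 := by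
    intro w hw
    have hmem : ∀ t ∈ Set.uIcc (0 : ℝ) 1, (t : ℂ) * w ∈ s := by
      intro t ht
      rw [Set.uIcc_of_le zero_le_one] at ht
      have := hconv hs0 hw (sub_nonneg.2 ht.2) ht.1 (by ring)
      simpa using this
    have hd : ∀ t ∈ Set.uIcc (0 : ℝ) 1,
        HasDerivAt (fun t : ℝ => f (t * w)) (K n (t * w) * w) t := by
      intro t ht
      have h1 : HasDerivAt (fun t : ℝ => (t : ℂ) * w) (1 * w) t :=
        (HasDerivAt.ofReal_comp (hasDerivAt_id t)).mul_const w
      rw [one_mul] at h1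
      exact (hf' _ (hmem t ht)).comp t h1
    have hc : ContinuousOn (fun t : ℝ => K n (t * w) * w) (Set.uIcc 0 1) := by
      refine ContinuousOn.mul ?_ continuousOn_const
      exact ((differentiableOn_K n).continuousOn.mono hth).comp (by fun_prop) hmem
    have := intervalIntegral.integral_eq_sub_of_hasDerivAt hd hc.intervalIntegrable
    rw [intervalIntegral.integral_mul_const] at this
    simp only [ofReal_one, one_mul, ofReal_zero, zero_mul] at this
    rw [F, mul_comm]
    exact this
  have h1 : HasDerivAt (fun w => f w - f 0) (K n z) z := (hf' z hsz).sub_const _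
  refine h1.congr_of_eventuallyEq ?_
  filter_upwards [hso.mem_nhds hsz] with w hw using hFf w hw

/-- Away from `0`, write `F n z` as `u` times the integral of `K n (t u)` over `0 < t ≤ ‖z‖`, with
`u = z/‖z‖`. The majorant `kern n` does not depend on the direction, so dominated convergence
applies even at and beyond the singular point `1`. -/
lemma continuousOn_F_sector {n : ℕ} (hn : 3 ≤ n) : ContinuousOn (F n) (sector n) := by
  intro z₀ hz₀
  by_cases h0 : z₀ = 0
  · subst h0
    exact (hasDerivAt_F (zero_mem_slitDomain hn)).continuousAt.continuousWithinAt
  set u : ℂ → ℂ := fun z => ((‖z‖⁻¹ : ℝ) : ℂ) * z with hu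
  set f : ℂ → ℝ → ℂ := fun z => (Set.Iic ‖z‖).indicator (fun t => K n (t * u z)) with hf
  have hnu : ∀ z, z ≠ 0 → ‖u z‖ = 1 := by
    intro z hz
    have : ‖z‖ ≠ 0 := norm_ne_zero_iff.2 hz
    simp [hu, this]
  have hFu : ∀ z, z ≠ 0 → F n z = u z * ∫ t in Set.Ioi (0 : ℝ), f z t := by
    intro z hz
    have hz' : (‖z‖ : ℂ) ≠ 0 := by simpa using hz
    have h1 : z = (‖z‖ : ℂ) * u z := by
      simp only [hu]; push_cast; field_simp
    conv_lhs => rw [h1]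
    rw [F_ofReal_mul, intervalIntegral.integral_of_le (norm_nonneg z), hf,
      setIntegral_indicator measurableSet_Iic, Set.Ioi_inter_Iic]
  have hne : ∀ᶠ z in 𝓝[sector n] z₀, z ≠ 0 :=
    mem_nhdsWithin_of_mem_nhds (isOpen_ne.mem_nhds h0)
  have huc : ContinuousAt u z₀ := by
    have : ‖z₀‖ ≠ 0 := norm_ne_zero_iff.2 h0
    refine ContinuousAt.mul ?_ continuousAt_id
    exact continuous_ofReal.continuousAt.comp (continuous_norm.continuousAt.inv₀ this)
  have hint : Tendsto (fun z => ∫ t in Set.Ioi (0 : ℝ), f z t) (𝓝[sector n] z₀)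
      (𝓝 (∫ t in Set.Ioi (0 : ℝ), f z₀ t)) := by
    refine tendsto_integral_filter_of_dominated_convergence (kern n) ?_ ?_
      (integrableOn_kern hn) ?_
    · refine Eventually.of_forall fun z => ?_
      exact (((measurable_K n).comp (by fun_prop)).indicator
        measurableSet_Iic).aestronglyMeasurable
    · filter_upwards [hne] with z hz
      filter_upwards [ae_restrict_mem measurableSet_Ioi, ae_restrict_of_ae (ae_ne 1)] with t ht ht1
      have h : ‖(t : ℂ) * u z‖ = t := by
        rw [norm_mul, hnu z hz, mul_one, norm_real, Real.norm_of_nonneg (le_of_lt ht)]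
      have h2 := norm_K_le hn (z := t * u z) (by rwa [h])
      rw [h] at h2
      exact (norm_indicator_le_norm_self _ _).trans h2
    · filter_upwards [ae_restrict_mem measurableSet_Ioi, ae_restrict_of_ae (ae_ne 1),
        ae_restrict_of_ae (ae_ne ‖z₀‖)] with t ht ht1 ht2
      have hmem : ∀ z ∈ sector n, (t : ℂ) * u z ∈ sector n := fun z hz =>
        pos_mul_mem_sector (pos_mul_mem_sector hz (by positivity)) (le_of_lt ht)
      have hK : Tendsto (fun z => K n (t * u z)) (𝓝[sector n] z₀) (𝓝 (K n (t * u z₀))) := by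
        have h : ‖(t : ℂ) * u z₀‖ = t := by
          rw [norm_mul, hnu z₀ h0, mul_one, norm_real, Real.norm_of_nonneg (le_of_lt ht)]
        have h1 : (t : ℂ) * u z₀ ≠ 1 := fun h' => ht1 (by rw [← h, h', norm_one])
        exact ContinuousWithinAt.comp (f := fun z => (t : ℂ) * u z)
          (continuousWithinAt_K hn (hmem z₀ hz₀) h1)
          (continuousAt_const.mul huc).continuousWithinAt hmem
      rcases lt_or_gt_of_ne ht2 with hlt | hgt
      · have hev : ∀ᶠ z in 𝓝[sector n] z₀, t < ‖z‖ :=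
          mem_nhdsWithin_of_mem_nhds ((isOpen_lt continuous_const continuous_norm).mem_nhds hlt)
        have h3 : f z₀ t = K n (t * u z₀) := if_pos hlt.le
        rw [h3]
        refine hK.congr' ?_
        filter_upwards [hev] with z hz
        exact (if_pos hz.le).symm
      · have hev : ∀ᶠ z in 𝓝[sector n] z₀, ‖z‖ < t :=
          mem_nhdsWithin_of_mem_nhds ((isOpen_lt continuous_norm continuous_const).mem_nhds hgt)
        have h3 : f z₀ t = 0 := if_neg (not_le.2 hgt)
        rw [h3]
        refine tendsto_const_nhds.congr' ?_
        filter_upwards [hev] with z hz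
        exact (if_neg (not_le.2 hz)).symm
  have := (huc.continuousWithinAt (s := sector n)).tendsto.mul hint
  unfold ContinuousWithinAt
  rw [hFu z₀ h0]
  refine this.congr' ?_
  filter_upwards [hne] with z hz using (hFu z hz).symm

/-! ### Quantitative injectivity on the sector. -/

lemma K_lower_bound {n : ℕ} (hn : 3 ≤ n) {R : ℝ} {z : ℂ} (hz : z ∈ sector n) (h1 : z ≠ 1)
    (hR : ‖z‖ ≤ R) : 1 / (1 + R ^ n) ^ alpha n ≤ ‖K n z‖ := by
  rw [norm_K]
  have h0 : 0 < ‖1 - z ^ n‖ := norm_pos_iff.2 (one_sub_pow_ne_zero hn hz h1)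
  have h2 : ‖1 - z ^ n‖ ≤ 1 + R ^ n := by
    refine (norm_sub_le _ _).trans ?_
    rw [norm_one, norm_pow]
    gcongr
  have := alpha_pos hn
  gcongr

lemma one_notMem_sectorInt {n : ℕ} {z : ℂ} (hz : z ∈ sectorInt n) : z ≠ 1 := by
  rintro rfl
  simpa using hz.1

/-- The constant in the quantitative injectivity estimate for `F n`. -/
def lowerConst (n : ℕ) (R : ℝ) : ℝ :=
  Real.cos (alpha n * Real.pi / 2) * (1 / (1 + R ^ n) ^ alpha n)

lemma lowerConst_pos {n : ℕ} (hn : 3 ≤ n) {R : ℝ} (hR : 0 ≤ R) : 0 < lowerConst n R := by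
  have := cos_alpha_pos hn
  unfold lowerConst
  positivity

/-- A quantitative Noshiro–Warschawski argument: along the segment from `w` to `z`, the derivative
of the right-hand quantity is `‖z - w‖^2` times the real part of the rotated kernel, which is
bounded below on the ball of radius `R`. -/
lemma F_mono_sectorInt {n : ℕ} (hn : 3 ≤ n) {R : ℝ} {z w : ℂ} (hz : z ∈ sectorInt n)
    (hw : w ∈ sectorInt n) (hzR : ‖z‖ ≤ R) (hwR : ‖w‖ ≤ R) :
    lowerConst n R * ‖z - w‖ ^ 2 ≤
      (dir (-(alpha n * Real.pi / 2)) * (F n z - F n w) * conj (z - w)).re := by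
  set D := dir (-(alpha n * Real.pi / 2))
  set p : ℝ → ℂ := fun s => w + s * (z - w) with hp
  have hmem : ∀ s ∈ Set.Icc (0 : ℝ) 1, p s ∈ sectorInt n ∧ ‖p s‖ ≤ R := by
    intro s hs
    have h : p s = (1 - s) • w + s • z := by simp [hp]; ring
    rw [h]
    refine ⟨convex_sectorInt n hw hz (sub_nonneg.2 hs.2) hs.1 (by ring), ?_⟩
    refine (norm_add_le _ _).trans ?_
    rw [norm_smul, norm_smul, Real.norm_of_nonneg (sub_nonneg.2 hs.2), Real.norm_of_nonneg hs.1]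
    nlinarith [hs.1, hs.2, mul_le_mul_of_nonneg_left hzR hs.1,
      mul_le_mul_of_nonneg_left hwR (sub_nonneg.2 hs.2)]
  have hd : ∀ s ∈ Set.Icc (0 : ℝ) 1, HasDerivAt (fun s => (D * F n (p s) * conj (z - w)).re)
      (D * (K n (p s) * (z - w)) * conj (z - w)).re s := by
    intro s hs
    have h1 : HasDerivAt p (z - w) s := by
      have := ((HasDerivAt.ofReal_comp (hasDerivAt_id s)).mul_const (z - w)).const_add w
      rw [ofReal_one, one_mul] at this
      exact this
    have h2 : HasDerivAt (fun s => F n (p s)) (K n (p s) * (z - w)) s :=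
      (hasDerivAt_F (sectorInt_subset_slitDomain hn (hmem s hs).1)).comp s h1
    exact (reCLM.hasFDerivAt.comp_hasDerivAt s ((h2.const_mul D).mul_const (conj (z - w))))
  have hlow : ∀ s ∈ Set.Icc (0 : ℝ) 1, lowerConst n R * ‖z - w‖ ^ 2 ≤
      (D * (K n (p s) * (z - w)) * conj (z - w)).re := by
    intro s hs
    obtain ⟨h1, h2⟩ := hmem s hs
    have h3 := le_re_dir_mul_K hn (sectorInt_subset n h1) (one_notMem_sectorInt h1)
    have h4 := K_lower_bound hn (sectorInt_subset n h1) (one_notMem_sectorInt h1) h2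
    have h5 : D * (K n (p s) * (z - w)) * conj (z - w) =
        ((‖z - w‖ ^ 2 : ℝ) : ℂ) * (D * K n (p s)) := by
      rw [ofReal_pow, ← mul_conj']; ring
    rw [h5, re_ofReal_mul, mul_comm]
    refine mul_le_mul_of_nonneg_left (le_trans ?_ h3) (by positivity)
    exact mul_le_mul_of_nonneg_left h4 (cos_alpha_pos hn).le
  have := (convex_Icc (0 : ℝ) 1).mul_sub_le_image_sub_of_le_deriv
    (fun s hs => (hd s hs).continuousAt.continuousWithinAt)
    (fun s hs => (hd s (interior_subset hs)).differentiableAt.differentiableWithinAt)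
    (fun s hs => by rw [(hd s (interior_subset hs)).deriv]; exact hlow s (interior_subset hs))
    0 (Set.left_mem_Icc.2 zero_le_one) 1 (Set.right_mem_Icc.2 zero_le_one) zero_le_one
  rw [sub_zero, mul_one, ← sub_re] at this
  convert this using 2
  simp [hp]
  ring

/-- A direction inside the open sector. -/
def mid (n : ℕ) : ℂ := dir (Real.pi / n / 2)

lemma shift_mem_sectorInt {n : ℕ} (hn : 3 ≤ n) {z : ℂ} (hz : z ∈ sector n) {ε : ℝ} (hε : 0 < ε) :
    z + ε * mid n ∈ sectorInt n :=
  add_mem_sectorInt hz (mul_dir_mem_sectorInt hn hε (by linarith [pi_div_pos hn])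
    (by linarith [pi_div_pos hn]))

lemma tendsto_shift (n : ℕ) (z : ℂ) :
    Tendsto (fun ε : ℝ => z + ε * mid n) (𝓝[>] 0) (𝓝 z) := by
  have : ContinuousAt (fun ε : ℝ => z + ε * mid n) 0 := by fun_prop
  have h := this.tendsto
  simp only [ofReal_zero, zero_mul, add_zero] at h
  exact h.mono_left nhdsWithin_le_nhds

lemma tendsto_F_shift {n : ℕ} (hn : 3 ≤ n) {z : ℂ} (hz : z ∈ sector n) :
    Tendsto (fun ε : ℝ => F n (z + ε * mid n)) (𝓝[>] 0) (𝓝 (F n z)) := by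
  refine (continuousOn_F_sector hn z hz).tendsto.comp (tendsto_nhdsWithin_iff.2
    ⟨tendsto_shift n z, ?_⟩)
  filter_upwards [self_mem_nhdsWithin] with ε hε
  exact sectorInt_subset n (shift_mem_sectorInt hn hz hε)

/-- Both points are pushed inwards by the same vector, so `z - w` does not change; the strict norm
bounds leave room for the push. -/
lemma F_mono_sector {n : ℕ} (hn : 3 ≤ n) {R : ℝ} {z w : ℂ} (hz : z ∈ sector n)
    (hw : w ∈ sector n) (hzR : ‖z‖ < R) (hwR : ‖w‖ < R) :
    lowerConst n R * ‖z - w‖ ^ 2 ≤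
      (dir (-(alpha n * Real.pi / 2)) * (F n z - F n w) * conj (z - w)).re := by
  have hR : ∀ z : ℂ, ‖z‖ < R → ∀ᶠ ε : ℝ in 𝓝[>] 0, ‖z + ε * mid n‖ < R := fun z hz =>
    ((tendsto_shift n z).norm).eventually (gt_mem_nhds hz)
  have hlim := (((((tendsto_F_shift hn hz).sub (tendsto_F_shift hn hw)).const_mul
    (dir (-(alpha n * Real.pi / 2)))).mul_const (conj (z - w))))
  refine ge_of_tendsto (continuous_re.continuousAt.tendsto.comp hlim) ?_
  filter_upwards [hR z hzR, hR w hwR, self_mem_nhdsWithin] with ε h1 h2 h3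
  have := F_mono_sectorInt hn (shift_mem_sectorInt hn hz h3) (shift_mem_sectorInt hn hw h3)
    h1.le h2.le
  simpa [add_sub_add_right_eq_sub] using this

lemma injOn_F_sector {n : ℕ} (hn : 3 ≤ n) : Set.InjOn (F n) (sector n) := by
  intro z hz w hw h
  have hR : 0 ≤ ‖z‖ + ‖w‖ + 1 := by positivity
  have := F_mono_sector hn (R := ‖z‖ + ‖w‖ + 1) hz hw (by linarith [norm_nonneg w])
    (by linarith [norm_nonneg z])
  rw [h, sub_self, mul_zero, zero_mul, zero_re] at this
  have h2 := lowerConst_pos hn hR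
  have h3 : ‖z - w‖ ^ 2 ≤ 0 := by
    by_contra h'
    push Not at h'
    nlinarith [mul_pos h2 h']
  have h4 : ‖z - w‖ = 0 := by
    have := sq_nonneg ‖z - w‖
    exact pow_eq_zero_iff (two_ne_zero) |>.1 (le_antisymm h3 this)
  exact sub_eq_zero.1 (norm_eq_zero.1 h4)

/-- Points of the sector far from `w` have image bounded away from `F n w`. -/
lemma exists_norm_F_sub_ge {n : ℕ} (hn : 3 ≤ n) {w : ℂ} (hw : w ∈ sector n) :
    ∃ c > 0, ∀ z ∈ sector n, 1 ≤ ‖z - w‖ → c ≤ ‖F n z - F n w‖ := by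
  set c := lowerConst n (‖w‖ + 2) with hc
  have hcpos : 0 < c := lowerConst_pos hn (by positivity)
  refine ⟨c, hcpos, fun z hz hzw => ?_⟩
  set d := ‖z - w‖ with hd
  have hd0 : 0 < d := by linarith
  set D := dir (-(alpha n * Real.pi / 2))
  -- The bound must be uniform in `z`, but `lowerConst` degenerates for large radii. So the segment
  -- is cut at the point `m` at distance `1` from `w`: the part up to `m` contributes at least `c`,
  -- and from the rest only the sign is used.
  set m : ℂ := w + (d⁻¹ : ℝ) * (z - w) with hm
  have hdi : d⁻¹ ≤ 1 := inv_le_one_of_one_le₀ hzw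
  have hmS : m ∈ sector n := by
    have := convex_sector n hw hz (sub_nonneg.2 hdi) (inv_nonneg.2 hd0.le) (by ring)
    convert this using 1
    simp only [hm, real_smul]; push_cast; ring
  have hmw : m - w = (d⁻¹ : ℝ) * (z - w) := by rw [hm]; ring
  have hzm : z - m = ((1 - d⁻¹ : ℝ) : ℂ) * (z - w) := by rw [hm]; push_cast; ring
  have hnmw : ‖m - w‖ = 1 := by
    rw [hmw, norm_mul, norm_real, Real.norm_of_nonneg (inv_nonneg.2 hd0.le), ← hd,
      inv_mul_cancel₀ hd0.ne']
  have hnm : ‖m‖ < ‖w‖ + 2 := by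
    have : ‖m‖ ≤ ‖w‖ + ‖m - w‖ := by simpa using norm_add_le w (m - w)
    linarith
  have h1 := F_mono_sector hn (R := ‖w‖ + 2) hmS hw hnm (by linarith)
  have h2 := F_mono_sector hn (R := ‖z‖ + ‖m‖ + 1) hz hmS (by linarith [norm_nonneg m])
    (by linarith [norm_nonneg z])
  have h2' : 0 ≤ (D * (F n z - F n m) * conj (z - m)).re :=
    le_trans (mul_nonneg (lowerConst_pos hn (by positivity)).le (sq_nonneg _)) h2
  rw [hnmw, one_pow, mul_one, hmw, map_mul, conj_ofReal, mul_left_comm, re_ofReal_mul] at h1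
  rw [hzm, map_mul, conj_ofReal, mul_left_comm, re_ofReal_mul] at h2'
  have h3 : 0 ≤ (D * (F n z - F n m) * conj (z - w)).re := by
    rcases hdi.lt_or_eq with h | h
    · exact nonneg_of_mul_nonneg_right h2' (sub_pos.2 h)
    · have : z = m := by
        rw [hm, h]; simp
      rw [← this]; simp
  have h4 : c * d ≤ (D * (F n m - F n w) * conj (z - w)).re := by
    rw [← hc] at h1
    calc c * d ≤ (d⁻¹ * (D * (F n m - F n w) * conj (z - w)).re) * d := by gcongr
      _ = _ := by field_simp
  have h5 : c * d ≤ (D * (F n z - F n w) * conj (z - w)).re := by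
    have : D * (F n z - F n w) * conj (z - w) =
      D * (F n z - F n m) * conj (z - w) + D * (F n m - F n w) * conj (z - w) := by ring
    rw [this, add_re]; linarith
  have h6 : (D * (F n z - F n w) * conj (z - w)).re ≤ ‖F n z - F n w‖ * d := by
    refine (re_le_norm _).trans ?_
    rw [norm_mul, norm_mul, norm_dir, one_mul, RCLike.norm_conj]
  exact le_of_mul_le_mul_right (h5.trans h6) hd0

/-- The image of the sector under `F n` does not contain a limit of `F n` at infinity. -/
lemma notMem_image_of_tendsto {n : ℕ} (hn : 3 ≤ n) {Q : ℂ}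
    (hQ : Tendsto (fun r : ℝ => F n r) atTop (𝓝 Q)) : Q ∉ F n '' sector n := by
  rintro ⟨w, hw, rfl⟩
  obtain ⟨c, hc, h⟩ := exists_norm_F_sub_ge hn hw
  have h1 : Tendsto (fun r : ℝ => ‖F n r - F n w‖) atTop (𝓝 0) := by
    simpa using (hQ.sub_const (F n w)).norm
  obtain ⟨r, hr1, hr2⟩ := ((h1.eventually (gt_mem_nhds hc)).and
    (eventually_ge_atTop (‖w‖ + 1))).exists
  have hr0 : 0 ≤ r := by linarith [norm_nonneg w]
  have hrS : (r : ℂ) ∈ sector n := by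
    simpa [dir_zero] using mul_dir_mem_sector hn hr0 le_rfl (pi_div_pos hn).le
  have : 1 ≤ ‖(r : ℂ) - w‖ := by
    have := norm_sub_norm_le (r : ℂ) w
    rw [norm_real, Real.norm_of_nonneg hr0] at this
    linarith
  linarith [h r hrS this]

/-! ### Variation of `F n` on large arcs. -/

lemma norm_F_sub_le_sectorInt {n : ℕ} (hn : 3 ≤ n) {R : ℝ} (hR : 6 ≤ R) {z w : ℂ}
    (hz : z ∈ sectorInt n) (hw : w ∈ sectorInt n) (hzR : R / 3 < z.re) (hwR : R / 3 < w.re) :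
    ‖F n z - F n w‖ ≤ 18 / R ^ 2 * ‖z - w‖ := by
  have hconv : Convex ℝ (sectorInt n ∩ {z | R / 3 < z.re}) :=
    (convex_sectorInt n).inter (convex_halfSpace_re_gt _)
  refine hconv.norm_image_sub_le_of_norm_hasDerivWithin_le
    (f' := K n) (fun x hx => (hasDerivAt_F
      (sectorInt_subset_slitDomain hn hx.1)).hasDerivWithinAt) (fun x hx => ?_)
    ⟨hw, hwR⟩ ⟨hz, hzR⟩
  have hx2 : R / 3 < x.re := hx.2
  have h1 : R / 3 ≤ ‖x‖ := (hx2.le).trans (re_le_norm x)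
  have h2 : (2 : ℝ) ≤ ‖x‖ := by linarith
  calc ‖K n x‖ ≤ kern n ‖x‖ := norm_K_le hn (by linarith)
    _ ≤ 2 / ‖x‖ ^ 2 := kern_le_of_two_le hn h2
    _ ≤ 2 / (R / 3) ^ 2 := by gcongr
    _ = 18 / R ^ 2 := by field_simp; norm_num

lemma half_norm_le_re {n : ℕ} (hn : 3 ≤ n) {z : ℂ} (hz : z ∈ sector n) : ‖z‖ / 2 ≤ z.re := by
  obtain ⟨θ, h0, h1, h⟩ := exists_polar_of_mem_sector hn hz
  have h2 : 1 / 2 ≤ Real.cos θ := (half_le_cos hn).trans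
    (Real.cos_le_cos_of_nonneg_of_le_pi h0 (by linarith [pi_div_le hn, Real.pi_pos]) h1)
  have h3 : z.re = ‖z‖ * Real.cos θ := by
    conv_lhs => rw [h]
    rw [re_ofReal_mul, dir_re]
  rw [h3]
  nlinarith [norm_nonneg z]

/-- The opening angle is at most `π/3`, so both points have real part at least `R/2`. The chord
between them, of length at most `2R`, stays where `Re > R/3` and `‖K‖ ≤ 18/R^2`. -/
lemma norm_F_sub_le {n : ℕ} (hn : 3 ≤ n) {R : ℝ} (hR : 6 ≤ R) {z w : ℂ}
    (hz : z ∈ sector n) (hw : w ∈ sector n) (hzR : ‖z‖ = R) (hwR : ‖w‖ = R) :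
    ‖F n z - F n w‖ ≤ 36 / R := by
  have hre : ∀ z ∈ sector n, ‖z‖ = R → ∀ᶠ ε : ℝ in 𝓝[>] 0, R / 3 < (z + ε * mid n).re :=
    fun z hz hzR => (continuous_re.continuousAt.tendsto.comp (tendsto_shift n z)).eventually
      (lt_mem_nhds (by have := half_norm_le_re hn hz; linarith))
  have h1 : ‖F n z - F n w‖ ≤ 18 / R ^ 2 * ‖z - w‖ := by
    refine le_of_tendsto ((tendsto_F_shift hn hz).sub (tendsto_F_shift hn hw)).norm ?_
    filter_upwards [hre z hz hzR, hre w hw hwR, self_mem_nhdsWithin] with ε h1 h2 h3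
    have := norm_F_sub_le_sectorInt hn hR (shift_mem_sectorInt hn hz h3)
      (shift_mem_sectorInt hn hw h3) h1 h2
    simpa [add_sub_add_right_eq_sub] using this
  have h2 : ‖z - w‖ ≤ 2 * R := (norm_sub_le _ _).trans (by linarith)
  calc _ ≤ 18 / R ^ 2 * (2 * R) := h1.trans (by gcongr)
    _ = 36 / R := by field_simp; norm_num

/-! ### Boundary values of `F n` and the vertex at infinity. -/

lemma K_ofReal {n : ℕ} {t : ℝ} (h : t ^ n ≤ 1) :
    K n t = ((1 / (1 - t ^ n) ^ alpha n : ℝ) : ℂ) := by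
  rw [K_eq_alpha, ofReal_div, ofReal_cpow (by linarith)]
  push_cast; rfl

lemma F_ofReal_eq_realF {n : ℕ} {y : ℝ} (h : ∀ t ∈ Set.uIcc 0 y, t ^ n ≤ 1) :
    F n y = realF n y := by
  have h1 := F_ofReal_mul n y 1
  rw [mul_one, one_mul] at h1
  rw [h1, realF, ← intervalIntegral.integral_ofReal]
  refine intervalIntegral.integral_congr fun t ht => ?_
  simp only [mul_one]
  exact K_ofReal (h t ht)

lemma F_ofReal_of_mem_Icc {n : ℕ} {x : ℝ} (hx : x ∈ Set.Icc (0 : ℝ) 1) :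
    F n x = realF n x := by
  refine F_ofReal_eq_realF fun t ht => ?_
  rw [Set.uIcc_of_le hx.1] at ht
  exact pow_le_one₀ ht.1 (ht.2.trans hx.2)

lemma F_one (n : ℕ) : F n 1 = realF n 1 := by
  have := F_ofReal_of_mem_Icc (n := n) (x := 1) ⟨zero_le_one, le_rfl⟩
  rwa [ofReal_one] at this

lemma A_eq (n : ℕ) : A n = realF n 1 := by
  rw [A, piN]; congr 1; ring

lemma realF_eq_integral_kern {n : ℕ} {x : ℝ} (hx : x ∈ Set.Icc (0 : ℝ) 1) :
    realF n x = ∫ t in (0 : ℝ)..x, kern n t := by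
  refine intervalIntegral.integral_congr fun t ht => ?_
  rw [Set.uIcc_of_le hx.1] at ht
  have := pow_le_one₀ ht.1 (ht.2.trans hx.2) (n := n)
  simp only [kern]
  rw [abs_of_nonneg (by linarith)]
  rfl

lemma intervalIntegrable_kern {n : ℕ} (hn : 3 ≤ n) {a b : ℝ} (ha : 0 ≤ a) (hab : a ≤ b) :
    IntervalIntegrable (kern n) volume a b := by
  rw [intervalIntegrable_iff_integrableOn_Ioc_of_le hab]
  exact (integrableOn_kern hn).mono_set fun t ht => lt_of_le_of_lt ha ht.1

lemma realF_nonneg {n : ℕ} {x : ℝ} (hx : x ∈ Set.Icc (0 : ℝ) 1) : 0 ≤ realF n x := by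
  rw [realF_eq_integral_kern hx]
  exact intervalIntegral.integral_nonneg hx.1 fun t _ => kern_nonneg n t

lemma realF_le {n : ℕ} (hn : 3 ≤ n) {x : ℝ} (hx : x ∈ Set.Icc (0 : ℝ) 1) :
    realF n x ≤ realF n 1 := by
  rw [realF_eq_integral_kern hx, realF_eq_integral_kern ⟨zero_le_one, le_rfl⟩,
    ← intervalIntegral.integral_add_adjacent_intervals (intervalIntegrable_kern hn le_rfl hx.1)
      (intervalIntegrable_kern hn hx.1 hx.2)]
  linarith [intervalIntegral.integral_nonneg (μ := volume) hx.2 fun t _ => kern_nonneg n t]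

lemma ofReal_mem_sector {n : ℕ} (hn : 3 ≤ n) {r : ℝ} (hr : 0 ≤ r) : (r : ℂ) ∈ sector n := by
  simpa [dir_zero] using mul_dir_mem_sector hn hr le_rfl (pi_div_pos hn).le

lemma realF_one_pos {n : ℕ} (hn : 3 ≤ n) : 0 < realF n 1 := by
  refine lt_of_le_of_ne (realF_nonneg ⟨zero_le_one, le_rfl⟩) fun h => ?_
  have h1 : F n 1 = F n 0 := by rw [F_one, ← h, F_zero, ofReal_zero]
  have := injOn_F_sector hn (by simpa using ofReal_mem_sector hn zero_le_one)
    (by simpa using ofReal_mem_sector hn le_rfl) h1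
  exact one_ne_zero this

/-- The distance from `A n` to the image of a point `x ≥ 1` of a slit. -/
def slitLength (n : ℕ) (x : ℝ) : ℝ := ∫ t in (1 : ℝ)..x, kern n t

/-- The distance from `0` to the image of `r e^{-iπ/n}`. -/
def rayLength (n : ℕ) (r : ℝ) : ℝ := ∫ t in (0 : ℝ)..r, 1 / (1 + t ^ n) ^ alpha n

/-- Past `1` the argument of `1 - t^n` is `π`, so the kernel has constant argument `-(π - π/n)`. The
image of `[1, ∞)` is therefore straight. -/
lemma K_of_one_lt {n : ℕ} (hn : 3 ≤ n) {t : ℝ} (ht : 1 < t) :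
    K n t = (kern n t : ℂ) * -dir (-(Real.pi / n)) := by
  have h1 : 1 < t ^ n := one_lt_pow₀ ht (by omega)
  have h2 : (1 : ℂ) - (t : ℂ) ^ n = ((1 - t ^ n : ℝ) : ℂ) := by push_cast; ring
  have h3 : (1 : ℂ) - (t : ℂ) ^ n ≠ 0 := by
    rw [h2, ofReal_ne_zero]; linarith
  rw [K_polar h3, h2, arg_ofReal_of_neg (by linarith), norm_real, Real.norm_eq_abs]
  congr 1
  rw [alpha_mul_pi hn]
  apply Complex.ext <;> simp [dir_re, dir_im]

lemma F_of_one_le {n : ℕ} (hn : 3 ≤ n) {x : ℝ} (hx : 1 ≤ x) :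
    F n x = realF n 1 - slitLength n x * dir (-(Real.pi / n)) := by
  have h1 := F_ofReal_mul n x 1
  have h2 := F_ofReal_mul n 1 1
  rw [mul_one, one_mul] at h1 h2
  rw [ofReal_one, F_one] at h2
  have hint : ∀ a b : ℝ, 0 ≤ a → a ≤ b →
      IntervalIntegrable (fun t : ℝ => K n (t * 1)) volume a b := by
    intro a b ha hab
    rw [intervalIntegrable_iff_integrableOn_Ioc_of_le hab]
    exact (integrableOn_K_ray hn norm_one).mono_set fun t ht => lt_of_le_of_lt ha ht.1
  rw [h1, ← intervalIntegral.integral_add_adjacent_intervals (hint 0 1 le_rfl zero_le_one)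
    (hint 1 x zero_le_one hx), ← h2, slitLength, sub_eq_add_neg, ← mul_neg,
    ← intervalIntegral.integral_ofReal, ← intervalIntegral.integral_mul_const]
  congr 1
  refine intervalIntegral.integral_congr_ae ?_
  refine Eventually.of_forall fun t ht => ?_
  rw [Set.uIoc_of_le hx] at ht
  rw [mul_one]
  exact K_of_one_lt hn ht.1

lemma F_ray {n : ℕ} (hn : 3 ≤ n) {r : ℝ} (hr : 0 ≤ r) :
    F n (r * dir (Real.pi / n)) = rayLength n r * dir (Real.pi / n) := by
  rw [F_ofReal_mul, mul_comm, rayLength, ← intervalIntegral.integral_ofReal]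
  congr 1
  refine intervalIntegral.integral_congr fun t ht => ?_
  rw [Set.uIcc_of_le hr] at ht
  have := pow_nonneg ht.1 n
  simp only [K_eq_alpha]
  rw [ray_pow hn, ofReal_div, ofReal_cpow (by linarith)]
  push_cast; ring_nf

lemma slitLength_nonneg {n : ℕ} {x : ℝ} (hx : 1 ≤ x) : 0 ≤ slitLength n x :=
  intervalIntegral.integral_nonneg hx fun t _ => kern_nonneg n t

lemma rayLength_nonneg {n : ℕ} {r : ℝ} (hr : 0 ≤ r) : 0 ≤ rayLength n r := by
  refine intervalIntegral.integral_nonneg hr fun t ht => ?_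
  have := pow_nonneg ht.1 n
  positivity

lemma integrableOn_ray {n : ℕ} (hn : 3 ≤ n) :
    IntegrableOn (fun t : ℝ => 1 / (1 + t ^ n) ^ alpha n) (Set.Ioi 0) := by
  refine (integrableOn_kern hn).mono' (Measurable.aestronglyMeasurable (by fun_prop)) ?_
  have hal := alpha_pos hn
  filter_upwards [ae_restrict_mem measurableSet_Ioi, ae_restrict_of_ae (ae_ne 1)] with t ht ht1
  have h0 : 0 ≤ t := le_of_lt ht
  have h1 := pow_nonneg h0 n
  have h2 : 0 < |1 - t ^ n| :=
    lt_of_lt_of_le (abs_pos.2 (sub_ne_zero.2 (Ne.symm ht1))) (abs_sub_le_abs_one_sub_pow hn h0)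
  rw [Real.norm_of_nonneg (by positivity), kern]
  gcongr
  rw [abs_le]; constructor <;> linarith

lemma tendsto_slitLength {n : ℕ} (hn : 3 ≤ n) :
    Tendsto (slitLength n) atTop (𝓝 (∫ t in Set.Ioi (1 : ℝ), kern n t)) :=
  intervalIntegral_tendsto_integral_Ioi 1
    ((integrableOn_kern hn).mono_set (Set.Ioi_subset_Ioi zero_le_one)) tendsto_id

lemma tendsto_rayLength {n : ℕ} (hn : 3 ≤ n) :
    Tendsto (rayLength n) atTop (𝓝 (∫ t in Set.Ioi (0 : ℝ), 1 / (1 + t ^ n) ^ alpha n)) :=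
  intervalIntegral_tendsto_integral_Ioi 0 (integrableOn_ray hn) tendsto_id

/-- The length of the sides of the quadrilateral issuing from `P n`. -/
def sideLength (n : ℕ) : ℝ := realF n 1 / (2 * Real.cos (Real.pi / n))

lemma sideLength_pos {n : ℕ} (hn : 3 ≤ n) : 0 < sideLength n := by
  have := half_le_cos hn
  have := realF_one_pos hn
  unfold sideLength
  positivity

lemma two_mul_sideLength {n : ℕ} (hn : 3 ≤ n) :
    2 * (sideLength n * Real.cos (Real.pi / n)) = realF n 1 := by
  have : Real.cos (Real.pi / n) ≠ 0 := by have := half_le_cos hn; linarith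
  unfold sideLength; field_simp

lemma conj_P (n : ℕ) : conj (P n) = sideLength n * dir (Real.pi / n) := by
  rw [P, map_mul, conj_ofReal, ← exp_conj, dir]
  congr 1
  · rw [ofReal_inj, piN, sideLength]
    ring
  · congr 1; simp; ring

/-- The arc estimate forces the images of the two unbounded edges to have the same limit. Imaginary
parts give equality of the two lengths, and real parts then give their value. -/
lemma limits_eq {n : ℕ} (hn : 3 ≤ n) :
    (∫ t in Set.Ioi (1 : ℝ), kern n t) = sideLength n ∧
    (∫ t in Set.Ioi (0 : ℝ), 1 / (1 + t ^ n) ^ alpha n) = sideLength n := by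
  set M := ∫ t in Set.Ioi (1 : ℝ), kern n t
  set L := ∫ t in Set.Ioi (0 : ℝ), 1 / (1 + t ^ n) ^ alpha n
  have h1 : Tendsto (fun r : ℝ => F n r - F n (r * dir (Real.pi / n))) atTop
      (𝓝 ((realF n 1 - M * dir (-(Real.pi / n))) - L * dir (Real.pi / n))) := by
    have hM := (continuous_ofReal.tendsto M).comp (tendsto_slitLength hn)
    have hL := (continuous_ofReal.tendsto L).comp (tendsto_rayLength hn)
    refine (((hM.mul_const (dir (-(Real.pi / n)))).const_sub (realF n 1 : ℂ)).sub
      (hL.mul_const (dir (Real.pi / n)))).congr' ?_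
    filter_upwards [eventually_ge_atTop 1] with r hr
    rw [F_of_one_le hn hr, F_ray hn (by linarith)]
    rfl
  have h2 : Tendsto (fun r : ℝ => F n r - F n (r * dir (Real.pi / n))) atTop (𝓝 0) := by
    refine squeeze_zero_norm' ?_ (tendsto_const_nhds.div_atTop tendsto_id : Tendsto
      (fun r : ℝ => 36 / r) atTop (𝓝 0))
    filter_upwards [eventually_ge_atTop 6] with r hr
    have hr0 : (0 : ℝ) ≤ r := by linarith
    exact norm_F_sub_le hn hr (ofReal_mem_sector hn hr0)
      (mul_dir_mem_sector hn hr0 (pi_div_pos hn).le le_rfl)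
      (by rw [norm_real, Real.norm_of_nonneg hr0])
      (by rw [norm_mul, norm_dir, norm_real, Real.norm_of_nonneg hr0, mul_one])
  have h3 := tendsto_nhds_unique h1 h2
  have hre := congrArg re h3
  have him := congrArg im h3
  simp only [sub_re, sub_im, re_ofReal_mul, im_ofReal_mul, dir_re, dir_im, ofReal_re, ofReal_im,
    Real.cos_neg, Real.sin_neg, zero_re, zero_im] at hre him
  have hs := sin_pos hn
  have hc := half_le_cos hn
  have h4 : (L - M) * Real.sin (Real.pi / n) = 0 := by linarith
  have h5 : L = M := by
    rcases mul_eq_zero.1 h4 with h | h <;> linarith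
  have h6 := two_mul_sideLength hn
  have h7 : (M - sideLength n) * Real.cos (Real.pi / n) = 0 := by rw [h5] at hre; linarith
  have h8 : M = sideLength n := by
    rcases mul_eq_zero.1 h7 with h | h <;> linarith
  exact ⟨h8, h5.trans h8⟩

lemma slitLength_le {n : ℕ} (hn : 3 ≤ n) {x : ℝ} (hx : 1 ≤ x) : slitLength n x ≤ sideLength n := by
  rw [slitLength, intervalIntegral.integral_of_le hx, ← (limits_eq hn).1]
  exact setIntegral_mono_set ((integrableOn_kern hn).mono_set (Set.Ioi_subset_Ioi zero_le_one))
    (Eventually.of_forall fun t => kern_nonneg n t) (Set.Ioc_subset_Ioi_self).eventuallyLE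

lemma rayLength_le {n : ℕ} (hn : 3 ≤ n) {r : ℝ} (hr : 0 ≤ r) : rayLength n r ≤ sideLength n := by
  rw [rayLength, intervalIntegral.integral_of_le hr, ← (limits_eq hn).2]
  refine setIntegral_mono_set (integrableOn_ray hn) ?_ (Set.Ioc_subset_Ioi_self).eventuallyLE
  filter_upwards [ae_restrict_mem measurableSet_Ioi] with t ht
  have h0 : 0 < t := ht
  change 0 ≤ 1 / (1 + t ^ n) ^ alpha n
  positivity

lemma tendsto_F_ofReal {n : ℕ} (hn : 3 ≤ n) :
    Tendsto (fun r : ℝ => F n r) atTop (𝓝 (conj (P n))) := by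
  have hM := (continuous_ofReal.tendsto _).comp (tendsto_slitLength hn)
  rw [(limits_eq hn).1] at hM
  have h := (hM.mul_const (dir (-(Real.pi / n)))).const_sub (realF n 1 : ℂ)
  have h2 : (realF n 1 : ℂ) - sideLength n * dir (-(Real.pi / n)) = conj (P n) := by
    have := two_mul_sideLength hn
    rw [conj_P]
    apply Complex.ext
    · simp only [sub_re, re_ofReal_mul, dir_re, ofReal_re, Real.cos_neg]; linarith
    · simp only [sub_im, im_ofReal_mul, dir_im, ofReal_im, Real.sin_neg]; ring
  rw [h2] at h
  refine h.congr' ?_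
  filter_upwards [eventually_ge_atTop 1] with r hr using (F_of_one_le hn hr).symm

lemma exists_F_near_conj_P {n : ℕ} (hn : 3 ≤ n) {ε : ℝ} (hε : 0 < ε) :
    ∃ R : ℝ, ∀ z ∈ sector n, R ≤ ‖z‖ → ‖F n z - conj (P n)‖ < ε := by
  have h1 := (tendsto_iff_norm_sub_tendsto_zero.1 (tendsto_F_ofReal hn)).eventually
    (gt_mem_nhds (half_pos hε))
  have h2 := (tendsto_const_nhds.div_atTop tendsto_id : Tendsto
      (fun r : ℝ => 36 / r) atTop (𝓝 0)).eventually (gt_mem_nhds (half_pos hε))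
  obtain ⟨R, hR⟩ := eventually_atTop.1 ((h1.and h2).and (eventually_ge_atTop 6))
  refine ⟨R, fun z hz hzR => ?_⟩
  obtain ⟨⟨h3, h4⟩, h5⟩ := hR _ hzR
  have h6 := norm_F_sub_le hn h5 hz (ofReal_mem_sector hn (norm_nonneg z)) rfl
    (by rw [norm_real, norm_norm])
  calc ‖F n z - conj (P n)‖ = ‖(F n z - F n ‖z‖) + (F n ‖z‖ - conj (P n))‖ := by congr 1; ring
    _ ≤ _ := norm_add_le _ _
    _ < ε := by linarith

lemma conj_P_notMem_image {n : ℕ} (hn : 3 ≤ n) : conj (P n) ∉ F n '' sector n :=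
  notMem_image_of_tendsto hn (tendsto_F_ofReal hn)

/-! ### The image of the sector is a triangle. -/

/-- The linear functional whose level set `realF n 1 * sin (π/n)` is the line through `A n` and
`conj (P n)`. -/
def ell (n : ℕ) (w : ℂ) : ℝ := w.re * Real.sin (Real.pi / n) - w.im * Real.cos (Real.pi / n)

/-- The closed triangle with vertices `0`, `A n`, `conj (P n)`. -/
def tri (n : ℕ) : Set ℂ := {w ∈ sector n | ell n w ≤ realF n 1 * Real.sin (Real.pi / n)}

/-- The open triangle with vertices `0`, `A n`, `conj (P n)`. -/
def triInt (n : ℕ) : Set ℂ := {w ∈ sectorInt n | ell n w < realF n 1 * Real.sin (Real.pi / n)}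

lemma triInt_subset (n : ℕ) : triInt n ⊆ tri n := fun _ h => ⟨sectorInt_subset n h.1, h.2.le⟩

lemma ell_F_of_one_le {n : ℕ} (hn : 3 ≤ n) {x : ℝ} (hx : 1 ≤ x) :
    ell n (F n x) = realF n 1 * Real.sin (Real.pi / n) := by
  rw [F_of_one_le hn hx, ell]
  simp only [sub_re, sub_im, re_ofReal_mul, im_ofReal_mul, dir_re, dir_im, ofReal_re, ofReal_im,
    Real.cos_neg, Real.sin_neg]
  ring

lemma ell_ray {n : ℕ} (r : ℝ) : ell n (r * dir (Real.pi / n)) =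
    2 * (r * Real.cos (Real.pi / n)) * Real.sin (Real.pi / n) := by
  rw [ell]
  simp only [re_ofReal_mul, im_ofReal_mul, dir_re, dir_im]
  ring

lemma sector_boundary_cases {n : ℕ} (hn : 3 ≤ n) {z : ℂ} (hz : z ∈ sector n)
    (h : z ∉ sectorInt n) : z = (‖z‖ : ℂ) ∨ z = (‖z‖ : ℂ) * dir (Real.pi / n) := by
  obtain ⟨θ, h0, h1, hp⟩ := exists_polar_of_mem_sector hn hz
  by_cases hz0 : z = 0
  · left; simp [hz0]
  rcases h0.lt_or_eq with h2 | h2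
  · rcases h1.lt_or_eq with h3 | h3
    · exact absurd (hp ▸ mul_dir_mem_sectorInt hn (norm_pos_iff.2 hz0) h2 h3) h
    · right; rwa [h3] at hp
  · left; rwa [← h2, dir_zero, mul_one] at hp

/-- The pieces `[0,1]`, `[1,∞)` and the lower ray of the boundary go into the three sides, by the
explicit length formulas. -/
lemma F_boundary_mem {n : ℕ} (hn : 3 ≤ n) {z : ℂ} (hz : z ∈ sector n) (h : z ∉ sectorInt n) :
    F n z ∈ tri n ∧ F n z ∉ triInt n := by
  have hs := sin_pos hn
  have hc := half_le_cos hn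
  have h2 := two_mul_sideLength hn
  rcases sector_boundary_cases hn hz h with h1 | h1
  · rcases le_total ‖z‖ 1 with h3 | h3
    · have hm : ‖z‖ ∈ Set.Icc (0 : ℝ) 1 := ⟨norm_nonneg z, h3⟩
      rw [h1, F_ofReal_of_mem_Icc hm]
      refine ⟨⟨ofReal_mem_sector hn (realF_nonneg hm), ?_⟩, fun h' => ?_⟩
      · have := realF_le hn hm
        simp only [ell, ofReal_re, ofReal_im, zero_mul, sub_zero]
        gcongr
      · simpa using h'.1.1
    · rw [h1]
      refine ⟨⟨⟨?_, ?_⟩, (ell_F_of_one_le hn h3).le⟩, fun h' =>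
        (ne_of_lt h'.2) (ell_F_of_one_le hn h3)⟩
      · rw [F_of_one_le hn h3]
        simp only [sub_im, im_ofReal_mul, dir_im, ofReal_im, Real.sin_neg]
        nlinarith [mul_nonneg (slitLength_nonneg (n := n) h3) hs.le]
      · rw [F_of_one_le hn h3]
        simp only [sub_re, sub_im, re_ofReal_mul, im_ofReal_mul, dir_re, dir_im, ofReal_re,
          ofReal_im, Real.cos_neg, Real.sin_neg]
        have h4 := slitLength_le hn h3
        have h5 : 0 ≤ (sideLength n - slitLength n ‖z‖) * Real.cos (Real.pi / n) :=
          mul_nonneg (by linarith) (by linarith)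
        rw [← h2]
        nlinarith [mul_nonneg h5 hs.le]
  · rw [h1, F_ray hn (norm_nonneg z)]
    have h3 := rayLength_nonneg (n := n) (norm_nonneg z)
    refine ⟨⟨mul_dir_mem_sector hn h3 (pi_div_pos hn).le le_rfl, ?_⟩, fun h' => ?_⟩
    · have h4 := rayLength_le hn (norm_nonneg z)
      rw [ell_ray, ← h2]
      gcongr
    · have := h'.1.2
      rw [re_ofReal_mul, im_ofReal_mul, dir_re, dir_im] at this
      linarith

lemma conj_P_notMem_triInt {n : ℕ} : conj (P n) ∉ triInt n := by
  intro h
  have := h.1.2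
  rw [conj_P, re_ofReal_mul, im_ofReal_mul, dir_re, dir_im] at this
  linarith

lemma conj_P_mem_tri {n : ℕ} (hn : 3 ≤ n) : conj (P n) ∈ tri n := by
  rw [conj_P]
  refine ⟨mul_dir_mem_sector hn (sideLength_pos hn).le (pi_div_pos hn).le le_rfl, ?_⟩
  rw [ell_ray, two_mul_sideLength hn]

/-- A bounded part of the sector has compact image, and the remainder maps close to `conj (P n)`.
Taking half the distance from `y` to `conj (P n)` as tolerance leaves only the compact image. -/
lemma closure_F_image_sector {n : ℕ} (hn : 3 ≤ n) :
    closure (F n '' sector n) ⊆ insert (conj (P n)) (F n '' sector n) := by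
  intro y hy
  by_cases hyP : y = conj (P n)
  · exact Or.inl hyP
  right
  obtain ⟨R, hR⟩ := exists_F_near_conj_P hn (half_pos (norm_pos_iff.2 (sub_ne_zero.2 hyP)))
  have hcomp : IsCompact (F n '' (sector n ∩ Metric.closedBall 0 R)) :=
    ((isCompact_closedBall 0 R).inter_left (isClosed_sector n)).image_of_continuousOn
      ((continuousOn_F_sector hn).mono Set.inter_subset_left)
  have h1 : F n '' sector n ⊆ F n '' (sector n ∩ Metric.closedBall 0 R) ∪
      Metric.closedBall (conj (P n)) (‖y - conj (P n)‖ / 2) := by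
    rintro _ ⟨z, hz, rfl⟩
    rcases le_total R ‖z‖ with h | h
    · right
      rw [mem_closedBall_iff_norm]
      exact (hR z hz h).le
    · left
      exact ⟨z, ⟨hz, by simpa using h⟩, rfl⟩
  have h2 := closure_minimal h1 (hcomp.isClosed.union Metric.isClosed_closedBall) hy
  rcases h2 with h | h
  · exact Set.image_mono Set.inter_subset_left h
  · rw [mem_closedBall_iff_norm] at h
    have := norm_pos_iff.2 (sub_ne_zero.2 hyP)
    linarith

lemma isBounded_F_image_sector {n : ℕ} (hn : 3 ≤ n) : Bornology.IsBounded (F n '' sector n) := by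
  obtain ⟨R, hR⟩ := exists_F_near_conj_P hn one_pos
  have hcomp : IsCompact (F n '' (sector n ∩ Metric.closedBall 0 R)) :=
    ((isCompact_closedBall 0 R).inter_left (isClosed_sector n)).image_of_continuousOn
      ((continuousOn_F_sector hn).mono Set.inter_subset_left)
  refine (hcomp.isBounded.union (Metric.isBounded_closedBall (x := conj (P n)) (r := 1))).subset ?_
  rintro _ ⟨z, hz, rfl⟩
  rcases le_total R ‖z‖ with h | h
  · right
    rw [mem_closedBall_iff_norm]
    exact (hR z hz h).le
  · left
    exact ⟨z, ⟨hz, by simpa using h⟩, rfl⟩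

/-- A bounded open set lies in any open half-plane whose closure contains the boundary. -/
lemma lt_of_forall_boundary_le {W : Set ℂ} (hW : IsOpen W) (hb : Bornology.IsBounded W)
    {p q c : ℝ} (hpq : 0 < p * p + q * q)
    (h : ∀ y ∈ closure W, y ∉ W → p * y.re + q * y.im ≤ c) :
    ∀ y ∈ W, p * y.re + q * y.im < c := by
  set f : ℂ → ℝ := fun y => p * y.re + q * y.im with hf
  have hfc : Continuous f := by fun_prop
  -- A small move along the gradient `(p, q)` increases the functional, so its maximum on the
  -- compact closure is attained off `W`.
  have hnomax : ∀ y ∈ W, ∃ y' ∈ W, f y < f y' := by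
    intro y hy
    have hcont : ContinuousAt (fun ε : ℝ => y + ε * (⟨p, q⟩ : ℂ)) 0 := by fun_prop
    have h1 : ∀ᶠ ε : ℝ in 𝓝 0, y + ε * (⟨p, q⟩ : ℂ) ∈ W :=
      hcont.eventually_mem (hW.mem_nhds (by simpa using hy))
    obtain ⟨ε, h2, h3⟩ := ((h1.filter_mono nhdsWithin_le_nhds).and
      (self_mem_nhdsWithin : ∀ᶠ ε : ℝ in 𝓝[>] 0, ε ∈ Set.Ioi (0 : ℝ))).exists
    refine ⟨_, h2, ?_⟩
    simp only [hf, add_re, add_im, re_ofReal_mul, im_ofReal_mul]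
    nlinarith [mul_pos (show (0 : ℝ) < ε from h3) hpq]
  intro y hy
  obtain ⟨y₀, hy₀, hmax⟩ := hb.isCompact_closure.exists_isMaxOn ⟨y, subset_closure hy⟩
    hfc.continuousOn
  have h0 : y₀ ∉ W := fun h0 => by
    obtain ⟨y', h1, h2⟩ := hnomax y₀ h0
    exact absurd (hmax (subset_closure h1)) (not_le.2 h2)
  obtain ⟨y', h1, h2⟩ := hnomax y hy
  exact lt_of_lt_of_le h2 (le_trans (hmax (subset_closure h1)) (h y₀ hy₀ h0))

lemma isOpen_F_image_sectorInt {n : ℕ} (hn : 3 ≤ n) : IsOpen (F n '' sectorInt n) := by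
  have han : AnalyticOnNhd ℂ (F n) (sectorInt n) :=
    DifferentiableOn.analyticOnNhd (fun z hz => (hasDerivAt_F
      (sectorInt_subset_slitDomain hn hz)).differentiableAt.differentiableWithinAt)
      (isOpen_sectorInt n)
  rcases han.is_constant_or_isOpen (convex_sectorInt n).isPreconnected with ⟨w, hw⟩ | h
  · exfalso
    have hp := pi_div_pos hn
    have h1 := mul_dir_mem_sectorInt hn one_pos (half_pos hp) (half_lt_self hp)
    have h2 := mul_dir_mem_sectorInt hn two_pos (half_pos hp) (half_lt_self hp)
    have := injOn_F_sector hn (sectorInt_subset n h1) (sectorInt_subset n h2)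
      ((hw _ h1).trans (hw _ h2).symm)
    have := congrArg norm this
    simp at this
  · exact h _ subset_rfl (isOpen_sectorInt n)

lemma convex_triInt (n : ℕ) : Convex ℝ (triInt n) := by
  refine (convex_sectorInt n).inter ?_
  refine convex_halfSpace_lt (f := ell n) ⟨fun x y => ?_, fun c x => ?_⟩ _
  · simp only [ell, add_re, add_im]; ring
  · simp only [ell, real_smul, re_ofReal_mul, im_ofReal_mul, smul_eq_mul]; ring

lemma closure_F_image_diff {n : ℕ} (hn : 3 ≤ n) {y : ℂ} (hy : y ∈ closure (F n '' sectorInt n))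
    (hyW : y ∉ F n '' sectorInt n) : y ∈ tri n ∧ y ∉ triInt n := by
  rcases closure_F_image_sector hn (closure_mono (Set.image_mono (sectorInt_subset n)) hy) with
    h | ⟨z, hz, rfl⟩
  · rw [h]
    exact ⟨conj_P_mem_tri hn, conj_P_notMem_triInt⟩
  · exact F_boundary_mem hn hz fun h => hyW ⟨z, h, rfl⟩

lemma F_image_sectorInt {n : ℕ} (hn : 3 ≤ n) : F n '' sectorInt n = triInt n := by
  have hs := sin_pos hn
  have hopen := isOpen_F_image_sectorInt hn
  have hb := (isBounded_F_image_sector hn).subset (Set.image_mono (sectorInt_subset n))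
  have hsub : F n '' sectorInt n ⊆ triInt n := by
    intro y hy
    have h1 := lt_of_forall_boundary_le hopen hb (p := 0) (q := 1) (c := 0) (by norm_num)
      (fun y hy hyW => by simpa using (closure_F_image_diff hn hy hyW).1.1.1) y hy
    have h2 := lt_of_forall_boundary_le hopen hb (p := -Real.sin (Real.pi / n))
      (q := -Real.cos (Real.pi / n)) (c := 0) (by nlinarith)
      (fun y hy hyW => by linarith [(closure_F_image_diff hn hy hyW).1.1.2]) y hy
    have h3 := lt_of_forall_boundary_le hopen hb (p := Real.sin (Real.pi / n))
      (q := -Real.cos (Real.pi / n)) (c := realF n 1 * Real.sin (Real.pi / n)) (by nlinarith)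
      (fun y hy hyW => by
        have := (closure_F_image_diff hn hy hyW).1.2
        rw [ell] at this; linarith) y hy
    exact ⟨⟨by simpa using h1, by linarith⟩, by rw [ell]; linarith⟩
  refine hsub.antisymm ?_
  have hmem : F n (mid n) ∈ F n '' sectorInt n := by
    refine ⟨mid n, ?_, rfl⟩
    have := shift_mem_sectorInt hn (z := 0) (by simpa using ofReal_mem_sector hn le_rfl) one_pos
    simpa using this
  -- The image is open, and it is relatively closed in the open triangle because its other closure
  -- points lie outside; connectedness then gives the whole triangle.
  refine (convex_triInt n).isPreconnected.subset_of_closure_inter_subset hopen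
    ⟨_, hsub hmem, hmem⟩ ?_
  rintro y ⟨h1, h2⟩
  by_contra h
  exact (closure_F_image_diff hn h1 h).2 h2

lemma tri_subset_closure {n : ℕ} (hn : 3 ≤ n) : tri n ⊆ closure (triInt n) := by
  intro y hy
  obtain ⟨q, hq⟩ : (triInt n).Nonempty := by
    rw [← F_image_sectorInt hn]
    refine ⟨_, mid n, ?_, rfl⟩
    have := shift_mem_sectorInt hn (z := 0) (by simpa using ofReal_mem_sector hn le_rfl) one_pos
    simpa using this
  have hc : ContinuousAt (fun ε : ℝ => ((1 - ε : ℝ) : ℂ) * y + ε * q) 0 := by fun_prop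
  have ht : Tendsto (fun ε : ℝ => ((1 - ε : ℝ) : ℂ) * y + ε * q) (𝓝[>] 0) (𝓝 y) := by
    have := hc.tendsto
    simp only [sub_zero, ofReal_one, one_mul, ofReal_zero, zero_mul, add_zero] at this
    exact this.mono_left nhdsWithin_le_nhds
  refine mem_closure_of_tendsto ht ?_
  filter_upwards [Ioo_mem_nhdsGT one_pos] with ε hε
  refine ⟨add_mem_sectorInt (pos_mul_mem_sector hy.1 (by linarith [hε.2]))
    (pos_mul_mem_sectorInt hq.1 hε.1), ?_⟩
  have h1 := hy.2
  have h2 := hq.2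
  simp only [ell, add_re, add_im, re_ofReal_mul, im_ofReal_mul] at h1 h2 ⊢
  nlinarith [mul_le_mul_of_nonneg_left h1 (by linarith [hε.2] : 0 ≤ 1 - ε),
    mul_lt_mul_of_pos_left h2 hε.1]

lemma F_image_sector {n : ℕ} (hn : 3 ≤ n) : F n '' sector n = tri n \ {conj (P n)} := by
  ext y
  constructor
  · intro hy
    refine ⟨?_, fun h => conj_P_notMem_image hn (h ▸ hy)⟩
    obtain ⟨z, hz, rfl⟩ := hy
    by_cases h : z ∈ sectorInt n
    · exact triInt_subset n (F_image_sectorInt hn ▸ ⟨z, h, rfl⟩)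
    · exact (F_boundary_mem hn hz h).1
  · rintro ⟨hy, hyP⟩
    have h1 := tri_subset_closure hn hy
    rw [← F_image_sectorInt hn] at h1
    exact (closure_F_image_sector hn (closure_mono (Set.image_mono (sectorInt_subset n)) h1)
      ).resolve_left hyP

/-! ### Folding the plane onto the sector by the dihedral group. -/

/-- The reflection of `v` into the closed upper half plane. -/
def upper (v : ℂ) : ℂ := ⟨v.re, |v.im|⟩

lemma upper_of_nonneg {v : ℂ} (h : 0 ≤ v.im) : upper v = v := by
  apply Complex.ext <;> simp [upper, abs_of_nonneg h]

lemma upper_of_nonpos {v : ℂ} (h : v.im ≤ 0) : upper v = conj v := by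
  apply Complex.ext <;> simp [upper, abs_of_nonpos h]

lemma upper_conj (v : ℂ) : upper (conj v) = upper v := by simp [upper]

lemma upper_im_nonneg (v : ℂ) : 0 ≤ (upper v).im := abs_nonneg _

lemma norm_upper (v : ℂ) : ‖upper v‖ = ‖v‖ := by
  rcases le_total 0 v.im with h | h
  · rw [upper_of_nonneg h]
  · rw [upper_of_nonpos h, RCLike.norm_conj]

lemma continuous_upper : Continuous upper := by
  have : upper = fun v => (v.re : ℂ) + (|v.im| : ℝ) * I := by
    funext v; apply Complex.ext <;> simp [upper]
  rw [this]
  fun_prop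

/-- The representative in the closed sector of the orbit of `w` under the dihedral group. -/
def fold (n : ℕ) (w : ℂ) : ℂ := conj (upper (w ^ n) ^ (((n : ℝ)⁻¹ : ℝ) : ℂ))

lemma norm_fold {n : ℕ} (hn : 3 ≤ n) (w : ℂ) : ‖fold n w‖ = ‖w‖ := by
  rw [fold, RCLike.norm_conj, norm_cpow_real, norm_upper, norm_pow]
  exact Real.pow_rpow_inv_natCast (norm_nonneg w) (by omega)

lemma fold_zero {n : ℕ} (hn : 3 ≤ n) : fold n 0 = 0 := by
  rw [← norm_eq_zero, norm_fold hn, norm_zero]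

lemma fold_mem_sector {n : ℕ} (hn : 3 ≤ n) (w : ℂ) : fold n w ∈ sector n := by
  rcases eq_or_ne w 0 with rfl | hw
  · rw [fold_zero hn]
    simpa using ofReal_mem_sector hn le_rfl
  have hu : upper (w ^ n) ≠ 0 := by
    rw [← norm_ne_zero_iff, norm_upper, norm_ne_zero_iff]
    exact pow_ne_zero n hw
  have hn0 : (0 : ℝ) < n := by have : 0 < n := by omega
                               exact_mod_cast this
  have h1 : fold n w = ((Real.exp (Real.log ‖upper (w ^ n)‖ * (n : ℝ)⁻¹) : ℝ) : ℂ) *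
      dir (arg (upper (w ^ n)) / n) := by
    rw [fold, cpow_def_of_ne_zero hu, ← exp_conj, ofReal_exp, dir, ← exp_add]
    congr 1
    apply Complex.ext
    · simp [log_re]
    · simp [log_im, div_eq_mul_inv]
  rw [h1]
  have h2 : 0 ≤ arg (upper (w ^ n)) := arg_nonneg_iff.2 (upper_im_nonneg _)
  refine mul_dir_mem_sector hn (Real.exp_pos _).le (by positivity) ?_
  gcongr
  exact arg_le_pi _

lemma fold_pow {n : ℕ} (hn : 3 ≤ n) (w : ℂ) : fold n w ^ n = conj (upper (w ^ n)) := by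
  rw [fold, ← map_pow]
  push_cast
  rw [cpow_nat_inv_pow _ (by omega)]

/-- The branch cut of the root does no harm, since `upper` keeps its argument in the closed upper
half-plane; at `0` the norm identity suffices. -/
lemma continuous_fold {n : ℕ} (hn : 3 ≤ n) : Continuous (fold n) := by
  rw [continuous_iff_continuousAt]
  intro w
  rcases eq_or_ne w 0 with rfl | hw
  · have : Tendsto (fold n) (𝓝 0) (𝓝 0) := by
      refine squeeze_zero_norm (fun w => (norm_fold hn w).le) ?_
      simpa using (continuous_norm (E := ℂ)).tendsto 0
    unfold ContinuousAt
    rwa [fold_zero hn]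
  · have hu : upper (w ^ n) ≠ 0 := by
      rw [← norm_ne_zero_iff, norm_upper, norm_ne_zero_iff]
      exact pow_ne_zero n hw
    have h1 : ContinuousWithinAt (fun w => upper (w ^ n)) Set.univ w :=
      (continuous_upper.comp (continuous_pow n)).continuousWithinAt
    have h2 := ContinuousWithinAt.comp (f := fun w => upper (w ^ n))
      (continuousWithinAt_cpow_upper hu (((n : ℝ)⁻¹ : ℝ) : ℂ)) h1
      (fun w _ => upper_im_nonneg (w ^ n))
    exact continuous_conj.continuousAt.comp ((continuousWithinAt_univ _ _).1 h2)

/-- Moduli agree, and the angles `n * θ` lie in `[0, π]`, where the cosine is injective. This makes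
the n-th power a complete coordinate for identities about `fold`. -/
lemma injOn_pow_sector {n : ℕ} (hn : 3 ≤ n) : Set.InjOn (fun z : ℂ => z ^ n) (sector n) := by
  intro z hz w hw h
  simp only at h
  have hnorm : ‖z‖ = ‖w‖ := by
    have := congrArg norm h
    rw [norm_pow, norm_pow] at this
    exact (pow_left_inj₀ (norm_nonneg z) (norm_nonneg w) (by omega)).1 this
  obtain ⟨θ, h0, h1, hp⟩ := exists_polar_of_mem_sector hn hz
  obtain ⟨φ, h0', h1', hp'⟩ := exists_polar_of_mem_sector hn hw
  rcases eq_or_ne z 0 with rfl | hz0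
  · rw [norm_zero] at hnorm
    exact (norm_eq_zero.1 hnorm.symm).symm
  rw [hp, hp', pow_polar, pow_polar, hnorm] at h
  have h2 : dir (n * θ) = dir (n * φ) := by
    refine mul_left_cancel₀ ?_ h
    rw [ofReal_ne_zero, ← hnorm]
    exact pow_ne_zero n (norm_ne_zero_iff.2 hz0)
  have h3 := congrArg re h2
  rw [dir_re, dir_re] at h3
  have h4 := Real.injOn_cos (natCast_mul_mem hn h0 h1) (natCast_mul_mem hn h0' h1') h3
  have hn0 : (n : ℝ) ≠ 0 := by have : n ≠ 0 := by omega
                               exact_mod_cast this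
  rw [hp, hp', hnorm, mul_left_cancel₀ hn0 h4]

lemma fold_of_mem_sector {n : ℕ} (hn : 3 ≤ n) {w : ℂ} (hw : w ∈ sector n) : fold n w = w := by
  refine injOn_pow_sector hn (fold_mem_sector hn w) hw ?_
  simp only
  rw [fold_pow hn, upper_of_nonpos (pow_im_nonpos hn hw), conj_conj]

lemma fold_conj (n : ℕ) (w : ℂ) : fold n (conj w) = fold n w := by
  rw [fold, fold, ← map_pow, upper_conj]

lemma isPrimitiveRoot_omega {n : ℕ} (hn : 3 ≤ n) : IsPrimitiveRoot (omega n) n := by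
  have := Complex.isPrimitiveRoot_exp n (by omega)
  unfold omega
  convert this using 2

lemma omega_pow_self {n : ℕ} (hn : 3 ≤ n) : omega n ^ n = 1 := (isPrimitiveRoot_omega hn).pow_eq_one

lemma omega_pow_pow {n : ℕ} (hn : 3 ≤ n) (k : ℕ) : (omega n ^ k) ^ n = 1 := by
  rw [← pow_mul, mul_comm, pow_mul, omega_pow_self hn, one_pow]

lemma omega_pow_mul_pow {n : ℕ} (hn : 3 ≤ n) (k : ℕ) (w : ℂ) :
    (omega n ^ k * w) ^ n = w ^ n := by
  rw [mul_pow, omega_pow_pow hn, one_mul]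

lemma fold_omega_pow_mul {n : ℕ} (hn : 3 ≤ n) (k : ℕ) (w : ℂ) :
    fold n (omega n ^ k * w) = fold n w := by
  rw [fold, fold, omega_pow_mul_pow hn]

lemma omega_eq_dir (n : ℕ) : omega n = dir (-(2 * (Real.pi / n))) := by
  rw [omega, dir]; congr 1; push_cast; ring

lemma norm_omega (n : ℕ) : ‖omega n‖ = 1 := by rw [omega_eq_dir, norm_dir]

lemma norm_omega_pow (n k : ℕ) : ‖omega n ^ k‖ = 1 := by rw [norm_pow, norm_omega, one_pow]

lemma omega_ne_zero (n : ℕ) : omega n ≠ 0 := exp_ne_zero _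

lemma conj_omega_mul (n : ℕ) : conj (omega n) * omega n = 1 := by
  rw [conj_mul', norm_omega]; simp

lemma omega_pow_mul_conj (n k : ℕ) : omega n ^ k * conj (omega n ^ k) = 1 := by
  rw [mul_conj', norm_omega_pow]; simp

lemma exists_omega_pow_of_pow_eq {n : ℕ} (hn : 3 ≤ n) {z w : ℂ} (h : z ^ n = w ^ n) :
    ∃ k < n, z = omega n ^ k * w := by
  rcases eq_or_ne w 0 with rfl | hw
  · rw [zero_pow (by omega)] at h
    exact ⟨0, by omega, by simpa using (pow_eq_zero_iff (by omega)).1 h⟩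
  have h1 : (z / w) ^ n = 1 := by rw [div_pow, h, div_self (pow_ne_zero n hw)]
  have : NeZero n := ⟨by omega⟩
  obtain ⟨k, hk, h2⟩ := (isPrimitiveRoot_omega hn).eq_pow_of_pow_eq_one h1
  exact ⟨k, hk, by rw [h2, div_mul_cancel₀ z hw]⟩

lemma exists_eq_omega_pow_mul_fold {n : ℕ} (hn : 3 ≤ n) {w : ℂ} (h : (w ^ n).im ≤ 0) :
    ∃ k < n, w = omega n ^ k * fold n w := by
  apply exists_omega_pow_of_pow_eq hn
  rw [fold_pow hn, upper_of_nonpos h, conj_conj]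

lemma exists_eq_omega_pow_mul_conj_fold {n : ℕ} (hn : 3 ≤ n) {w : ℂ} (h : 0 ≤ (w ^ n).im) :
    ∃ k < n, w = omega n ^ k * conj (fold n w) := by
  apply exists_omega_pow_of_pow_eq hn
  rw [← map_pow, fold_pow hn, upper_of_nonneg h, conj_conj]

lemma fold_ofReal_mul {n : ℕ} (hn : 3 ≤ n) {r : ℝ} (hr : 0 ≤ r) (w : ℂ) :
    fold n (r * w) = r * fold n w := by
  refine injOn_pow_sector hn (fold_mem_sector hn _)
    (pos_mul_mem_sector (fold_mem_sector hn w) hr) ?_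
  simp only
  rw [fold_pow hn, mul_pow, mul_pow, fold_pow hn, ← ofReal_pow]
  have : 0 ≤ r ^ n := pow_nonneg hr n
  apply Complex.ext <;>
    simp only [upper, conj_re, conj_im, re_ofReal_mul, im_ofReal_mul, abs_mul, abs_of_nonneg this,
      mul_neg]

/-! ### The region `Omega n` as a sublevel set. -/

/-- The gauge of the star-shaped region made of the rotated quadrilaterals. -/
def lam (n : ℕ) (w : ℂ) : ℝ := ell n (fold n w)

lemma continuous_ell (n : ℕ) : Continuous (ell n) := by unfold ell; fun_prop

lemma continuous_lam {n : ℕ} (hn : 3 ≤ n) : Continuous (lam n) :=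
  (continuous_ell n).comp (continuous_fold hn)

lemma lam_of_mem_sector {n : ℕ} (hn : 3 ≤ n) {w : ℂ} (hw : w ∈ sector n) : lam n w = ell n w := by
  rw [lam, fold_of_mem_sector hn hw]

lemma lam_conj (n : ℕ) (w : ℂ) : lam n (conj w) = lam n w := by rw [lam, lam, fold_conj]

lemma lam_omega_pow_mul {n : ℕ} (hn : 3 ≤ n) (k : ℕ) (w : ℂ) :
    lam n (omega n ^ k * w) = lam n w := by rw [lam, lam, fold_omega_pow_mul hn]

lemma lam_ofReal_mul {n : ℕ} (hn : 3 ≤ n) {r : ℝ} (hr : 0 ≤ r) (w : ℂ) :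
    lam n (r * w) = r * lam n w := by
  rw [lam, lam, fold_ofReal_mul hn hr, ell, ell, re_ofReal_mul, im_ofReal_mul]; ring

/-- The level of `lam n` on the boundary of `Omega n`. -/
def level (n : ℕ) : ℝ := realF n 1 * Real.sin (Real.pi / n)

lemma level_pos {n : ℕ} (hn : 3 ≤ n) : 0 < level n := mul_pos (realF_one_pos hn) (sin_pos hn)

lemma tendsto_smul_one (w : ℂ) (l : Filter ℝ) (hl : l ≤ 𝓝 1) :
    Tendsto (fun t : ℝ => (t : ℂ) * w) l (𝓝 w) := by
  have : ContinuousAt (fun t : ℝ => (t : ℂ) * w) 1 := by fun_prop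
  have h := this.tendsto
  rw [ofReal_one, one_mul] at h
  exact h.mono_left hl

/-- By homogeneity and `level n > 0`, scaling a point of the level set by any `t > 1` leaves the
sublevel set. The closure statement uses scaling by `t < 1` in the same way. -/
lemma interior_lam_le {n : ℕ} (hn : 3 ≤ n) :
    interior {w | lam n w ≤ level n} = {w | lam n w < level n} := by
  apply Set.Subset.antisymm
  · intro w hw
    refine lt_of_le_of_ne (show lam n w ≤ level n from (interior_subset hw :)) fun h => ?_
    have h1 := (tendsto_smul_one w (𝓝[>] 1) nhdsWithin_le_nhds).eventually
      (mem_interior_iff_mem_nhds.1 hw)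
    obtain ⟨t, h2, h3⟩ := (h1.and self_mem_nhdsWithin).exists
    have h4 : (1 : ℝ) < t := h3
    change lam n (t * w) ≤ level n at h2
    rw [lam_ofReal_mul hn (by linarith), h] at h2
    nlinarith [level_pos hn]
  · exact interior_maximal (fun w (hw : lam n w < level n) => show lam n w ≤ level n from hw.le)
      (isOpen_lt (continuous_lam hn) continuous_const)

lemma closure_lam_lt {n : ℕ} (hn : 3 ≤ n) :
    closure {w | lam n w < level n} = {w | lam n w ≤ level n} := by
  apply Set.Subset.antisymm
  · exact closure_minimal (fun w (hw : lam n w < level n) => show lam n w ≤ level n from hw.le)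
      (isClosed_le (continuous_lam hn) continuous_const)
  · intro w hw
    refine mem_closure_of_tendsto (tendsto_smul_one w (𝓝[<] 1) nhdsWithin_le_nhds) ?_
    filter_upwards [Ioo_mem_nhdsLT (zero_lt_one' ℝ)] with t ht
    have hw' : lam n w ≤ level n := hw
    change lam n (t * w) < level n
    rw [lam_ofReal_mul hn ht.1.le]
    nlinarith [level_pos hn, ht.1, ht.2, mul_le_mul_of_nonneg_left hw' ht.1.le,
      mul_lt_mul_of_pos_right ht.2 (level_pos hn)]

lemma mem_convexHull_zero_iff (a b w : ℂ) : w ∈ convexHull ℝ {0, a, b} ↔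
    ∃ s t : ℝ, 0 ≤ s ∧ 0 ≤ t ∧ s + t ≤ 1 ∧ w = s * a + t * b := by
  constructor
  · intro h
    rw [convexHull_insert (by simp), convexHull_pair, mem_convexJoin] at h
    obtain ⟨x, hx, y, ⟨c, d, hc, hd, hcd, rfl⟩, ⟨e, f, he, hf, hef, rfl⟩⟩ := h
    rw [Set.mem_singleton_iff] at hx
    refine ⟨f * c, f * d, by positivity, by positivity, ?_, ?_⟩
    · rw [← mul_add, hcd]; linarith
    · rw [hx]; simp only [real_smul]; push_cast; ring
  · rintro ⟨s, t, hs, ht, hst, rfl⟩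
    have h0 : (0 : ℂ) ∈ convexHull ℝ {0, a, b} := subset_convexHull _ _ (by simp)
    have ha : a ∈ convexHull ℝ {0, a, b} := subset_convexHull _ _ (by simp)
    have hb : b ∈ convexHull ℝ {0, a, b} := subset_convexHull _ _ (by simp)
    have := (convex_convexHull ℝ {0, a, b}).sum_mem (t := Finset.univ) (w := ![1 - s - t, s, t])
      (z := ![0, a, b]) (fun i _ => by fin_cases i <;> simp <;> linarith)
      (by simp only [Fin.sum_univ_three, Matrix.cons_val]; ring) (fun i _ => by fin_cases i <;> simpa)
    simpa [Fin.sum_univ_three] using this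

lemma mem_tri_iff {n : ℕ} (hn : 3 ≤ n) (w : ℂ) : w ∈ tri n ↔
    ∃ s t : ℝ, 0 ≤ s ∧ 0 ≤ t ∧ s + t ≤ 1 ∧ w = s * A n + t * conj (P n) := by
  have hs := sin_pos hn
  have ha := realF_one_pos hn
  have hl := sideLength_pos hn
  have h2 := two_mul_sideLength hn
  have hA : A n ∈ sector n := by rw [A_eq]; exact ofReal_mem_sector hn ha.le
  have hell : ∀ s t : ℝ, ell n (s * A n + t * conj (P n)) =
      (s + t) * (realF n 1 * Real.sin (Real.pi / n)) := by
    intro s t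
    have h3 := ell_ray (n := n) (sideLength n)
    rw [h2, ← conj_P] at h3
    have h4 : ell n (A n) = realF n 1 * Real.sin (Real.pi / n) := by
      rw [A_eq, ell]; simp
    rw [add_mul]
    nth_rewrite 1 [← h4]
    rw [← h3]
    simp only [ell, add_re, add_im, re_ofReal_mul, im_ofReal_mul]
    ring
  constructor
  · intro hw
    -- The coordinates `s` and `t` come from the linear functionals vanishing on the sides through
    -- `conj (P n)` and `A n`, normalised at the opposite vertex.
    set s := (w.re * Real.sin (Real.pi / n) + w.im * Real.cos (Real.pi / n)) /
      (realF n 1 * Real.sin (Real.pi / n)) with hsdef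
    set t := -w.im / (sideLength n * Real.sin (Real.pi / n)) with htdef
    have heq : w = s * A n + t * conj (P n) := by
      rw [A_eq, conj_P]
      apply Complex.ext
      · simp only [add_re, re_ofReal_mul, ofReal_re, dir_re, hsdef, htdef]
        field_simp
        ring
      · simp only [add_im, im_ofReal_mul, ofReal_im, dir_im, htdef]
        field_simp
        ring
    refine ⟨s, t, div_nonneg hw.1.2 (by positivity), div_nonneg (neg_nonneg.2 hw.1.1)
      (by positivity), ?_, heq⟩
    have h3 := hw.2
    rw [heq, hell] at h3
    by_contra hlt
    push Not at hlt
    nlinarith [mul_pos ha hs]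
  · rintro ⟨s, t, h0, h1, hst, rfl⟩
    refine ⟨?_, ?_⟩
    · have h3 := convex_sector n (pos_mul_mem_sector hA h0)
        (pos_mul_mem_sector (conj_P_mem_tri hn).1 h1) (by norm_num : (0 : ℝ) ≤ 1 / 2)
        (by norm_num : (0 : ℝ) ≤ 1 / 2) (by norm_num)
      have h4 := pos_mul_mem_sector h3 (by norm_num : (0 : ℝ) ≤ 2)
      convert h4 using 1
      simp only [real_smul]; push_cast; ring
    · rw [hell]
      nlinarith [mul_pos ha hs]

lemma A_conj (n : ℕ) : conj (A n) = A n := by rw [A_eq, conj_ofReal]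

lemma omega_mul_conj_P (n : ℕ) : omega n * conj (P n) = P n := by
  have h : P n = sideLength n * dir (-(Real.pi / n)) := by
    rw [← conj_conj (P n), conj_P, map_mul, conj_ofReal]
    congr 1
    apply Complex.ext <;> simp [dir_re, dir_im]
  rw [h, map_mul, conj_ofReal, mul_left_comm]
  congr 1
  rw [omega_eq_dir]
  have : conj (dir (-(Real.pi / n))) = dir (Real.pi / n) := by
    apply Complex.ext <;> simp [dir_re, dir_im]
  rw [this, dir, dir, dir, ← exp_add]
  congr 1; push_cast; ring

/-- The diagonal `O P_n` cuts the quadrilateral into the mirror image of `tri n` and its rotation by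
`omega n`, since `omega n` carries `conj (P n)` to `P n` and `A n` to `B n`. -/
lemma mem_quad_iff {n : ℕ} (hn : 3 ≤ n) (w : ℂ) :
    w ∈ quad n ↔ conj w ∈ tri n ∨ conj (omega n) * w ∈ tri n := by
  rw [quad, Set.mem_union, mem_convexHull_zero_iff, mem_convexHull_zero_iff, mem_tri_iff hn,
    mem_tri_iff hn]
  have ho := conj_omega_mul n
  refine or_congr ?_ ?_
  · refine exists_congr fun s => exists_congr fun t => and_congr_right fun _ =>
      and_congr_right fun _ => and_congr_right fun _ => ?_
    constructor
    · rintro rfl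
      simp [A_conj]
    · intro h
      have := congrArg conj h
      simpa [A_conj] using this
  · constructor
    · rintro ⟨s, t, h0, h1, h2, rfl⟩
      refine ⟨t, s, h1, h0, by linarith, ?_⟩
      rw [B]
      conv_lhs => rw [← omega_mul_conj_P]
      linear_combination (s * conj (P n) + t * A n) * ho
    · rintro ⟨s, t, h0, h1, h2, h3⟩
      refine ⟨t, s, h1, h0, by linarith, ?_⟩
      rw [B]
      have h4 : (t : ℂ) * P n = t * (omega n * conj (P n)) := by rw [omega_mul_conj_P]
      rw [h4]
      linear_combination omega n * h3 - w * ho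

lemma lam_le_of_mem_quad {n : ℕ} (hn : 3 ≤ n) {w : ℂ} (hw : w ∈ quad n) : lam n w ≤ level n := by
  rcases (mem_quad_iff hn w).1 hw with h | h
  · rw [← lam_conj, lam_of_mem_sector hn h.1]
    exact h.2
  · have h1 : w = omega n ^ 1 * (conj (omega n) * w) := by
      linear_combination -w * conj_omega_mul n
    rw [h1, lam_omega_pow_mul hn, lam_of_mem_sector hn h.1]
    exact h.2

lemma omega_mul_mem_quad {n : ℕ} (hn : 3 ≤ n) {w : ℂ} (hw : w ∈ tri n) :
    omega n * w ∈ quad n := by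
  refine (mem_quad_iff hn _).2 (Or.inr ?_)
  rwa [← mul_assoc, conj_omega_mul, one_mul]

lemma conj_mem_quad {n : ℕ} (hn : 3 ≤ n) {w : ℂ} (hw : w ∈ tri n) :
    conj w ∈ quad n :=
  (mem_quad_iff hn _).2 (Or.inl (by rwa [conj_conj]))

/-- An index shift modulo `n`, which also covers `k = 0`: the copy `omega n ^ k * tri n` belongs to
the quadrilateral of the preceding index. -/
lemma exists_omega_pow_eq_succ {n : ℕ} (hn : 3 ≤ n) (k : ℕ) :
    ∃ j < n, omega n ^ k = omega n ^ j * omega n := by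
  obtain ⟨j, hj, h⟩ := exists_omega_pow_of_pow_eq hn (z := omega n ^ k) (w := omega n)
    (by rw [omega_pow_pow hn, omega_pow_self hn])
  exact ⟨j, hj, h⟩

lemma iUnion_rot_quad {n : ℕ} (hn : 3 ≤ n) :
    (⋃ k ∈ Finset.range n, rot n k (quad n)) = {w | lam n w ≤ level n} := by
  ext w
  simp only [Set.mem_iUnion, Finset.mem_range, exists_prop, rot, Set.mem_image, Set.mem_ofPred_eq]
  constructor
  · rintro ⟨k, _, q, hq, rfl⟩
    rw [lam_omega_pow_mul hn]
    exact lam_le_of_mem_quad hn hq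
  · intro hw
    have ht : fold n w ∈ tri n := ⟨fold_mem_sector hn w, hw⟩
    rcases le_total (w ^ n).im 0 with h | h
    · obtain ⟨k, hk, h1⟩ := exists_eq_omega_pow_mul_fold hn h
      obtain ⟨j, hj, h2⟩ := exists_omega_pow_eq_succ hn k
      refine ⟨j, hj, _, omega_mul_mem_quad hn ht, ?_⟩
      rw [← mul_assoc, ← h2, ← h1]
    · obtain ⟨k, hk, h1⟩ := exists_eq_omega_pow_mul_conj_fold hn h
      exact ⟨k, hk, _, conj_mem_quad hn ht, h1.symm⟩

lemma Omega_eq {n : ℕ} (hn : 3 ≤ n) : Omega n = {w | lam n w < level n} := by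
  rw [Omega, iUnion_rot_quad hn, interior_lam_le hn]

lemma isOpen_Omega (n : ℕ) : IsOpen (Omega n) := isOpen_interior

lemma closure_Omega {n : ℕ} (hn : 3 ≤ n) : closure (Omega n) = {w | lam n w ≤ level n} := by
  rw [Omega_eq hn, closure_lam_lt hn]

lemma frontier_Omega {n : ℕ} (hn : 3 ≤ n) : frontier (Omega n) = {w | lam n w = level n} := by
  rw [frontier, closure_Omega hn, (isOpen_Omega n).interior_eq, Omega_eq hn]
  ext w
  simp only [Set.mem_sdiff, Set.mem_ofPred_eq, not_lt]
  exact ⟨fun h => le_antisymm h.1 h.2, fun h => ⟨h.le, h.ge⟩⟩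

/-! ### The wedge, the interior of the quadrilateral and the slit plane. -/

lemma mem_wedge_iff {n : ℕ} (hn : 3 ≤ n) (w : ℂ) :
    w ∈ wedge n ↔ 0 < w.im ∧ (conj (omega n) * w).im < 0 := by
  have hpi := Real.pi_pos
  have hb := pi_div_pos hn
  have hb3 := pi_div_le hn
  have h2 : 2 * Real.pi / n = 2 * (Real.pi / n) := by ring
  have him : ∀ r θ : ℝ, (conj (omega n) * (r * exp (θ * I))).im =
      r * Real.sin (θ - 2 * (Real.pi / n)) := by
    intro r θ
    rw [mul_left_comm, im_ofReal_mul]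
    congr 1
    rw [omega_eq_dir, Real.sin_sub]
    simp [mul_im, exp_re, exp_im, dir_re, dir_im]
    ring
  constructor
  · rintro ⟨r, θ, hr, h0, h1, rfl⟩
    rw [h2] at h1
    refine ⟨?_, ?_⟩
    · rw [im_ofReal_mul, exp_ofReal_mul_I_im]
      exact mul_pos hr (Real.sin_pos_of_pos_of_lt_pi h0 (by linarith))
    · rw [him]
      have := Real.sin_pos_of_pos_of_lt_pi (x := 2 * (Real.pi / n) - θ) (by linarith) (by linarith)
      rw [← neg_sub, Real.sin_neg]
      nlinarith
  · rintro ⟨h3, h4⟩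
    have hw0 : 0 < ‖w‖ := norm_pos_iff.2 fun h => by simp [h] at h3
    have h5 : 0 ≤ arg w := arg_nonneg_iff.2 h3.le
    have h6 : arg w ≠ 0 := fun h => h3.ne' (arg_eq_zero_iff.1 h).2
    refine ⟨‖w‖, arg w, hw0, lt_of_le_of_ne h5 (Ne.symm h6), ?_, (norm_mul_exp_arg_mul_I w).symm⟩
    rw [h2]
    by_contra hlt
    push Not at hlt
    rw [← norm_mul_exp_arg_mul_I w, him] at h4
    have := Real.sin_nonneg_of_nonneg_of_le_pi (x := arg w - 2 * (Real.pi / n)) (by linarith)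
      (by linarith [arg_le_pi w])
    nlinarith

lemma isOpen_wedge {n : ℕ} (hn : 3 ≤ n) : IsOpen (wedge n) := by
  have : wedge n = {w | 0 < w.im} ∩ {w | (conj (omega n) * w).im < 0} := by
    ext w; exact mem_wedge_iff hn w
  rw [this]
  exact (isOpen_lt continuous_const continuous_im).inter
    (isOpen_lt (continuous_im.comp (continuous_const.mul continuous_id)) continuous_const)

lemma conj_or_rot_mem_sector {n : ℕ} (hn : 3 ≤ n) {w : ℂ} (hw : w ∈ wedge n) :
    conj w ∈ sector n ∨ conj (omega n) * w ∈ sector n := by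
  obtain ⟨r, θ, hr, h0, h1, rfl⟩ := hw
  have h2 : 2 * Real.pi / n = 2 * (Real.pi / n) := by ring
  rw [h2] at h1
  rcases le_total θ (Real.pi / n) with h | h
  · left
    convert mul_dir_mem_sector hn hr.le h0.le h using 1
    rw [map_mul, conj_ofReal, ← exp_conj, dir]
    congr 2; simp
  · right
    convert mul_dir_mem_sector hn hr.le (show 0 ≤ 2 * (Real.pi / n) - θ by linarith)
      (by linarith) using 1
    rw [mul_left_comm, omega_eq_dir, dir, dir, ← exp_conj, ← exp_add]
    congr 2
    simp only [map_mul, map_neg, conj_ofReal, conj_I]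
    push_cast; ring

lemma lt_of_mem_interior {S : Set ℂ} {u : ℂ} {c : ℝ} (hu : u ≠ 0)
    (h : ∀ w ∈ S, (u * w).im ≤ c) {w : ℂ} (hw : w ∈ interior S) : (u * w).im < c := by
  refine lt_of_le_of_ne (h w (interior_subset hw)) fun heq => ?_
  -- Moving along `conj u * I` raises the imaginary part of `u * w` at rate `‖u‖^2`, so equality
  -- cannot hold at an interior point.
  have hcont : ContinuousAt (fun ε : ℝ => w + ε * (conj u * I)) 0 := by fun_prop
  have h1 : ∀ᶠ ε : ℝ in 𝓝 0, w + ε * (conj u * I) ∈ S :=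
    hcont.eventually (by simpa using mem_interior_iff_mem_nhds.1 hw)
  obtain ⟨ε, h2, h3⟩ := ((h1.filter_mono nhdsWithin_le_nhds).and
    (self_mem_nhdsWithin : ∀ᶠ ε : ℝ in 𝓝[>] 0, ε ∈ Set.Ioi (0 : ℝ))).exists
  have h4 := h _ h2
  have h5 : u * (w + ε * (conj u * I)) = u * w + ((ε * ‖u‖ ^ 2 : ℝ) : ℂ) * I := by
    push_cast
    rw [← mul_conj' u]; ring
  rw [h5, add_im, im_ofReal_mul, I_im, mul_one, heq] at h4
  have : 0 < ε * ‖u‖ ^ 2 := mul_pos h3 (by have := norm_pos_iff.2 hu; positivity)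
  linarith

lemma quad_im {n : ℕ} (hn : 3 ≤ n) {w : ℂ} (hw : w ∈ quad n) :
    0 ≤ w.im ∧ (conj (omega n) * w).im ≤ 0 := by
  have hc := half_le_cos hn
  have hs := sin_pos hn
  have h1 : ∀ z : ℂ, z ∈ sector n → (omega n * z).im ≥ 0 := by
    intro z hz
    rw [omega_eq_dir, mul_im, dir_re, dir_im, Real.cos_neg, Real.sin_neg, Real.cos_two_mul,
      Real.sin_two_mul]
    nlinarith [mul_nonneg (by linarith : 0 ≤ Real.cos (Real.pi / n)) hz.2, hz.1]
  rcases (mem_quad_iff hn w).1 hw with h | h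
  · refine ⟨by simpa using h.1.1, ?_⟩
    have := h1 _ h.1
    have h2 : conj (omega n) * w = conj (omega n * conj w) := by simp
    rw [h2, conj_im]; linarith
  · refine ⟨?_, h.1.1⟩
    have := h1 _ h.1
    rw [← mul_assoc, mul_comm (omega n), conj_omega_mul, one_mul] at this
    exact this

lemma interior_quad {n : ℕ} (hn : 3 ≤ n) :
    interior (quad n) = {w | w ∈ wedge n ∧ lam n w < level n} := by
  apply Set.Subset.antisymm
  · intro w hw
    refine ⟨(mem_wedge_iff hn w).2 ⟨?_, ?_⟩, ?_⟩
    · have := lt_of_mem_interior (u := -1) (c := 0) (by simp)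
        (fun z hz => by have := (quad_im hn hz).1; simpa using this) hw
      simpa using this
    · exact lt_of_mem_interior (by simpa using omega_ne_zero n)
        (fun z hz => (quad_im hn hz).2) hw
    · have : w ∈ interior {w | lam n w ≤ level n} :=
        interior_mono (fun z hz => lam_le_of_mem_quad hn hz) hw
      rwa [interior_lam_le hn] at this
  · refine interior_maximal ?_ ((isOpen_wedge hn).inter
      (isOpen_lt (continuous_lam hn) continuous_const))
    rintro w ⟨hw, hl⟩
    rw [mem_quad_iff hn]
    rcases conj_or_rot_mem_sector hn hw with h | h
    · left
      refine ⟨h, ?_⟩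
      rw [← lam_of_mem_sector hn h, lam_conj]; exact hl.le
    · right
      refine ⟨h, ?_⟩
      have h1 : w = omega n ^ 1 * (conj (omega n) * w) := by
        linear_combination -w * conj_omega_mul n
      rw [h1, lam_omega_pow_mul hn, lam_of_mem_sector hn h] at hl
      exact hl.le

/-- The slits are exactly the points whose n-th power lies in `[1, ∞)`. -/
lemma Sigma_eq {n : ℕ} (hn : 3 ≤ n) : Sigma n = slitDomain n := by
  ext z
  rw [Sigma, Set.mem_compl_iff, ← not_iff_not, not_not]
  simp only [slits, rot, Set.mem_iUnion, Finset.mem_range, exists_prop, Set.mem_image, Set.mem_Ici]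
  constructor
  · rintro ⟨k, _, _, ⟨x, hx, rfl⟩, rfl⟩ h
    have h1 : 1 ≤ x ^ n := one_le_pow₀ hx
    have h2 : (1 : ℂ) - (omega n ^ k * x) ^ n = ((1 - x ^ n : ℝ) : ℂ) := by
      rw [omega_pow_mul_pow hn]; push_cast; ring
    rw [slitDomain, Set.mem_ofPred_eq, h2, ofReal_mem_slitPlane] at h
    linarith
  · intro h
    have h1 : ¬(0 < (1 - z ^ n).re ∨ (1 - z ^ n).im ≠ 0) := h
    push Not at h1
    have h2 : z ^ n = (((z ^ n).re : ℝ) : ℂ) := by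
      apply Complex.ext
      · simp
      · have := h1.2
        rw [sub_im, one_im] at this
        rw [ofReal_im]; linarith
    have h3 : 1 ≤ (z ^ n).re := by
      have := h1.1
      rw [sub_re, one_re] at this; linarith
    set x := (z ^ n).re ^ ((n : ℝ)⁻¹) with hx
    have hx1 : 1 ≤ x := Real.one_le_rpow h3 (by positivity)
    have hxn : x ^ n = (z ^ n).re := Real.rpow_inv_natCast_pow (by linarith) (by omega)
    obtain ⟨k, hk, h4⟩ := exists_omega_pow_of_pow_eq hn (z := z) (w := x)
      (by rw [h2, ← hxn, ofReal_pow])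
    exact ⟨k, hk, _, ⟨x, hx1, rfl⟩, h4.symm⟩

/-! ### The inverse on the closed region, glued from the sector. -/

/-- The quotient `F n z / z`, with value `1` at `0`. -/
def phi (n : ℕ) : ℂ → ℂ := dslope (F n) 0

lemma mul_phi (n : ℕ) (z : ℂ) : z * phi n z = F n z := by
  have := sub_smul_dslope (F n) 0 z
  simpa [F_zero, phi] using this

lemma phi_zero {n : ℕ} (hn : 3 ≤ n) : phi n 0 = 1 := by
  rw [phi, dslope_same, (hasDerivAt_F (zero_mem_slitDomain hn)).deriv]
  simp [K, show n ≠ 0 by omega]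

lemma F_ne_zero {n : ℕ} (hn : 3 ≤ n) {z : ℂ} (hz : z ∈ sector n) (h0 : z ≠ 0) : F n z ≠ 0 := by
  intro h
  refine h0 (injOn_F_sector hn hz (by simpa using ofReal_mem_sector hn le_rfl) ?_)
  rw [h, F_zero]

lemma phi_ne_zero {n : ℕ} (hn : 3 ≤ n) {z : ℂ} (hz : z ∈ sector n) : phi n z ≠ 0 := by
  rcases eq_or_ne z 0 with rfl | h0
  · rw [phi_zero hn]; exact one_ne_zero
  · intro h
    have := mul_phi n z
    rw [h, mul_zero] at this
    exact F_ne_zero hn hz h0 this.symm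

lemma continuousOn_phi {n : ℕ} (hn : 3 ≤ n) : ContinuousOn (phi n) (sector n) := by
  intro z hz
  rcases eq_or_ne z 0 with rfl | h0
  · exact (continuousAt_dslope_same.2
      (hasDerivAt_F (zero_mem_slitDomain hn)).differentiableAt).continuousWithinAt
  · exact (continuousWithinAt_dslope_of_ne h0).2 (continuousOn_F_sector hn z hz)

lemma phi_conj_of_F {n : ℕ} (hn : 3 ≤ n) {r c : ℝ} {e : ℂ} (he : e ≠ 0)
    (h : F n (r * e) = c * e) : conj (phi n (r * e)) = phi n (r * e) := by
  rcases eq_or_ne r 0 with rfl | h0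
  · simp [phi_zero hn]
  · have h1 := mul_phi n (r * e)
    rw [h] at h1
    have h2 : phi n (r * e) = ((c / r : ℝ) : ℂ) := by
      have h0' : (r : ℂ) ≠ 0 := ofReal_ne_zero.2 h0
      push_cast
      rw [eq_div_iff h0']
      exact mul_left_cancel₀ he (by linear_combination h1)
    rw [h2, conj_ofReal]

/-- The interior maps strictly inside. On `[0,1)` the value would have to be that of `F n 1`,
against injectivity, and on the lower ray it would have to be `conj (P n)`, which is not attained.
-/
lemma eq_one_le_of_ell_eq {n : ℕ} (hn : 3 ≤ n) {z : ℂ} (hz : z ∈ sector n)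
    (h : ell n (F n z) = level n) : ∃ x : ℝ, 1 ≤ x ∧ z = x := by
  have hs := sin_pos hn
  have hint : z ∉ sectorInt n := fun h' => by
    have : F n z ∈ triInt n := F_image_sectorInt hn ▸ ⟨z, h', rfl⟩
    exact (ne_of_lt this.2) h
  rcases sector_boundary_cases hn hz hint with h1 | h1
  · refine ⟨‖z‖, ?_, h1⟩
    by_contra hlt
    push Not at hlt
    have hm : ‖z‖ ∈ Set.Icc (0 : ℝ) 1 := ⟨norm_nonneg z, hlt.le⟩
    rw [h1, F_ofReal_of_mem_Icc hm, ell, level, ofReal_re, ofReal_im, zero_mul, sub_zero] at h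
    have h2 := mul_right_cancel₀ hs.ne' h
    have h3 : F n z = F n 1 := by rw [h1, F_ofReal_of_mem_Icc hm, F_one, h2]
    have := injOn_F_sector hn hz (by simpa using ofReal_mem_sector hn zero_le_one) h3
    rw [this, norm_one] at hlt
    exact lt_irrefl _ hlt
  · exfalso
    rw [h1, F_ray hn (norm_nonneg z), ell_ray, level, ← two_mul_sideLength hn] at h
    have hc := half_le_cos hn
    have h2 := mul_right_cancel₀ hs.ne' h
    have h3 : rayLength n ‖z‖ = sideLength n :=
      mul_right_cancel₀ (by linarith : Real.cos (Real.pi / n) ≠ 0) (by linarith)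
    refine conj_P_notMem_image hn ⟨z, hz, ?_⟩
    rw [h1, F_ray hn (norm_nonneg z), h3, conj_P]

/-- The hypothesis puts `F n z` on a side of the triangle through `0`. Then `z` lies on `[0,1]` or
on the lower ray, where `F n z / z` is real. A point `x > 1` is excluded because the outer side
meets those sides only at `A n` and at the unattained `conj (P n)`. -/
lemma phi_conj {n : ℕ} (hn : 3 ≤ n) {z : ℂ} (hz : z ∈ sector n) (h : (F n z ^ n).im = 0) :
    conj (phi n z) = phi n z := by
  have hs := sin_pos hn
  have hc := half_le_cos hn
  have hFz : F n z ∈ sector n := by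
    have : F n z ∈ tri n \ {conj (P n)} := F_image_sector hn ▸ ⟨z, hz, rfl⟩
    exact this.1.1
  have hint : z ∉ sectorInt n := fun h' => by
    have : F n z ∈ triInt n := F_image_sectorInt hn ▸ ⟨z, h', rfl⟩
    exact (pow_im_neg hn this.1).ne h
  rcases sector_boundary_cases hn hz hint with h1 | h1
  · have h1' : z = (‖z‖ : ℂ) * 1 := by rw [mul_one]; exact h1
    rcases le_or_gt ‖z‖ 1 with h2 | h2
    · have hm : ‖z‖ ∈ Set.Icc (0 : ℝ) 1 := ⟨norm_nonneg z, h2⟩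
      rw [h1']
      refine phi_conj_of_F hn one_ne_zero (c := realF n ‖z‖) ?_
      rw [mul_one, mul_one, F_ofReal_of_mem_Icc hm]
    · exfalso
      have hF : F n z = realF n 1 - slitLength n ‖z‖ * dir (-(Real.pi / n)) := by
        conv_lhs => rw [h1]
        exact F_of_one_le hn h2.le
      have hell : ell n (F n z) = level n := by
        conv_lhs => rw [h1]
        exact ell_F_of_one_le hn h2.le
      rcases pow_eq_real_cases hn hFz h with h3 | h3
      · have him := congrArg im hF
        rw [h3, ofReal_im] at him
        simp only [sub_im, im_ofReal_mul, dir_im, ofReal_im, Real.sin_neg] at him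
        have h4 : slitLength n ‖z‖ = 0 := by
          have : slitLength n ‖z‖ * Real.sin (Real.pi / n) = 0 := by linarith
          exact (mul_eq_zero.1 this).resolve_right hs.ne'
        rw [h4, ofReal_zero, zero_mul, sub_zero, ← F_one] at hF
        have := injOn_F_sector hn hz (by simpa using ofReal_mem_sector hn zero_le_one) hF
        rw [this, norm_one] at h2
        exact lt_irrefl _ h2
      · rw [h3, ell_ray, level, ← two_mul_sideLength hn] at hell
        have h4 := mul_right_cancel₀ hs.ne' hell
        have h5 : ‖F n z‖ = sideLength n :=
          mul_right_cancel₀ (by linarith : Real.cos (Real.pi / n) ≠ 0) (by linarith)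
        refine conj_P_notMem_image hn ⟨z, hz, ?_⟩
        rw [h3, h5, conj_P]
  · rw [h1]
    exact phi_conj_of_F hn (dir_ne_zero _) (F_ray hn (norm_nonneg z))

/-- The inverse of `F n` on the closed sector. -/
def secInv (n : ℕ) : ℂ → ℂ := Function.invFunOn (F n) (sector n)

lemma secInv_F {n : ℕ} (hn : 3 ≤ n) {z : ℂ} (hz : z ∈ sector n) : secInv n (F n z) = z :=
  (injOn_F_sector hn).leftInvOn_invFunOn hz

lemma lowerConst_mul_le {n : ℕ} (hn : 3 ≤ n) {R : ℝ} {z w : ℂ} (hz : z ∈ sector n)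
    (hw : w ∈ sector n) (hzR : ‖z‖ < R) (hwR : ‖w‖ < R) :
    lowerConst n R * ‖z - w‖ ≤ ‖F n z - F n w‖ := by
  rcases eq_or_ne z w with rfl | hne
  · simp
  have h1 := F_mono_sector hn hz hw hzR hwR
  have h2 : (dir (-(alpha n * Real.pi / 2)) * (F n z - F n w) * conj (z - w)).re ≤
      ‖F n z - F n w‖ * ‖z - w‖ := by
    refine (re_le_norm _).trans ?_
    rw [norm_mul, norm_mul, norm_dir, one_mul, RCLike.norm_conj]
  have h3 : 0 < ‖z - w‖ := norm_pos_iff.2 (sub_ne_zero.2 hne)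
  refine le_of_mul_le_mul_right ?_ h3
  rw [mul_assoc, ← sq]
  exact h1.trans h2

/-- The sector is not compact, so the far estimate is needed to confine the preimage to distance `1`
from `w`; within that range the inverse satisfies a Lipschitz bound. -/
lemma continuousOn_secInv {n : ℕ} (hn : 3 ≤ n) : ContinuousOn (secInv n) (F n '' sector n) := by
  rintro _ ⟨w, hw, rfl⟩
  rw [Metric.continuousWithinAt_iff]
  intro ε hε
  obtain ⟨c, hc, hfar⟩ := exists_norm_F_sub_ge hn hw
  have hl := lowerConst_pos hn (R := ‖w‖ + 1) (by positivity)
  refine ⟨min c (lowerConst n (‖w‖ + 1) * ε), lt_min hc (mul_pos hl hε), ?_⟩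
  rintro _ ⟨z, hz, rfl⟩ hd
  rw [secInv_F hn hz, secInv_F hn hw]
  rw [dist_eq_norm] at hd ⊢
  have h1 : ‖z - w‖ < 1 := by
    by_contra h
    push Not at h
    exact absurd (hfar z hz h) (not_le.2 (hd.trans_le (min_le_left _ _)))
  have h2 : ‖z‖ < ‖w‖ + 1 := by
    have : ‖z‖ ≤ ‖w‖ + ‖z - w‖ := by simpa using norm_add_le w (z - w)
    linarith
  have h3 := lowerConst_mul_le hn hz hw h2 (by linarith)
  exact lt_of_mul_lt_mul_left (h3.trans_lt (hd.trans_le (min_le_right _ _))) hl.le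

/-- The point of the closed sector corresponding to `w` under `F n` and the dihedral group. -/
def base (n : ℕ) (w : ℂ) : ℂ := secInv n (fold n w)

/-- The closed star-shaped region without the points at which `sinN n` is infinite. -/
def dom (n : ℕ) : Set ℂ := {w | lam n w ≤ level n} \ vertsP n

lemma P_pow {n : ℕ} (hn : 3 ≤ n) : conj (P n) ^ n = P n ^ n := by
  have := omega_pow_mul_pow hn 1 (conj (P n))
  rw [pow_one, omega_mul_conj_P] at this
  exact this.symm

lemma fold_conj_P {n : ℕ} (hn : 3 ≤ n) : fold n (conj (P n)) = conj (P n) :=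
  fold_of_mem_sector hn (conj_P_mem_tri hn).1

/-- Folding determines `w^n` up to conjugation, and `P n ^ n` is its own conjugate because `P n` and
`conj (P n)` differ by the factor `omega n`. -/
lemma mem_vertsP_iff {n : ℕ} (hn : 3 ≤ n) (w : ℂ) : w ∈ vertsP n ↔ fold n w = conj (P n) := by
  constructor
  · rintro ⟨k, _, rfl⟩
    rw [fold_omega_pow_mul hn, ← fold_conj, fold_conj_P hn]
  · intro h
    have h1 : w ^ n = P n ^ n := by
      have h2 := fold_pow hn w
      rw [h, P_pow hn] at h2
      rcases le_total 0 (w ^ n).im with h3 | h3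
      · rw [upper_of_nonneg h3, ← P_pow hn, ← map_pow] at h2
        exact ((starRingEnd ℂ).injective h2).symm
      · rw [upper_of_nonpos h3, conj_conj] at h2
        exact h2.symm
    exact exists_omega_pow_of_pow_eq hn h1

lemma mem_dom_iff {n : ℕ} (hn : 3 ≤ n) (w : ℂ) : w ∈ dom n ↔ fold n w ∈ F n '' sector n := by
  rw [F_image_sector hn, dom, Set.mem_sdiff, Set.mem_sdiff, mem_vertsP_iff hn,
    Set.mem_singleton_iff]
  exact and_congr_left fun _ => ⟨fun h => ⟨fold_mem_sector hn w, h⟩, fun h => h.2⟩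

lemma base_spec {n : ℕ} (hn : 3 ≤ n) {w : ℂ} (hw : w ∈ dom n) :
    base n w ∈ sector n ∧ F n (base n w) = fold n w := by
  obtain ⟨z, hz, h⟩ := (mem_dom_iff hn w).1 hw
  rw [base, ← h, secInv_F hn hz]
  exact ⟨hz, rfl⟩

lemma continuousOn_phi_base {n : ℕ} (hn : 3 ≤ n) :
    ContinuousOn (fun w => phi n (base n w)) (dom n) := by
  have h1 : ContinuousOn (base n) (dom n) :=
    (continuousOn_secInv hn).comp (continuous_fold hn).continuousOn
      fun w hw => (mem_dom_iff hn w).1 hw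
  exact (continuousOn_phi hn).comp h1 fun w hw => (base_spec hn hw).1

/-- The continuous extension of `sinN n` to `dom n`. -/
def sinExt (n : ℕ) (w : ℂ) : ℂ :=
  if (w ^ n).im ≤ 0 then w / phi n (base n w) else w / conj (phi n (base n w))

lemma phi_base_conj {n : ℕ} (hn : 3 ≤ n) {w : ℂ} (hw : w ∈ dom n) (h : (w ^ n).im = 0) :
    conj (phi n (base n w)) = phi n (base n w) := by
  obtain ⟨h1, h2⟩ := base_spec hn hw
  refine phi_conj hn h1 ?_
  rw [h2, fold_pow hn]
  simp [upper, h]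

lemma sinExt_of_nonneg {n : ℕ} (hn : 3 ≤ n) {w : ℂ} (hw : w ∈ dom n) (h : 0 ≤ (w ^ n).im) :
    sinExt n w = w / conj (phi n (base n w)) := by
  rw [sinExt]
  split_ifs with h1
  · rw [phi_base_conj hn hw (le_antisymm h1 h)]
  · rfl

/-- Dividing `w` by `phi` avoids choosing a rotation index, which would jump. The two formulas meet
only where `w^n` is real, and there `phi` is real. -/
lemma continuousOn_sinExt {n : ℕ} (hn : 3 ≤ n) : ContinuousOn (sinExt n) (dom n) := by
  have h1 := continuousOn_phi_base hn
  have h0 : ∀ w ∈ dom n, phi n (base n w) ≠ 0 := fun w hw => phi_ne_zero hn (base_spec hn hw).1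
  have hf : ContinuousOn (fun w => w / phi n (base n w)) (dom n) := continuousOn_id.div h1 h0
  have hg : ContinuousOn (fun w => w / conj (phi n (base n w))) (dom n) :=
    continuousOn_id.div (continuous_conj.comp_continuousOn h1) fun w hw => by
      simpa using h0 w hw
  unfold sinExt
  refine ContinuousOn.if ?_ (hf.mono Set.inter_subset_left) (hg.mono Set.inter_subset_left)
  rintro w ⟨hw, hfr⟩
  have : (w ^ n).im = 0 := frontier_le_subset_eq (by fun_prop) (by fun_prop) hfr
  rw [phi_base_conj hn hw this]

lemma fold_div_phi {n : ℕ} (hn : 3 ≤ n) {w : ℂ} (hw : w ∈ dom n) :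
    fold n w / phi n (base n w) = base n w := by
  obtain ⟨h1, h2⟩ := base_spec hn hw
  rw [← h2, ← mul_phi, mul_div_cancel_right₀ _ (phi_ne_zero hn h1)]

/-- The symmetry carrying `fold n w` to `w` also carries `base n w` to `sinExt n w`, so claims about
`sinExt` reduce to the sector. -/
lemma exists_sinExt_eq {n : ℕ} (hn : 3 ≤ n) {w : ℂ} (hw : w ∈ dom n) :
    ∃ k < n, (w = omega n ^ k * fold n w ∧ sinExt n w = omega n ^ k * base n w) ∨
      (w = omega n ^ k * conj (fold n w) ∧ sinExt n w = omega n ^ k * conj (base n w)) := by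
  have h0 := fold_div_phi hn hw
  rcases le_total (w ^ n).im 0 with h | h
  · obtain ⟨k, hk, h1⟩ := exists_eq_omega_pow_mul_fold hn h
    refine ⟨k, hk, Or.inl ⟨h1, ?_⟩⟩
    rw [sinExt, if_pos h]
    nth_rewrite 1 [h1]
    rw [mul_div_assoc, h0]
  · obtain ⟨k, hk, h1⟩ := exists_eq_omega_pow_mul_conj_fold hn h
    refine ⟨k, hk, Or.inr ⟨h1, ?_⟩⟩
    rw [sinExt_of_nonneg hn hw h]
    nth_rewrite 1 [h1]
    rw [mul_div_assoc, ← map_div₀, h0]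

lemma base_omega_pow_mul {n : ℕ} (hn : 3 ≤ n) (k : ℕ) (w : ℂ) :
    base n (omega n ^ k * w) = base n w := by rw [base, base, fold_omega_pow_mul hn]

lemma base_conj (n : ℕ) (w : ℂ) : base n (conj w) = base n w := by rw [base, base, fold_conj]

lemma sinExt_omega_pow_mul {n : ℕ} (hn : 3 ≤ n) (k : ℕ) (w : ℂ) :
    sinExt n (omega n ^ k * w) = omega n ^ k * sinExt n w := by
  rw [sinExt, sinExt, base_omega_pow_mul hn, omega_pow_mul_pow hn]
  split_ifs <;> rw [mul_div_assoc]

lemma omega_pow_mul_mem_dom_iff {n : ℕ} (hn : 3 ≤ n) (k : ℕ) (w : ℂ) :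
    omega n ^ k * w ∈ dom n ↔ w ∈ dom n := by
  rw [mem_dom_iff hn, mem_dom_iff hn, fold_omega_pow_mul hn]

lemma conj_mem_dom_iff {n : ℕ} (hn : 3 ≤ n) (w : ℂ) : conj w ∈ dom n ↔ w ∈ dom n := by
  rw [mem_dom_iff hn, mem_dom_iff hn, fold_conj]

lemma sinExt_conj {n : ℕ} (hn : 3 ≤ n) {w : ℂ} (hw : w ∈ dom n) :
    sinExt n (conj w) = conj (sinExt n w) := by
  have him : (conj w ^ n).im = -(w ^ n).im := by rw [← map_pow, conj_im]
  rcases le_total (w ^ n).im 0 with h | h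
  · rw [sinExt_of_nonneg hn ((conj_mem_dom_iff hn w).2 hw) (by linarith), base_conj, sinExt,
      if_pos h, map_div₀]
  · rw [sinExt_of_nonneg hn hw h, sinExt, if_pos (by linarith), base_conj, map_div₀, conj_conj]

lemma F_mem_dom {n : ℕ} (hn : 3 ≤ n) {z : ℂ} (hz : z ∈ sector n) :
    F n z ∈ sector n ∧ F n z ∈ dom n := by
  have h : F n z ∈ tri n \ {conj (P n)} := F_image_sector hn ▸ ⟨z, hz, rfl⟩
  refine ⟨h.1.1, (mem_dom_iff hn _).2 ?_⟩
  rw [fold_of_mem_sector hn h.1.1]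
  exact ⟨z, hz, rfl⟩

lemma base_F {n : ℕ} (hn : 3 ≤ n) {z : ℂ} (hz : z ∈ sector n) : base n (F n z) = z := by
  rw [base, fold_of_mem_sector hn (F_mem_dom hn hz).1, secInv_F hn hz]

lemma sinExt_F_sector {n : ℕ} (hn : 3 ≤ n) {z : ℂ} (hz : z ∈ sector n) : sinExt n (F n z) = z := by
  rw [sinExt, if_pos (pow_im_nonpos hn (F_mem_dom hn hz).1), base_F hn hz, ← mul_phi,
    mul_div_cancel_right₀ _ (phi_ne_zero hn hz)]

/-! ### `F n` and `sinExt n` are mutually inverse between the slit plane and `Omega n`. -/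

lemma F_omega_pow_mul {n : ℕ} (hn : 3 ≤ n) (k : ℕ) (z : ℂ) :
    F n (omega n ^ k * z) = omega n ^ k * F n z := by
  rw [F, F, mul_assoc]
  congr 2
  refine intervalIntegral.integral_congr fun t _ => ?_
  simp only [K]
  rw [mul_left_comm, omega_pow_mul_pow hn]

lemma K_conj {n : ℕ} {z : ℂ} (hz : z ∈ slitDomain n) : K n (conj z) = conj (K n z) := by
  have h1 := cpow_conj (1 - z ^ n) ((alpha n : ℝ) : ℂ) (slitPlane_arg_ne_pi hz)
  rw [conj_ofReal] at h1
  rw [K_eq_alpha, K_eq_alpha, map_div₀, map_one, h1, conj_conj]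
  simp

lemma F_conj {n : ℕ} {z : ℂ} (hz : z ∈ slitDomain n) : F n (conj z) = conj (F n z) := by
  rw [F, F, map_mul, intervalIntegral.integral_of_le zero_le_one,
    intervalIntegral.integral_of_le zero_le_one, ← integral_conj]
  congr 1
  refine setIntegral_congr_fun measurableSet_Ioc fun t ht => ?_
  rw [← K_conj (mul_mem_slitDomain hz ht.1.le ht.2), map_mul, conj_ofReal]

lemma omega_pow_mul_mem_slitDomain_iff {n : ℕ} (hn : 3 ≤ n) (k : ℕ) (z : ℂ) :
    omega n ^ k * z ∈ slitDomain n ↔ z ∈ slitDomain n := by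
  simp only [slitDomain, Set.mem_ofPred_eq, omega_pow_mul_pow hn]

lemma conj_mem_slitDomain_iff {n : ℕ} (z : ℂ) :
    conj z ∈ slitDomain n ↔ z ∈ slitDomain n := by
  simp only [slitDomain, Set.mem_ofPred_eq, mem_slitPlane_iff, ← map_pow, sub_re, sub_im, conj_re,
    conj_im, one_re, one_im, zero_sub, neg_ne_zero]

lemma exists_rep {n : ℕ} (hn : 3 ≤ n) (z : ℂ) : ∃ k < n, ∃ s ∈ sector n,
    z = omega n ^ k * s ∨ z = omega n ^ k * conj s := by
  rcases le_total (z ^ n).im 0 with h | h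
  · obtain ⟨k, hk, h1⟩ := exists_eq_omega_pow_mul_fold hn h
    exact ⟨k, hk, _, fold_mem_sector hn z, Or.inl h1⟩
  · obtain ⟨k, hk, h1⟩ := exists_eq_omega_pow_mul_conj_fold hn h
    exact ⟨k, hk, _, fold_mem_sector hn z, Or.inr h1⟩

lemma lam_F_lt {n : ℕ} (hn : 3 ≤ n) {s : ℂ} (hs : s ∈ sector n) (hsd : s ∈ slitDomain n) :
    lam n (F n s) < level n := by
  obtain ⟨h1, h2⟩ := F_mem_dom hn hs
  refine lt_of_le_of_ne h2.1 fun h => ?_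
  rw [lam_of_mem_sector hn h1] at h
  obtain ⟨x, hx, rfl⟩ := eq_one_le_of_ell_eq hn hs h
  have h3 : 1 ≤ x ^ n := one_le_pow₀ hx
  have h4 : (1 : ℂ) - (x : ℂ) ^ n = ((1 - x ^ n : ℝ) : ℂ) := by push_cast; ring
  rw [slitDomain, Set.mem_ofPred_eq, h4, ofReal_mem_slitPlane] at hsd
  linarith

lemma F_mem_Omega {n : ℕ} (hn : 3 ≤ n) {z : ℂ} (hz : z ∈ slitDomain n) :
    F n z ∈ Omega n ∧ sinExt n (F n z) = z := by
  rw [Omega_eq hn, Set.mem_ofPred_eq]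
  obtain ⟨k, _, s, hs, rfl | rfl⟩ := exists_rep hn z
  · rw [omega_pow_mul_mem_slitDomain_iff hn] at hz
    rw [F_omega_pow_mul hn, lam_omega_pow_mul hn, sinExt_omega_pow_mul hn, sinExt_F_sector hn hs]
    exact ⟨lam_F_lt hn hs hz, rfl⟩
  · rw [omega_pow_mul_mem_slitDomain_iff hn, conj_mem_slitDomain_iff] at hz
    rw [F_omega_pow_mul hn, lam_omega_pow_mul hn, sinExt_omega_pow_mul hn, F_conj hz, lam_conj,
      sinExt_conj hn (F_mem_dom hn hs).2, sinExt_F_sector hn hs]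
    exact ⟨lam_F_lt hn hs hz, rfl⟩

lemma eq_one_le_of_notMem_slitDomain {n : ℕ} (hn : 3 ≤ n) {s : ℂ} (hs : s ∈ sector n)
    (h : s ∉ slitDomain n) : ∃ x : ℝ, 1 ≤ x ∧ s = x := by
  rw [← Sigma_eq hn, Sigma, Set.mem_compl_iff, not_not] at h
  simp only [slits, rot, Set.mem_iUnion, Finset.mem_range, exists_prop, Set.mem_image,
    Set.mem_Ici] at h
  obtain ⟨k, _, _, ⟨x, hx, rfl⟩, h1⟩ := h
  have h2 : s ^ n = (x : ℂ) ^ n := by rw [← h1, omega_pow_mul_pow hn]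
  exact ⟨x, hx, injOn_pow_sector hn hs (ofReal_mem_sector hn (by linarith)) h2⟩

lemma mem_slitDomain_of_lam_lt {n : ℕ} (hn : 3 ≤ n) {s : ℂ} (hs : s ∈ sector n)
    (h : lam n (F n s) < level n) : s ∈ slitDomain n := by
  by_contra hsd
  obtain ⟨x, hx, rfl⟩ := eq_one_le_of_notMem_slitDomain hn hs hsd
  rw [lam_of_mem_sector hn (F_mem_dom hn hs).1, ell_F_of_one_le hn hx] at h
  exact lt_irrefl _ h

lemma conj_P_lam {n : ℕ} (hn : 3 ≤ n) : lam n (conj (P n)) = level n := by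
  rw [lam_of_mem_sector hn (conj_P_mem_tri hn).1, conj_P, ell_ray, two_mul_sideLength hn, level]

lemma lam_of_mem_vertsP {n : ℕ} (hn : 3 ≤ n) {w : ℂ} (hw : w ∈ vertsP n) : lam n w = level n := by
  rw [mem_vertsP_iff hn] at hw
  rw [lam, hw, ← lam_of_mem_sector hn (conj_P_mem_tri hn).1, conj_P_lam hn]

lemma Omega_subset_dom {n : ℕ} (hn : 3 ≤ n) : Omega n ⊆ dom n := by
  intro w hw
  rw [Omega_eq hn] at hw
  have hw' : lam n w < level n := hw
  exact ⟨hw'.le, fun h => hw'.ne (lam_of_mem_vertsP hn h)⟩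

lemma sinExt_spec {n : ℕ} (hn : 3 ≤ n) {w : ℂ} (hw : w ∈ Omega n) :
    sinExt n w ∈ slitDomain n ∧ F n (sinExt n w) = w := by
  have hd := Omega_subset_dom hn hw
  obtain ⟨h1, h2⟩ := base_spec hn hd
  rw [Omega_eq hn] at hw
  have h3 : lam n (F n (base n w)) < level n := by
    rw [h2, lam_of_mem_sector hn (fold_mem_sector hn w)]
    exact hw
  have h4 := mem_slitDomain_of_lam_lt hn h1 h3
  obtain ⟨k, _, ⟨h5, h6⟩ | ⟨h5, h6⟩⟩ := exists_sinExt_eq hn hd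
  · rw [h6, omega_pow_mul_mem_slitDomain_iff hn, F_omega_pow_mul hn, h2, ← h5]
    exact ⟨h4, rfl⟩
  · rw [h6, omega_pow_mul_mem_slitDomain_iff hn, conj_mem_slitDomain_iff, F_omega_pow_mul hn,
      F_conj h4, h2, ← h5]
    exact ⟨h4, rfl⟩

/-! ### The bijection from the wedge onto the interior of the quadrilateral. -/

lemma mem_wedge_iff_exists {n : ℕ} (hn : 3 ≤ n) (z : ℂ) :
    z ∈ wedge n ↔ ∃ s ∈ sector n, s.im ≠ 0 ∧ (z = conj s ∨ z = omega n * s) := by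
  constructor
  · intro hz
    obtain ⟨h1, h2⟩ := (mem_wedge_iff hn z).1 hz
    rcases conj_or_rot_mem_sector hn hz with h | h
    · exact ⟨_, h, by simpa using h1.ne', Or.inl (conj_conj z).symm⟩
    · exact ⟨_, h, h2.ne, Or.inr (by linear_combination -z * conj_omega_mul n)⟩
  · rintro ⟨s, hs, him, h⟩
    have h0 : s.im < 0 := lt_of_le_of_ne hs.1 him
    have hc := half_le_cos hn
    have h1 : 0 < (omega n * s).im := by
      rw [omega_eq_dir, mul_im, dir_re, dir_im, Real.cos_neg, Real.sin_neg, Real.cos_two_mul,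
        Real.sin_two_mul]
      nlinarith [mul_nonneg (by linarith : 0 ≤ Real.cos (Real.pi / n)) hs.2]
    rw [mem_wedge_iff hn]
    rcases h with rfl | rfl
    · refine ⟨by simpa using h0, ?_⟩
      rw [← map_mul, conj_im]; linarith
    · refine ⟨h1, ?_⟩
      rwa [← mul_assoc, conj_omega_mul, one_mul]

lemma mem_slitDomain_of_im_ne_zero {n : ℕ} (hn : 3 ≤ n) {s : ℂ} (hs : s ∈ sector n)
    (h : s.im ≠ 0) : s ∈ slitDomain n := by
  by_contra hsd
  obtain ⟨x, _, rfl⟩ := eq_one_le_of_notMem_slitDomain hn hs hsd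
  exact h (ofReal_im x)

lemma injOn_F_slitDomain {n : ℕ} (hn : 3 ≤ n) : Set.InjOn (F n) (slitDomain n) :=
  fun z hz w hw h => by rw [← (F_mem_Omega hn hz).2, h, (F_mem_Omega hn hw).2]

/-- Being real means being fixed by conjugation, with which the injective map `F n` commutes. -/
lemma F_im_ne_zero_iff {n : ℕ} (hn : 3 ≤ n) {s : ℂ} (hsd : s ∈ slitDomain n) :
    (F n s).im ≠ 0 ↔ s.im ≠ 0 := by
  rw [not_iff_not, ← conj_eq_iff_im, ← conj_eq_iff_im, ← F_conj hsd]
  exact ⟨fun h => injOn_F_slitDomain hn ((conj_mem_slitDomain_iff s).2 hsd) hsd h,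
    fun h => by rw [h]⟩

lemma wedge_subset_slitDomain {n : ℕ} (hn : 3 ≤ n) : wedge n ⊆ slitDomain n := by
  intro z hz
  obtain ⟨s, hs, him, rfl | rfl⟩ := (mem_wedge_iff_exists hn z).1 hz
  · exact (conj_mem_slitDomain_iff s).2 (mem_slitDomain_of_im_ne_zero hn hs him)
  · have := (omega_pow_mul_mem_slitDomain_iff hn 1 s).2 (mem_slitDomain_of_im_ne_zero hn hs him)
    rwa [pow_one] at this

lemma interior_quad_eq {n : ℕ} (hn : 3 ≤ n) : interior (quad n) = wedge n ∩ Omega n := by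
  rw [interior_quad hn, Omega_eq hn]; rfl

lemma F_mem_wedge {n : ℕ} (hn : 3 ≤ n) {z : ℂ} (hz : z ∈ wedge n) : F n z ∈ wedge n := by
  obtain ⟨s, hs, him, h⟩ := (mem_wedge_iff_exists hn z).1 hz
  have hsd := mem_slitDomain_of_im_ne_zero hn hs him
  refine (mem_wedge_iff_exists hn _).2 ⟨F n s, (F_mem_dom hn hs).1,
    (F_im_ne_zero_iff hn hsd).2 him, ?_⟩
  rcases h with rfl | rfl
  · exact Or.inl (F_conj hsd)
  · have := F_omega_pow_mul hn 1 s
    rw [pow_one] at this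
    exact Or.inr this

lemma sinExt_mem_wedge {n : ℕ} (hn : 3 ≤ n) {w : ℂ} (hw : w ∈ wedge n) (hwO : w ∈ Omega n) :
    sinExt n w ∈ wedge n := by
  obtain ⟨t, ht, him, h⟩ := (mem_wedge_iff_exists hn w).1 hw
  have hd := Omega_subset_dom hn hwO
  have htd : t ∈ dom n := by
    rcases h with rfl | rfl
    · exact (conj_mem_dom_iff hn t).1 hd
    · exact (omega_pow_mul_mem_dom_iff hn 1 t).1 (by rwa [pow_one])
  have htl : lam n t < level n := by
    rw [Omega_eq hn] at hwO
    have hwO' : lam n w < level n := hwO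
    rcases h with rfl | rfl
    · rwa [lam_conj] at hwO'
    · rwa [← pow_one (omega n), lam_omega_pow_mul hn] at hwO'
  obtain ⟨h1, h2⟩ := base_spec hn htd
  rw [fold_of_mem_sector hn ht] at h2
  have h3 : sinExt n t = base n t := by
    conv_lhs => rw [← h2]
    exact sinExt_F_sector hn h1
  have hsd : base n t ∈ slitDomain n := mem_slitDomain_of_lam_lt hn h1 (by rwa [h2])
  refine (mem_wedge_iff_exists hn _).2 ⟨base n t, h1,
    (F_im_ne_zero_iff hn hsd).1 (by rwa [h2]), ?_⟩
  rcases h with rfl | rfl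
  · exact Or.inl (by rw [sinExt_conj hn htd, h3])
  · have := sinExt_omega_pow_mul hn 1 t
    rw [pow_one, h3] at this
    exact Or.inr this

lemma bijOn_F_wedge {n : ℕ} (hn : 3 ≤ n) : Set.BijOn (F n) (wedge n) (interior (quad n)) := by
  rw [interior_quad_eq hn]
  refine ⟨fun z hz => ⟨F_mem_wedge hn hz, (F_mem_Omega hn (wedge_subset_slitDomain hn hz)).1⟩,
    (injOn_F_slitDomain hn).mono (wedge_subset_slitDomain hn), fun w hw => ?_⟩
  exact ⟨sinExt n w, sinExt_mem_wedge hn hw.1 hw.2, (sinExt_spec hn hw.2).2⟩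

/-! ### The reflected pieces agree with `sinExt`. -/

lemma omega_mul_conj_mem_interior_quad {n : ℕ} (hn : 3 ≤ n) {q : ℂ} (hq : q ∈ interior (quad n)) :
    omega n * conj q ∈ interior (quad n) := by
  rw [interior_quad hn] at hq ⊢
  obtain ⟨h1, h2⟩ := hq
  rw [mem_wedge_iff hn] at h1
  refine ⟨(mem_wedge_iff hn _).2 ⟨?_, ?_⟩, ?_⟩
  · have h3 : omega n * conj q = conj (conj (omega n) * q) := by simp
    rw [h3, conj_im]; linarith [h1.2]
  · rw [← mul_assoc, conj_omega_mul, one_mul, conj_im]; linarith [h1.1]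
  · rwa [← pow_one (omega n), lam_omega_pow_mul hn, lam_conj]

lemma rot_subset_Omega {n : ℕ} (hn : 3 ≤ n) (k : ℕ) : rot n k (interior (quad n)) ⊆ Omega n := by
  rintro _ ⟨q, hq, rfl⟩
  rw [interior_quad hn] at hq
  rw [Omega_eq hn]
  change lam n (omega n ^ k * q) < level n
  rw [lam_omega_pow_mul hn]
  exact hq.2

/-- The base piece follows from injectivity on the wedge. Each reflection carries a piece to the
preceding one and commutes with `sinExt`, so it cancels. -/
lemma sinPiece_eq {n : ℕ} (hn : 3 ≤ n) (k : ℕ) :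
    ∀ w ∈ rot n k (interior (quad n)), sinPiece n k w = sinExt n w := by
  induction k with
  | zero =>
    rintro _ ⟨q, hq, rfl⟩
    simp only [pow_zero, one_mul, sinPiece]
    have hq' := hq
    rw [interior_quad_eq hn] at hq'
    have hex : ∃ z ∈ wedge n, F n z = q := (bijOn_F_wedge hn).surjOn hq
    refine (bijOn_F_wedge hn).injOn (Function.invFunOn_mem hex)
      (sinExt_mem_wedge hn hq'.1 hq'.2) ?_
    rw [Function.invFunOn_eq hex, (sinExt_spec hn hq'.2).2]
  | succ k ih =>
    intro w hw
    have hd : w ∈ dom n := Omega_subset_dom hn (rot_subset_Omega hn _ hw)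
    have hmem : reflection n (k + 1) w ∈ rot n k (interior (quad n)) := by
      obtain ⟨q, hq, rfl⟩ := hw
      refine ⟨omega n * conj q, omega_mul_conj_mem_interior_quad hn hq, ?_⟩
      have h := omega_pow_mul_conj n (k + 1)
      simp only [reflection, map_mul]
      linear_combination -(omega n ^ (k + 1) * conj q) * h
    change reflection n (k + 1) (sinPiece n k (reflection n (k + 1) w)) = sinExt n w
    rw [ih _ hmem, reflection, reflection, sinExt_omega_pow_mul hn, sinExt_conj hn hd,
      map_mul, conj_conj, ← mul_assoc, omega_pow_mul_conj, one_mul]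

/-- Every admissible index gives the value of `sinExt`, so disjointness of the pieces plays no role
in the choice made by `Nat.find`. -/
lemma sinOnPieces_eq {n : ℕ} (hn : 3 ≤ n) {w : ℂ} (hw : w ∈ pieces n) :
    sinOnPieces n w = sinExt n w := by
  classical
  have h : ∃ k, k < n ∧ w ∈ rot n k (interior (quad n)) := by
    simpa [pieces] using hw
  rw [sinOnPieces, dif_pos h]
  exact sinPiece_eq hn _ w (Nat.find_spec h).2

lemma mem_pieces_of_im_ne_zero {n : ℕ} (hn : 3 ≤ n) {w : ℂ} (hw : w ∈ Omega n)
    (h : (w ^ n).im ≠ 0) : w ∈ pieces n := by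
  have hfold : (fold n w).im ≠ 0 := fun h0 => by
    have h1 := fold_pow hn w
    rw [← conj_eq_iff_im] at h0
    have h2 : conj (fold n w ^ n) = fold n w ^ n := by rw [map_pow, h0]
    rw [conj_eq_iff_im, h1] at h2
    simp [upper, h] at h2
  have hl : lam n w < level n := by rw [Omega_eq hn] at hw; exact hw
  have hl' : lam n (fold n w) < level n := by
    rwa [lam_of_mem_sector hn (fold_mem_sector hn w)]
  simp only [pieces, Set.mem_iUnion, Finset.mem_range, exists_prop]
  rw [interior_quad hn]
  rcases le_total (w ^ n).im 0 with h1 | h1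
  · obtain ⟨k, hk, h2⟩ := exists_eq_omega_pow_mul_fold hn h1
    obtain ⟨j, hj, h3⟩ := exists_omega_pow_eq_succ hn k
    refine ⟨j, hj, omega n * fold n w, ⟨(mem_wedge_iff_exists hn _).2
      ⟨_, fold_mem_sector hn w, hfold, Or.inr rfl⟩, ?_⟩, ?_⟩
    · rwa [← pow_one (omega n), lam_omega_pow_mul hn]
    · change omega n ^ j * (omega n * fold n w) = w
      rw [← mul_assoc, ← h3, ← h2]
  · obtain ⟨k, hk, h2⟩ := exists_eq_omega_pow_mul_conj_fold hn h1
    refine ⟨k, hk, conj (fold n w), ⟨(mem_wedge_iff_exists hn _).2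
      ⟨_, fold_mem_sector hn w, hfold, Or.inl rfl⟩, ?_⟩, h2.symm⟩
    rwa [lam_conj]

/-- An inward shift of the sector representative makes the n-th power non-real, which places the
shifted point in an open piece. -/
lemma Omega_subset_closure_pieces {n : ℕ} (hn : 3 ≤ n) : Omega n ⊆ closure (pieces n) := by
  intro w hw
  obtain ⟨k, _, s, hs, h⟩ := exists_rep hn w
  have hpow : ∀ ε : ℝ, 0 < ε → ((s + ε * mid n) ^ n).im ≠ 0 := fun ε hε =>
    (pow_im_neg hn (shift_mem_sectorInt hn hs hε)).ne
  rcases h with rfl | rfl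
  · have ht := (tendsto_shift n s).const_mul (omega n ^ k)
    refine mem_closure_of_tendsto ht ?_
    filter_upwards [ht.eventually_mem ((isOpen_Omega n).mem_nhds hw), self_mem_nhdsWithin]
      with ε h1 h2
    refine mem_pieces_of_im_ne_zero hn h1 ?_
    rw [omega_pow_mul_pow hn]
    exact hpow ε h2
  · have ht := ((continuous_conj.tendsto s).comp (tendsto_shift n s)).const_mul (omega n ^ k)
    refine mem_closure_of_tendsto ht ?_
    filter_upwards [ht.eventually_mem ((isOpen_Omega n).mem_nhds hw), self_mem_nhdsWithin]
      with ε h1 h2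
    refine mem_pieces_of_im_ne_zero hn h1 ?_
    rw [omega_pow_mul_pow hn, Function.comp_apply, ← map_pow, conj_im, neg_ne_zero]
    exact hpow ε h2

lemma continuousAt_sinExt {n : ℕ} (hn : 3 ≤ n) {w : ℂ} (hw : w ∈ Omega n) :
    ContinuousAt (sinExt n) w :=
  ((continuousOn_sinExt hn).mono (Omega_subset_dom hn)).continuousAt
    ((isOpen_Omega n).mem_nhds hw)

lemma sinN_eq_sinExt {n : ℕ} (hn : 3 ≤ n) {w : ℂ} (hw : w ∈ Omega n) : sinN n w = sinExt n w := by
  refine extendFrom_eq (Omega_subset_closure_pieces hn hw) ?_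
  refine ((continuousAt_sinExt hn hw).tendsto.mono_left nhdsWithin_le_nhds).congr' ?_
  filter_upwards [self_mem_nhdsWithin] with z hz using (sinOnPieces_eq hn hz).symm

/-! ### Real values, conformality and the infinite vertices. -/

lemma pow_lt_one_of_lt_one {n : ℕ} (hn : 3 ≤ n) {y : ℝ} (h1 : y < 1) (h2 : Even n → -1 < y) :
    y ^ n < 1 := by
  rcases le_or_gt 0 y with h | h
  · exact pow_lt_one₀ h h1 (by omega)
  · rcases n.even_or_odd with he | ho
    · rw [← he.pow_abs]
      exact pow_lt_one₀ (abs_nonneg y) (abs_lt.2 ⟨h2 he, h1⟩) (by omega)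
    · linarith [ho.pow_neg h]

lemma F_ofReal_mem {n : ℕ} (hn : 3 ≤ n) {y : ℝ} (h1 : y < 1) (h2 : Even n → -1 < y) :
    (y : ℂ) ∈ slitDomain n ∧ F n y = realF n y := by
  refine ⟨?_, F_ofReal_eq_realF fun t ht => (pow_lt_one_of_lt_one hn ?_ fun he => ?_).le⟩
  · have h4 : (1 : ℂ) - (y : ℂ) ^ n = ((1 - y ^ n : ℝ) : ℂ) := by push_cast; ring
    rw [slitDomain, Set.mem_ofPred_eq, h4, ofReal_mem_slitPlane]
    linarith [pow_lt_one_of_lt_one hn h1 h2]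
  · exact lt_of_le_of_lt ht.2 (max_lt one_pos h1)
  · exact lt_of_lt_of_le (lt_min (by norm_num) (h2 he)) ht.1

/-- A continuous right inverse of a map with non-vanishing derivative is differentiable. This gives
analyticity across the common sides without the Schwarz reflection principle. -/
lemma analyticOnNhd_sinExt {n : ℕ} (hn : 3 ≤ n) : AnalyticOnNhd ℂ (sinExt n) (Omega n) := by
  refine DifferentiableOn.analyticOnNhd (fun w hw => ?_) (isOpen_Omega n)
  obtain ⟨h1, h2⟩ := sinExt_spec hn hw
  refine (HasDerivAt.of_local_left_inverse (continuousAt_sinExt hn hw) (hasDerivAt_F h1) ?_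
    ?_).differentiableAt.differentiableWithinAt
  · rw [← norm_ne_zero_iff, norm_K]
    have : 0 < ‖1 - sinExt n w ^ n‖ := norm_pos_iff.2 (slitPlane_ne_zero h1)
    positivity
  · filter_upwards [(isOpen_Omega n).mem_nhds hw] with z hz using (sinExt_spec hn hz).2

lemma bijOn_sinExt {n : ℕ} (hn : 3 ≤ n) : Set.BijOn (sinExt n) (Omega n) (Sigma n) := by
  rw [Sigma_eq hn]
  refine ⟨fun w hw => (sinExt_spec hn hw).1, fun w hw z hz h => ?_,
    fun z hz => ⟨F n z, F_mem_Omega hn hz⟩⟩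
  rw [← (sinExt_spec hn hw).2, h, (sinExt_spec hn hz).2]

lemma norm_sinExt {n : ℕ} (hn : 3 ≤ n) {w : ℂ} (hw : w ∈ dom n) : ‖sinExt n w‖ = ‖base n w‖ := by
  obtain ⟨k, _, ⟨_, h⟩ | ⟨_, h⟩⟩ := exists_sinExt_eq hn hw <;>
    simp [h, norm_omega]

/-- The image of the part of the sector in a ball of radius `b` is compact and misses `conj (P n)`.
Near `p` the folded point avoids it, so `base n w` lies outside the ball. -/
lemma tendsto_norm_sinN {n : ℕ} (hn : 3 ≤ n) {p : ℂ} (hp : p ∈ vertsP n) :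
    Tendsto (fun z => ‖sinN n z‖) (𝓝[Omega n] p) atTop := by
  rw [tendsto_atTop]
  intro b
  have hcomp : IsCompact (F n '' (sector n ∩ Metric.closedBall 0 b)) :=
    ((isCompact_closedBall 0 b).inter_left (isClosed_sector n)).image_of_continuousOn
      ((continuousOn_F_sector hn).mono Set.inter_subset_left)
  have hpC : fold n p ∈ (F n '' (sector n ∩ Metric.closedBall 0 b))ᶜ := fun h => by
    rw [(mem_vertsP_iff hn p).1 hp] at h
    exact conj_P_notMem_image hn (Set.image_mono Set.inter_subset_left h)
  have hev : ∀ᶠ w in 𝓝 p, fold n w ∈ (F n '' (sector n ∩ Metric.closedBall 0 b))ᶜ :=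
    (continuous_fold hn).continuousAt.eventually_mem (hcomp.isClosed.isOpen_compl.mem_nhds hpC)
  filter_upwards [hev.filter_mono nhdsWithin_le_nhds, self_mem_nhdsWithin] with w h1 h2
  have hd := Omega_subset_dom hn h2
  obtain ⟨h3, h4⟩ := base_spec hn hd
  rw [sinN_eq_sinExt hn h2, norm_sinExt hn hd]
  by_contra hlt
  push Not at hlt
  exact h1 ⟨base n w, ⟨h3, by simpa using hlt.le⟩, h4⟩

/-! ### Boundary values and the two-to-one count. -/

lemma mem_frontier_dom {n : ℕ} (hn : 3 ≤ n) {w : ℂ} (hw : w ∈ frontier (Omega n))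
    (hP : w ∉ vertsP n) : w ∈ dom n ∧ lam n w = level n := by
  rw [frontier_Omega hn] at hw
  have hw' : lam n w = level n := hw
  exact ⟨⟨hw'.le, hP⟩, hw'⟩

/-- A boundary point at which `sinN n` is finite comes from a point of `[1, ∞)`. -/
lemma exists_frontier_rep {n : ℕ} (hn : 3 ≤ n) {w : ℂ} (hw : w ∈ dom n)
    (hl : lam n w = level n) : ∃ x : ℝ, 1 ≤ x ∧ ∃ k < n, sinExt n w = omega n ^ k * x ∧
      (w = omega n ^ k * F n x ∨ w = omega n ^ k * conj (F n x)) := by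
  obtain ⟨h1, h2⟩ := base_spec hn hw
  obtain ⟨x, hx, h3⟩ := eq_one_le_of_ell_eq hn h1 (by rw [h2]; exact hl)
  obtain ⟨k, hk, ⟨h4, h5⟩ | ⟨h4, h5⟩⟩ := exists_sinExt_eq hn hw
  · exact ⟨x, hx, k, hk, by rw [h5, h3], Or.inl (by rw [← h3, h2]; exact h4)⟩
  · exact ⟨x, hx, k, hk, by rw [h5, h3, conj_ofReal], Or.inr (by rw [← h3, h2]; exact h4)⟩

lemma F_ofReal_boundary {n : ℕ} (hn : 3 ≤ n) {x : ℝ} (hx : 1 ≤ x) :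
    F n x ∈ sector n ∧ F n x ∈ dom n ∧ lam n (F n x) = level n ∧ sinExt n (F n x) = x := by
  have hs : (x : ℂ) ∈ sector n := ofReal_mem_sector hn (by linarith)
  obtain ⟨h1, h2⟩ := F_mem_dom hn hs
  refine ⟨h1, h2, ?_, sinExt_F_sector hn hs⟩
  rw [lam_of_mem_sector hn h1, ell_F_of_one_le hn hx, level]

lemma A_eq_F (n : ℕ) : A n = F n (1 : ℝ) := by rw [A_eq, ofReal_one, F_one]

/-- A real point on the line of the outer side is `A n`, the image of `1`. The two boundary
preimages of a point on an open slit are therefore distinct. -/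
lemma F_ofReal_ne_conj {n : ℕ} (hn : 3 ≤ n) {x : ℝ} (hx : 1 < x) : F n x ≠ conj (F n x) := by
  intro h
  obtain ⟨h1, _, h3, _⟩ := F_ofReal_boundary hn hx.le
  have him : (F n x).im = 0 := conj_eq_iff_im.1 h.symm
  rw [lam_of_mem_sector hn h1, ell, him, zero_mul, sub_zero, level] at h3
  have h4 : (F n x).re = realF n 1 := mul_right_cancel₀ (sin_pos hn).ne' h3
  have h5 : F n x = F n (1 : ℝ) := by
    rw [← A_eq_F, A_eq]
    exact Complex.ext h4 him
  have h6 := injOn_F_sector hn (ofReal_mem_sector hn (by linarith))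
    (ofReal_mem_sector hn zero_le_one) h5
  rw [ofReal_inj] at h6
  linarith

lemma boundary_preimage_mem {n : ℕ} (hn : 3 ≤ n) {k : ℕ} {x : ℝ} (hx : 1 < x) {u : ℂ}
    (hu : u = F n x ∨ u = conj (F n x)) :
    omega n ^ k * u ∈ frontier (Omega n) \ (vertsA n ∪ vertsP n) ∧
      sinExt n (omega n ^ k * u) = omega n ^ k * x := by
  obtain ⟨h1, h2, h3, h4⟩ := F_ofReal_boundary hn hx.le
  have hfold : fold n u = F n x := by
    rcases hu with rfl | rfl
    · exact fold_of_mem_sector hn h1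
    · rw [fold_conj, fold_of_mem_sector hn h1]
  have hsin : sinExt n u = x := by
    rcases hu with rfl | rfl
    · exact h4
    · rw [sinExt_conj hn h2, h4, conj_ofReal]
  have hd : omega n ^ k * u ∈ dom n := by
    rw [omega_pow_mul_mem_dom_iff hn, mem_dom_iff hn, hfold, ← fold_of_mem_sector hn h1,
      ← mem_dom_iff hn]
    exact h2
  refine ⟨⟨?_, ?_⟩, by rw [sinExt_omega_pow_mul hn, hsin]⟩
  · rw [frontier_Omega hn]
    change lam n (omega n ^ k * u) = level n
    rw [lam_omega_pow_mul hn, lam, hfold, ← lam_of_mem_sector hn h1, h3]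
  · rintro (⟨j, _, h5⟩ | h5)
    · have h6 := congrArg (fold n) h5
      have hA := (F_ofReal_boundary hn le_rfl).1
      rw [fold_omega_pow_mul hn, fold_omega_pow_mul hn, hfold, A_eq_F,
        fold_of_mem_sector hn hA] at h6
      have h7 := injOn_F_sector hn (ofReal_mem_sector hn (by linarith))
        (ofReal_mem_sector hn zero_le_one) h6
      rw [ofReal_inj] at h7
      linarith
    · exact hd.2 h5

/-- The modulus of the value recovers `x`, then its direction recovers `omega n ^ k`; only the side
of the slit stays free. -/
lemma setOf_boundary_preimage {n : ℕ} (hn : 3 ≤ n) {k : ℕ} {x : ℝ} (hx : 1 < x) :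
    {z | z ∈ frontier (Omega n) \ (vertsA n ∪ vertsP n) ∧ sinExt n z = omega n ^ k * x} =
      {omega n ^ k * F n x, omega n ^ k * conj (F n x)} := by
  ext z
  constructor
  · rintro ⟨⟨h1, h2⟩, h3⟩
    obtain ⟨hd, hl⟩ := mem_frontier_dom hn h1 fun h => h2 (Or.inr h)
    obtain ⟨y, hy, j, _, h4, h5⟩ := exists_frontier_rep hn hd hl
    rw [h4] at h3
    have hxy : y = x := by
      have := congrArg norm h3
      rwa [norm_mul, norm_mul, norm_omega_pow, norm_omega_pow, one_mul, one_mul, norm_real,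
        norm_real, Real.norm_of_nonneg (by linarith), Real.norm_of_nonneg (by linarith)] at this
    subst hxy
    have h6 : omega n ^ j = omega n ^ k :=
      mul_right_cancel₀ (ofReal_ne_zero.2 (by linarith : y ≠ 0)) h3
    rw [h6] at h5
    exact h5
  · rintro (rfl | rfl)
    · exact boundary_preimage_mem hn hx (Or.inl rfl)
    · exact boundary_preimage_mem hn hx (Or.inr rfl)

lemma sinExt_mem_openSlits {n : ℕ} (hn : 3 ≤ n) {w : ℂ}
    (hw : w ∈ frontier (Omega n) \ (vertsA n ∪ vertsP n)) : sinExt n w ∈ openSlits n := by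
  obtain ⟨hd, hl⟩ := mem_frontier_dom hn hw.1 fun h => hw.2 (Or.inr h)
  obtain ⟨x, hx, k, hk, h4, h5⟩ := exists_frontier_rep hn hd hl
  have hx1 : x ≠ 1 := by
    rintro rfl
    rw [← A_eq_F, A_conj, or_self] at h5
    exact hw.2 (Or.inl ⟨k, hk, h5⟩)
  simp only [openSlits, rot, Set.mem_iUnion, Finset.mem_range, exists_prop, Set.mem_image,
    Set.mem_Ioi]
  exact ⟨k, hk, x, ⟨x, lt_of_le_of_ne hx (Ne.symm hx1), rfl⟩, h4.symm⟩

end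

end GenSine

theorem mainTheorem1 (n : ℕ) (hn : 3 ≤ n) :
    -- `sin_n` is the analytic continuation to `Ω_n` of the inverse of `F_n`
    (Set.BijOn (GenSine.F n) (GenSine.wedge n) (interior (GenSine.quad n)) ∧
      (∀ w ∈ interior (GenSine.quad n),
        GenSine.sinN n w ∈ GenSine.wedge n ∧ GenSine.F n (GenSine.sinN n w) = w) ∧
      (∀ y : ℝ, y < 1 → (Even n → -1 < y) →
        ((GenSine.realF n y : ℝ) : ℂ) ∈ GenSine.Omega n ∧
        GenSine.sinN n ((GenSine.realF n y : ℝ) : ℂ) = (y : ℂ))) ∧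
    -- it is a conformal equivalence from `Ω_n` onto `Σ_n`
    (AnalyticOnNhd ℂ (GenSine.sinN n) (GenSine.Omega n) ∧
      Set.BijOn (GenSine.sinN n) (GenSine.Omega n) (GenSine.Sigma n) ∧
      AnalyticOnNhd ℂ (Function.invFunOn (GenSine.sinN n) (GenSine.Omega n))
        (GenSine.Sigma n)) ∧
    -- it tends to infinity at the points `ω_n^k P_n` (which are boundary points of `Ω_n`)
    (∀ k < n, GenSine.omega n ^ k * GenSine.P n ∈ frontier (GenSine.Omega n) ∧
      Filter.Tendsto (fun z => ‖GenSine.sinN n z‖)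
        (nhdsWithin (GenSine.omega n ^ k * GenSine.P n) (GenSine.Omega n)) Filter.atTop) ∧
    -- the continuous extension to the remaining boundary points
    (∃ g : ℂ → ℂ,
      ContinuousOn g (closure (GenSine.Omega n) \ GenSine.vertsP n) ∧
      Set.EqOn g (GenSine.sinN n) (GenSine.Omega n) ∧
      (∀ k < n, GenSine.omega n ^ k * GenSine.A n ∈
          frontier (GenSine.Omega n) \ GenSine.vertsP n ∧
        g (GenSine.omega n ^ k * GenSine.A n) = GenSine.omega n ^ k) ∧
      Set.MapsTo g (frontier (GenSine.Omega n) \ (GenSine.vertsA n ∪ GenSine.vertsP n))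
        (GenSine.openSlits n) ∧
      (∀ w ∈ GenSine.openSlits n,
        {z | z ∈ frontier (GenSine.Omega n) \ (GenSine.vertsA n ∪ GenSine.vertsP n) ∧
          g z = w}.ncard = 2)) := by
  open GenSine in
  have hN : Set.EqOn (sinExt n) (sinN n) (Omega n) := fun w hw => (sinN_eq_sinExt hn hw).symm
  refine ⟨⟨GenSine.bijOn_F_wedge hn, fun w hw => ?_, fun y h1 h2 => ?_⟩, ⟨?_, ?_, ?_⟩,
    fun k hk => ⟨?_, ?_⟩, GenSine.sinExt n, ?_, hN, fun k hk => ⟨⟨?_, ?_⟩, ?_⟩,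
    fun w hw => GenSine.sinExt_mem_openSlits hn hw, fun w hw => ?_⟩
  · rw [GenSine.interior_quad_eq hn] at hw
    rw [← hN hw.2]
    exact ⟨GenSine.sinExt_mem_wedge hn hw.1 hw.2, (GenSine.sinExt_spec hn hw.2).2⟩
  · obtain ⟨h3, h4⟩ := GenSine.F_ofReal_mem hn h1 h2
    obtain ⟨h5, h6⟩ := GenSine.F_mem_Omega hn h3
    rw [← h4, ← hN h5]
    exact ⟨h5, h6⟩
  · exact (GenSine.analyticOnNhd_sinExt hn).congr (GenSine.isOpen_Omega n) hN
  · exact (GenSine.bijOn_sinExt hn).congr hN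
  · have hS : IsOpen (GenSine.Sigma n) := by
      rw [GenSine.Sigma_eq hn]; exact GenSine.isOpen_slitDomain n
    have hb := (GenSine.bijOn_sinExt hn).congr hN
    have hF : AnalyticOnNhd ℂ (GenSine.F n) (GenSine.Sigma n) := by
      refine DifferentiableOn.analyticOnNhd (fun z hz => ?_) hS
      rw [GenSine.Sigma_eq hn] at hz
      exact (GenSine.hasDerivAt_F hz).differentiableAt.differentiableWithinAt
    -- The abstract inverse coincides on the slit plane with `F n`, which is analytic there.
    refine hF.congr hS fun z hz => ?_
    have hex : ∃ w ∈ GenSine.Omega n, GenSine.sinN n w = z := hb.surjOn hz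
    rw [GenSine.Sigma_eq hn] at hz
    obtain ⟨h1, h2⟩ := GenSine.F_mem_Omega hn hz
    refine hb.injOn h1 (Function.invFunOn_mem hex) ?_
    rw [Function.invFunOn_eq hex, ← hN h1, h2]
  · rw [GenSine.frontier_Omega hn]
    exact GenSine.lam_of_mem_vertsP hn ⟨k, hk, rfl⟩
  · exact GenSine.tendsto_norm_sinN hn ⟨k, hk, rfl⟩
  · rw [GenSine.closure_Omega hn]
    exact GenSine.continuousOn_sinExt hn
  · rw [GenSine.frontier_Omega hn, GenSine.A_eq_F]
    change GenSine.lam n (GenSine.omega n ^ k * _) = GenSine.level n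
    rw [GenSine.lam_omega_pow_mul hn]
    exact (GenSine.F_ofReal_boundary hn le_rfl).2.2.1
  · rw [GenSine.A_eq_F]
    exact ((GenSine.omega_pow_mul_mem_dom_iff hn k _).2
      (GenSine.F_ofReal_boundary hn le_rfl).2.1).2
  · rw [GenSine.sinExt_omega_pow_mul hn, GenSine.A_eq_F,
      (GenSine.F_ofReal_boundary hn le_rfl).2.2.2, Complex.ofReal_one, mul_one]
  · simp only [GenSine.openSlits, GenSine.rot, Set.mem_iUnion, Finset.mem_range, exists_prop,
      Set.mem_image, Set.mem_Ioi] at hw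
    obtain ⟨k, _, _, ⟨x, hx, rfl⟩, rfl⟩ := hw
    rw [GenSine.setOf_boundary_preimage hn hx]
    refine Set.ncard_pair fun h => GenSine.F_ofReal_ne_conj hn hx ?_
    exact mul_left_cancel₀ (pow_ne_zero k (GenSine.omega_ne_zero n)) h
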